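/- Let $N\ge 1$, let $\eta_1,\dots,\eta_{2N}$ be points of the unit circle with $0<\arg\eta_1<\dots<\arg\eta_{2N}<\pi$, and let $1\le \ell\le N$. Call the arcs $[\eta_{2k-1},\eta_{2k}]$ ($1\le k\le \ell$) of the unit circle and their complex conjugates the bands, and the arcs $[\eta_{2k},\eta_{2k+1}]$ ($1\le k<\ell$), the last gap $[\eta_{2\ell},-1]$, and their complex conjugates the gaps. Let $$\hat R_\ell(z)=\prod_{j=1}^{2\ell}\sqrt{(z-\eta_j)(z-\eta_j^{-1})}$$ with branch cuts along the bands and $\hat R_\ell(z)\sim z^{2\ell}$ as $z\to\infty$. Let $$\hat P_\ell(z)=z^{-2}\Big(\sum_{j=0}^{\ell}B_j(z^{2\ell+2-j}+z^j)+B_{\ell+1}z^{\ell+1}\Big),\qquad \hat Q_\ell(z)=z^{-3}\Big(\sum_{j=0}^{\ell+1}C_j(z^{2\ell+4-j}+z^j)+C_{\ell+2}z^{\ell+2}\Big),$$ where the $B_j,C_j$ are real, $B_0=C_0=1$, $B_1=C_1=-\sum_{j=1}^{2\ell}\operatorname{Re}\eta_j$, $C_2=\frac18\big[(\sum_{j=1}^{2\ell}(\eta_j+\eta_j^{-1}))^2-2\sum_{j=1}^{2\ell}(\eta_j^2+\eta_j^{-2})\big]$,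 and the integrals of $\hat P_\ell\,dz/\hat R_\ell$ and of $\hat Q_\ell\,dz/\hat R_\ell$ over every gap vanish. Put $$V(z;\xi)=\frac{\xi}{2}\int_{\eta_1}^z\frac{\hat P_\ell(s)}{\hat R_\ell(s)}\,ds-\int_{\eta_1}^z\frac{\hat Q_\ell(s)}{\hat R_\ell(s)}\,ds ,\qquad \xi_{2\ell}=\frac{2\hat Q_\ell(\eta_{2\ell})}{\hat P_\ell(\eta_{2\ell})},$$ where the integration is in $\mathbb C\setminus\{0\}$ cut along the arcs $\arg\eta_1\le|\arg z|\le\pi$ of the unit circle, and where on these arcs $V$ denotes the boundary value from outside the unit disc. Then these conditions determine the coefficients $B_j$ and $C_j$ uniquely, and there is a finite $\xi_0<\xi_{2\ell}$ such that the following holds on the open last gap $\gamma=\{e^{i\theta}:\arg\eta_{2\ell}<\theta<\pi\}$, where derivatives are taken with respect to $\theta$. 1. For every $\xi<\xi_{2\ell}$, $\operatorname{Im}V(\cdot;\xi)$ is $C^2$ on $\gamma$ and has a nondegenerate, negative, strict global minimum on $\gamma$ at a point $\beta(\xi)$. If $\xi_0<\xi<\xi_{2\ell}$, then $\operatorname{Im}V(\cdot;\xi)$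 changes sign exactly once on $\gamma$, at a point $\rho(\xi)$, from negative to positive as $\gamma$ is traversed counterclockwise; it has a nondegenerate, positive, strict global maximum on $\gamma$ at a point $s(\xi)$; it has no critical points on $\gamma$ other than $\beta(\xi)$ and $s(\xi)$; and $\arg\beta(\xi)<\arg\rho(\xi)<\arg s(\xi)$. If $\xi\le\xi_0$, then $\operatorname{Im}V(\cdot;\xi)<0$ on all of $\gamma$ and $\beta(\xi)$ is its only critical point there. 2. $\arg\beta(\xi)$ is strictly decreasing in $\xi$ on $(-\infty,\xi_{2\ell})$, $\arg s(\xi)$ and $\arg\rho(\xi)$ are strictly decreasing in $\xi$ on $(\xi_0,\xi_{2\ell})$, and $$\lim_{\xi\to\xi_0^+}s(\xi)=\lim_{\xi\to\xi_0^+}\rho(\xi)=-1 .$$ 3. If $\ell<N$, there is exactly one $\xi_{2\ell+1}\in(\xi_0,\xi_{2\ell})$ with $\rho(\xi_{2\ell+1})=\eta_{2\ell+1}$, and $$\xi_{2\ell+1}=2\int_{\eta_{2\ell}}^{\eta_{2\ell+1}}\frac{\hat Q_\ell(z)\,dz}{\hat R_\ell(z)}\bigg/\int_{\eta_{2\ell}}^{\eta_{2\ell+1}}\frac{\hat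 P_\ell(z)\,dz}{\hat R_\ell(z)},$$ the integrals being taken along the last gap. -/

import Mathlib

namespace DarkGas

noncomputable section

/-- `2N` branch points `η₁, …, η_{2N}` on the open upper unit semicircle,
with `0 < arg η₁ < ⋯ < arg η_{2N} < π`.  Only the entries with index `1, …, 2N` are used. -/
structure IsSpectrum (N : ℕ) (η : ℕ → ℂ) : Prop where
  norm_eq : ∀ j ∈ Set.Icc 1 (2 * N), ‖η j‖ = 1
  arg_pos : ∀ j ∈ Set.Icc 1 (2 * N), 0 < (η j).arg
  arg_lt : ∀ j ∈ Set.Icc 1 (2 * N), (η j).arg < Real.pi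
  arg_strictMono : StrictMonoOn (fun j => (η j).arg) (Set.Icc 1 (2 * N))

/-- For `a, b` on the unit circle with `0 < arg b - arg a < 2π`: the branch of
`√((z - a)(z - b))` whose cut is the arc of the unit circle from `a` counterclockwise to `b`
and which is `∼ z` at infinity.  (The Möbius map `z ↦ e^{i(arg b - arg a)/2} (z - a)/(z - b)` sends
that arc onto the negative real axis, and the exterior of the disc to the upper half plane, so
on the cut the function equals its boundary value from the exterior of the disc.) -/
def arcSqrt (a b z : ℂ) : ℂ :=
  (z - b) * Complex.exp (-(((b.arg - a.arg) / 4 : ℝ) : ℂ) * Complex.I) *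
    ((z - a) / (z - b) * Complex.exp ((((b.arg - a.arg) / 2 : ℝ) : ℂ) * Complex.I)) ^ (1 / 2 : ℂ)

/-- `R̂_ℓ(z) = ∏_{j=1}^{2ℓ} √((z - η_j)(z - η_j⁻¹))` with cuts along the bands
`[η_{2k-1}, η_{2k}]`, `k = 1, …, ℓ`, and their complex conjugates, `R̂_ℓ(z) ∼ z^{2ℓ}` at infinity.
On the bands it takes its boundary value from the exterior of the unit disc. -/
def Rhat (η : ℕ → ℂ) (ℓ : ℕ) (z : ℂ) : ℂ :=
  ∏ k ∈ Finset.Icc 1 ℓ,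
    (arcSqrt (η (2 * k - 1)) (η (2 * k)) z *
      arcSqrt (starRingEnd ℂ (η (2 * k))) (starRingEnd ℂ (η (2 * k - 1))) z)

/-- The palindromic polynomial `∑_{j<m} B_j z^{2m-j} + ∑_{j<m} B_j z^j + B_m z^m`. -/
def palindrome (m : ℕ) (B : Fin (m + 1) → ℝ) (z : ℂ) : ℂ :=
  ∑ j : Fin m, (B j.castSucc : ℂ) * z ^ (2 * m - (j : ℕ)) +
    ∑ j : Fin m, (B j.castSucc : ℂ) * z ^ (j : ℕ) + (B (Fin.last m) : ℂ) * z ^ m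

/-- The numerator `P̂_ℓ` of the first differential, with coefficients `B₀, …, B_{ℓ+1}`. -/
def Phat (ℓ : ℕ) (B : Fin (ℓ + 2) → ℝ) (z : ℂ) : ℂ := palindrome (ℓ + 1) B z / z ^ 2

/-- The numerator `Q̂_ℓ` of the second differential, with coefficients `C₀, …, C_{ℓ+2}`. -/
def Qhat (ℓ : ℕ) (C : Fin (ℓ + 3) → ℝ) (z : ℂ) : ℂ := palindrome (ℓ + 2) C z / z ^ 3

/-- `∫ F(z) dz` along the arc `z = e^{iθ}`, `θ` from `a` to `b`. -/
def arcIntegral (F : ℂ → ℂ) (a b : ℝ) : ℂ :=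
  ∫ θ in a..b, F (Complex.exp (θ * Complex.I)) * (Complex.I * Complex.exp (θ * Complex.I))

/-- The argument of the final point of the `k`-th gap: the gaps are `[η_{2k}, η_{2k+1}]` for
`1 ≤ k < ℓ` and `[η_{2ℓ}, -1]` for `k = ℓ`. -/
def gapEnd (η : ℕ → ℂ) (ℓ k : ℕ) : ℝ := if k < ℓ then (η (2 * k + 1)).arg else Real.pi

/-- All integrals of `F dz` over the gaps and over the conjugate gaps vanish. -/
def GapIntegralsVanish (η : ℕ → ℂ) (ℓ : ℕ) (F : ℂ → ℂ) : Prop :=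
  ∀ k ∈ Set.Icc 1 ℓ,
    arcIntegral F (η (2 * k)).arg (gapEnd η ℓ k) = 0 ∧
      arcIntegral F (-gapEnd η ℓ k) (-(η (2 * k)).arg) = 0

/-- The conditions that determine the real coefficients of `P̂_ℓ`. -/
structure IsFirstCoeffs (η : ℕ → ℂ) (ℓ : ℕ) (B : Fin (ℓ + 2) → ℝ) : Prop where
  zero : B 0 = 1
  one : B 1 = -∑ j ∈ Finset.Icc 1 (2 * ℓ), (η j).re
  gaps : GapIntegralsVanish η ℓ (fun z => Phat ℓ B z / Rhat η ℓ z)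

/-- The conditions that determine the real coefficients of `Q̂_ℓ`.  Here
`η_j + η_j⁻¹ = 2 Re η_j` and `η_j² + η_j⁻² = 2 Re η_j²`, so the value of `C₂` reads
`⅛ [(∑ (η_j + η_j⁻¹))² - 2 ∑ (η_j² + η_j⁻²)]`, the sums being over `1 ≤ j ≤ 2ℓ`. -/
structure IsSecondCoeffs (η : ℕ → ℂ) (ℓ : ℕ) (C : Fin (ℓ + 3) → ℝ) : Prop where
  zero : C 0 = 1
  one : C 1 = -∑ j ∈ Finset.Icc 1 (2 * ℓ), (η j).re
  two : C 2 = 1 / 8 * ((∑ j ∈ Finset.Icc 1 (2 * ℓ), 2 * (η j).re) ^ 2 -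
    2 * ∑ j ∈ Finset.Icc 1 (2 * ℓ), 2 * (η j ^ 2).re)
  gaps : GapIntegralsVanish η ℓ (fun z => Qhat ℓ C z / Rhat η ℓ z)

/-- The path `t ↦ exp((1 - t) log a + t log z)`, `0 ≤ t ≤ 1`, from `a` to `z`
(principal logarithms).  If `|a| = 1`, it stays for `t > 0` inside the open unit disc when `|z| < 1`,
outside the closed unit disc when `|z| > 1`, and on the unit circle when `|z| = 1`; it avoids `0`. -/
def spiral (a z : ℂ) (t : ℝ) : ℂ :=
  Complex.exp ((1 - (t : ℂ)) * Complex.log a + (t : ℂ) * Complex.log z)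

/-- `∫_a^z F(s) ds` along `spiral a z`. -/
def spiralIntegral (F : ℂ → ℂ) (a z : ℂ) : ℂ :=
  ∫ t in (0 : ℝ)..1, F (spiral a z t) * (spiral a z t * (Complex.log z - Complex.log a))

/-- `φ̂⁽¹⁾_ℓ(z) = ∫_{η₁}^z P̂_ℓ/R̂_ℓ ds`.  For `z` in the plane without `0` and without the arcs
`arg η₁ ≤ |arg z| ≤ π` of the unit circle, the path of integration lies (apart from its starting
point) in that domain; for `z` on those arcs the value is the boundary value from the exterior
of the unit disc. -/
def phi1 (η : ℕ → ℂ) (ℓ : ℕ) (B : Fin (ℓ + 2) → ℝ) (z : ℂ) : ℂ :=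
  spiralIntegral (fun s => Phat ℓ B s / Rhat η ℓ s) (η 1) z

/-- `φ̂⁽²⁾_ℓ(z) = ∫_{η₁}^z Q̂_ℓ/R̂_ℓ ds`, with the same paths as `phi1`. -/
def phi2 (η : ℕ → ℂ) (ℓ : ℕ) (C : Fin (ℓ + 3) → ℝ) (z : ℂ) : ℂ :=
  spiralIntegral (fun s => Qhat ℓ C s / Rhat η ℓ s) (η 1) z

/-- `V(z; ξ) = (ξ/2) φ̂⁽¹⁾_ℓ(z) - φ̂⁽²⁾_ℓ(z)`. -/
def V (η : ℕ → ℂ) (ℓ : ℕ) (B : Fin (ℓ + 2) → ℝ) (C : Fin (ℓ + 3) → ℝ) (ξ : ℝ) (z : ℂ) : ℂ :=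
  (ξ : ℂ) / 2 * phi1 η ℓ B z - phi2 η ℓ C z

/-- The transition value `ξ_{2ℓ} = 2 Q̂_ℓ(η_{2ℓ}) / P̂_ℓ(η_{2ℓ})` (this quotient is real). -/
def xiEven (η : ℕ → ℂ) (ℓ : ℕ) (B : Fin (ℓ + 2) → ℝ) (C : Fin (ℓ + 3) → ℝ) : ℝ :=
  (2 * Qhat ℓ C (η (2 * ℓ)) / Phat ℓ B (η (2 * ℓ))).re

/-- `2 ∫ Q̂_ℓ/R̂_ℓ dz / ∫ P̂_ℓ/R̂_ℓ dz`, both integrals along the arc from `η_{2ℓ}` to `η_{2ℓ+1}`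
(this quotient is real). -/
def xiOdd (η : ℕ → ℂ) (ℓ : ℕ) (B : Fin (ℓ + 2) → ℝ) (C : Fin (ℓ + 3) → ℝ) : ℝ :=
  (2 * arcIntegral (fun z => Qhat ℓ C z / Rhat η ℓ z) (η (2 * ℓ)).arg (η (2 * ℓ + 1)).arg /
    arcIntegral (fun z => Phat ℓ B z / Rhat η ℓ z) (η (2 * ℓ)).arg (η (2 * ℓ + 1)).arg).re

/-- The interior of the last gap, the open arc of the unit circle from `η_{2ℓ}` to `-1`. -/
def lastGap (η : ℕ → ℂ) (ℓ : ℕ) : Set ℂ :=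
  {z | ‖z‖ = 1 ∧ (η (2 * ℓ)).arg < z.arg ∧ z.arg < Real.pi}

/-- `Im V(e^{iθ}; ξ)` as a function of the angle. -/
def imV (η : ℕ → ℂ) (ℓ : ℕ) (B : Fin (ℓ + 2) → ℝ) (C : Fin (ℓ + 3) → ℝ) (ξ θ : ℝ) : ℝ :=
  (V η ℓ B C ξ (Complex.exp (θ * Complex.I))).im

end

end DarkGas

open DarkGas

/-!
On each arc of the unit circle the boundary value of `Rhat` is a constant phase times a positive
function of `θ`, so both differentials are, up to that phase, real densities
`p (cos θ) * w θ` and `q (cos θ) * w θ` with polynomials `p`, `q` of degrees `ℓ + 1` and `ℓ + 2`.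
The prescribed values of `B₁`, `C₁`, `C₂` say exactly that the residues at the origin vanish.
Cauchy's theorem inside the disc then turns the vanishing of the integrals over the `ℓ` gaps into
the vanishing of the integral over the arc around `1` as well, so every combination of `p` and `q`
has a root in each of `ℓ + 1` disjoint intervals. Counting roots gives existence and uniqueness of
the coefficients and excludes double roots; hence the Wronskian of `p` and `q` has no zeros and
`q / p` is monotone away from the roots of `p`. This controls the zeros of the slope of `Im V` on
the last gap and thereby its shape: a single valley followed by at most one peak, both moving
monotonically with `ξ`.
-/

namespace DarkGas

section Chebyshev

open Polynomial

/-- The polynomial `K_n` with `K_n (cos θ) = e^{inθ} + e^{-inθ}` for `n ≥ 1` and `K_0 = 1`; the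
exception at `0` matches the unpaired middle coefficient of a palindrome. -/
noncomputable def chebBasis (n : ℕ) : ℝ[X] := if n = 0 then 1 else C 2 * Chebyshev.T ℝ n

/-- The polynomial in `cos θ` which represents `e^{-imθ} palindrome m B (e^{iθ})`, as a linear
function of the coefficients `B`. -/
noncomputable def chebPoly (m : ℕ) : (Fin (m + 1) → ℝ) →ₗ[ℝ] ℝ[X] :=
  Fintype.linearCombination ℝ fun i : Fin (m + 1) => chebBasis (m - i)

lemma chebPoly_apply (m : ℕ) (B : Fin (m + 1) → ℝ) :
    chebPoly m B = ∑ i : Fin (m + 1), C (B i) * chebBasis (m - i) := by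
  simp only [chebPoly, Fintype.linearCombination_apply, smul_eq_C_mul]

lemma natDegree_chebBasis (n : ℕ) : (chebBasis n).natDegree = n := by
  unfold chebBasis
  split_ifs with h
  · simp [h]
  · rw [natDegree_C_mul two_ne_zero, Chebyshev.natDegree_T, Int.natAbs_natCast]

lemma coeff_chebBasis_self (n : ℕ) : (chebBasis n).coeff n = 2 ^ n := by
  unfold chebBasis
  split_ifs with h
  · simp [h]
  · have hlead := Chebyshev.leadingCoeff_T ℝ (n : ℤ)
    rw [leadingCoeff, Chebyshev.natDegree_T, Int.natAbs_natCast] at hlead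
    rw [coeff_C_mul, hlead, ← pow_succ']
    congr 1
    omega

section VanishingInitialCoeffs

variable {m : ℕ} {B : Fin (m + 1) → ℝ} {j : Fin (m + 1)}

lemma natDegree_chebPoly_le (h : ∀ i < j, B i = 0) : (chebPoly m B).natDegree ≤ m - j := by
  rw [chebPoly_apply]
  refine natDegree_sum_le_of_forall_le _ _ fun i _ => ?_
  rcases lt_or_ge i j with hij | hij
  · simp [h i hij]
  · refine (natDegree_C_mul_le _ _).trans ?_
    rw [natDegree_chebBasis]
    exact Nat.sub_le_sub_left hij m

lemma coeff_chebPoly (h : ∀ i < j, B i = 0) :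
    (chebPoly m B).coeff (m - j) = B j * 2 ^ (m - (j : ℕ)) := by
  rw [chebPoly_apply, finsetSum_coeff, Finset.sum_eq_single j]
  · rw [coeff_C_mul, coeff_chebBasis_self]
  · intro i _ hij
    rcases lt_or_gt_of_ne hij with hij | hij
    · simp [h i hij]
    · rw [coeff_C_mul, coeff_eq_zero_of_natDegree_lt, mul_zero]
      rw [natDegree_chebBasis]
      exact Nat.sub_lt_sub_left (by omega) hij
  · simp

end VanishingInitialCoeffs

section Monic

variable {m : ℕ} {B : Fin (m + 1) → ℝ}

lemma coeff_chebPoly_of_zero_eq_one (h : B 0 = 1) : (chebPoly m B).coeff m = 2 ^ m := by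
  simpa [h] using coeff_chebPoly (B := B) (j := 0) fun i hi => absurd hi (Fin.not_lt_zero i)

lemma natDegree_chebPoly_of_zero_eq_one (h : B 0 = 1) : (chebPoly m B).natDegree = m := by
  refine le_antisymm ?_ (le_natDegree_of_ne_zero ?_)
  · simpa using natDegree_chebPoly_le (B := B) (j := 0) fun i hi => absurd hi (Fin.not_lt_zero i)
  · rw [coeff_chebPoly_of_zero_eq_one h]
    positivity

lemma leadingCoeff_chebPoly_pos (h : B 0 = 1) : 0 < (chebPoly m B).leadingCoeff := by
  rw [leadingCoeff, natDegree_chebPoly_of_zero_eq_one h, coeff_chebPoly_of_zero_eq_one h]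
  positivity

end Monic

lemma chebPoly_injective (m : ℕ) : Function.Injective (chebPoly m) := by
  refine (injective_iff_map_eq_zero _).2 fun B hB => funext fun j => ?_
  induction j using WellFoundedLT.induction with
  | ind j ih =>
    have hj := coeff_chebPoly ih
    rw [hB, coeff_zero, eq_comm, mul_eq_zero] at hj
    exact hj.resolve_right (by positivity)

lemma eval_chebBasis_cos {n : ℕ} (hn : n ≠ 0) (θ : ℝ) :
    (((chebBasis n).eval (Real.cos θ) : ℝ) : ℂ) =
      Complex.exp (n * θ * Complex.I) + Complex.exp (-(n * θ * Complex.I)) := by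
  simp only [chebBasis, hn, if_false, eval_mul, eval_C, Chebyshev.T_real_cos, Int.cast_natCast]
  push_cast
  rw [Complex.two_cos, neg_mul]

lemma palindrome_exp (m : ℕ) (B : Fin (m + 1) → ℝ) (θ : ℝ) :
    palindrome m B (Complex.exp (θ * Complex.I)) =
      Complex.exp (θ * Complex.I) ^ m * ((chebPoly m B).eval (Real.cos θ) : ℝ) := by
  rw [palindrome, chebPoly_apply, eval_finsetSum, Fin.sum_univ_castSucc, ← Finset.sum_add_distrib,
    Complex.ofReal_add, Complex.ofReal_sum, mul_add, Finset.mul_sum]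
  congr 1
  · refine Finset.sum_congr rfl fun j _ => ?_
    have hjm : (j : ℕ) < m := j.2
    have hhigh : Complex.exp (θ * Complex.I) ^ (2 * m - (j : ℕ)) =
        Complex.exp (θ * Complex.I) ^ m * Complex.exp ((m - j : ℕ) * θ * Complex.I) := by
      rw [mul_assoc, Complex.exp_nat_mul, ← pow_add, show 2 * m - (j : ℕ) = m + (m - j) by omega]
    have hlow : Complex.exp (θ * Complex.I) ^ (j : ℕ) =
        Complex.exp (θ * Complex.I) ^ m * Complex.exp (-((m - j : ℕ) * θ * Complex.I)) := by
      rw [mul_assoc, Complex.exp_neg, Complex.exp_nat_mul, eq_mul_inv_iff_mul_eq₀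
        (pow_ne_zero _ (Complex.exp_ne_zero _)), ← pow_add, Nat.add_sub_cancel' hjm.le]
    rw [eval_mul, eval_C, Complex.ofReal_mul, Fin.val_castSucc,
      eval_chebBasis_cos (Nat.sub_ne_zero_of_lt hjm), hhigh, hlow]
    ring
  · simp [chebBasis, mul_comm]

end Chebyshev

section Nodes

/-- The arguments `0 < arg η₁ < ⋯ < arg η_{2ℓ} < π` of the endpoints of the bands and gaps in the
upper half plane, padded with `t₀ = 0` and `t_{2ℓ+1} = π`: the gaps are `(t_i, t_{i+1})` with `i`
even, the bands those with `i` odd. -/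
structure IsNodes (ℓ : ℕ) (t : ℕ → ℝ) : Prop where
  zero : t 0 = 0
  last : t (2 * ℓ + 1) = Real.pi
  lt : ∀ j ≤ 2 * ℓ, t j < t (j + 1)

/-- The positive function `1 / |∏ (cos θ - cos t_j)|^{1/2}`, which is `2^ℓ / |R̂_ℓ(e^{iθ})|`. -/
noncomputable def weight (ℓ : ℕ) (t : ℕ → ℝ) (θ : ℝ) : ℝ :=
  ∏ j ∈ Finset.Icc 1 (2 * ℓ), (√|Real.cos θ - Real.cos (t j)|)⁻¹

lemma weight_nonneg (ℓ : ℕ) (t : ℕ → ℝ) (θ : ℝ) : 0 ≤ weight ℓ t θ :=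
  Finset.prod_nonneg fun _ _ => by positivity

lemma measurable_weight (ℓ : ℕ) (t : ℕ → ℝ) : Measurable (weight ℓ t) := by
  unfold weight
  fun_prop

lemma weight_two_pi_sub (ℓ : ℕ) (t : ℕ → ℝ) (θ : ℝ) :
    weight ℓ t (2 * Real.pi - θ) = weight ℓ t θ := by
  simp only [weight, Real.cos_two_pi_sub]

namespace IsNodes

variable {ℓ : ℕ} {t : ℕ → ℝ}

lemma strictMonoOn (h : IsNodes ℓ t) : StrictMonoOn t (Set.Iic (2 * ℓ + 1)) :=
  strictMonoOn_of_lt_add_one Set.ordConnected_Iic fun j _ _ hj => h.lt j (by simpa using hj)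

lemma le_of_le (h : IsNodes ℓ t) {i j : ℕ} (hij : i ≤ j) (hj : j ≤ 2 * ℓ + 1) : t i ≤ t j :=
  h.strictMonoOn.monotoneOn (Set.mem_Iic.2 (hij.trans hj)) hj hij

lemma lt_of_lt (h : IsNodes ℓ t) {i j : ℕ} (hij : i < j) (hj : j ≤ 2 * ℓ + 1) : t i < t j :=
  h.strictMonoOn (Set.mem_Iic.2 (hij.le.trans hj)) hj hij

lemma nonneg (h : IsNodes ℓ t) {j : ℕ} (hj : j ≤ 2 * ℓ + 1) : 0 ≤ t j :=
  h.zero ▸ h.le_of_le j.zero_le hj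

lemma le_pi (h : IsNodes ℓ t) {j : ℕ} (hj : j ≤ 2 * ℓ + 1) : t j ≤ Real.pi :=
  h.last ▸ h.le_of_le hj le_rfl

lemma pos (h : IsNodes ℓ t) {j : ℕ} (hj₁ : 1 ≤ j) (hj : j ≤ 2 * ℓ + 1) : 0 < t j :=
  h.zero ▸ h.lt_of_lt hj₁ hj

lemma lt_pi (h : IsNodes ℓ t) {j : ℕ} (hj : j ≤ 2 * ℓ) : t j < Real.pi :=
  h.last ▸ h.lt_of_lt (Nat.lt_succ_of_le hj) le_rfl

lemma mem_Icc_zero_pi (h : IsNodes ℓ t) {j : ℕ} (hj : j ≤ 2 * ℓ + 1) : t j ∈ Set.Icc 0 Real.pi :=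
  ⟨h.nonneg hj, h.le_pi hj⟩

lemma mem_Ioo_zero_pi (h : IsNodes ℓ t) {i : ℕ} (hi : i ≤ 2 * ℓ) {θ : ℝ}
    (hθ : θ ∈ Set.Ioo (t i) (t (i + 1))) : θ ∈ Set.Ioo 0 Real.pi :=
  ⟨(h.nonneg (by omega)).trans_lt hθ.1, hθ.2.trans_le (h.le_pi (by omega))⟩

lemma ne_of_mem_Ioo (h : IsNodes ℓ t) {i j : ℕ} (hi : i ≤ 2 * ℓ) (hj : j ≤ 2 * ℓ + 1) {θ : ℝ}
    (hθ : θ ∈ Set.Ioo (t i) (t (i + 1))) : θ ≠ t j := by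
  rcases Nat.lt_or_ge i j with hij | hij
  · exact (hθ.2.trans_le (h.le_of_le hij hj)).ne
  · exact ((h.le_of_le hij (by omega)).trans_lt hθ.1).ne'

lemma cos_ne (h : IsNodes ℓ t) {i j : ℕ} (hi : i ≤ 2 * ℓ) (hj : j ≤ 2 * ℓ + 1) {θ : ℝ}
    (hθ : θ ∈ Set.Ioo (t i) (t (i + 1))) : Real.cos θ ≠ Real.cos (t j) := fun hcos =>
  h.ne_of_mem_Ioo hi hj hθ
    (Real.injOn_cos (Set.Ioo_subset_Icc_self (h.mem_Ioo_zero_pi hi hθ)) (h.mem_Icc_zero_pi hj) hcos)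

lemma weight_pos (h : IsNodes ℓ t) {i : ℕ} (hi : i ≤ 2 * ℓ) {θ : ℝ}
    (hθ : θ ∈ Set.Ioo (t i) (t (i + 1))) : 0 < weight ℓ t θ :=
  Finset.prod_pos fun _ hj => inv_pos.2 <| Real.sqrt_pos.2 <| abs_pos.2 <| sub_ne_zero.2 <|
    h.cos_ne hi ((Finset.mem_Icc.1 hj).2.trans (Nat.le_succ _)) hθ

end IsNodes

end Nodes

section SquareRootOnCircle

open Complex

lemma ofReal_cpow_half (r : ℝ) :
    (r : ℂ) ^ (1 / 2 : ℂ) = (if r < 0 then I else 1) * (√|r| : ℝ) := by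
  have hnonneg : ∀ s : ℝ, 0 ≤ s → (s : ℂ) ^ (1 / 2 : ℂ) = (√s : ℝ) := fun s hs => by
    rw [Real.sqrt_eq_rpow, ofReal_cpow hs]; norm_num
  split_ifs with hr
  · rw [ofReal_cpow_of_nonpos hr.le, ← ofReal_neg, hnonneg _ (by linarith), mul_comm, abs_of_neg hr,
      show (Real.pi : ℂ) * I * (1 / 2) = (Real.pi / 2) * I by ring, exp_pi_div_two_mul_I]
  · rw [hnonneg _ (not_lt.1 hr), abs_of_nonneg (not_lt.1 hr), one_mul]

lemma conj_exp_mul_I (x : ℝ) : starRingEnd ℂ (exp (x * I)) = exp ((-x : ℝ) * I) := by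
  rw [← exp_conj]; simp

lemma exp_sub_exp (x y : ℝ) : exp (x * I) - exp (y * I) =
    2 * I * (Real.sin ((x - y) / 2) : ℝ) * exp (((x + y) / 2 : ℝ) * I) := by
  have hx : exp (x * I) = exp (((x + y) / 2 : ℝ) * I) * exp (((x - y) / 2 : ℝ) * I) := by
    rw [← Complex.exp_add]; congr 1; push_cast; ring
  have hy : exp (y * I) = exp (((x + y) / 2 : ℝ) * I) * exp (-((x - y) / 2 : ℝ) * I) := by
    rw [← Complex.exp_add]; congr 1; push_cast; ring
  rw [hx, hy, ofReal_sin, Complex.sin]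
  linear_combination (exp (((x + y) / 2 : ℝ) * I) * exp (((x - y) / 2 : ℝ) * I) -
    exp (((x + y) / 2 : ℝ) * I) * exp (-((x - y) / 2 : ℝ) * I)) * I_sq

lemma exp_sub_div_exp_sub_mul_exp {α β θ : ℝ} (hβ : Real.sin ((θ - β) / 2) ≠ 0) :
    (exp (θ * I) - exp (α * I)) / (exp (θ * I) - exp (β * I)) * exp (((β - α) / 2 : ℝ) * I) =
      ((Real.sin ((θ - α) / 2) / Real.sin ((θ - β) / 2) : ℝ) : ℂ) := by
  have hβ' : (Real.sin ((θ - β) / 2) : ℂ) ≠ 0 := ofReal_ne_zero.2 hβ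
  have hexp : exp (((θ + β) / 2 : ℝ) * I) =
      exp (((θ + α) / 2 : ℝ) * I) * exp (((β - α) / 2 : ℝ) * I) := by
    rw [← Complex.exp_add]; congr 1; push_cast; ring
  rw [exp_sub_exp, exp_sub_exp, ofReal_div (Real.sin _), hexp]
  have hne₁ := Complex.exp_ne_zero (((θ + α) / 2 : ℝ) * I)
  have hne₂ := Complex.exp_ne_zero (((β - α) / 2 : ℝ) * I)
  generalize exp (((θ + α) / 2 : ℝ) * I) = E₁ at *
  generalize exp (((β - α) / 2 : ℝ) * I) = E₂ at *
  generalize ((Real.sin ((θ - β) / 2) : ℝ) : ℂ) = S at *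
  field_simp

/-- The phase of `arcSqrt` on the unit circle: `-1` before the arc, `-i` on it and `1` after it. -/
noncomputable def arcPhase (α β θ : ℝ) : ℂ := if θ < α then -1 else if θ < β then -I else 1

lemma arcPhase_neg {α β θ : ℝ} (hαβ : α < β) (hα : θ ≠ α) (hβ : θ ≠ β) :
    arcPhase (-β) (-α) (-θ) = -starRingEnd ℂ (arcPhase α β θ) := by
  unfold arcPhase
  rcases lt_or_gt_of_ne hα with hα | hα
  · simp [hα, hα.not_gt, (hα.trans hαβ).not_gt]
  · rcases lt_or_gt_of_ne hβ with hβ | hβ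
    · simp [hα, hβ, hβ.not_gt, hα.not_gt]
    · simp [hβ, hβ.not_gt, hα.not_gt]

lemma sin_half_sub_neg {γ θ : ℝ} (hγ : γ < Real.pi) (hθ : -Real.pi < θ) (h : θ < γ) :
    Real.sin ((θ - γ) / 2) < 0 :=
  Real.sin_neg_of_neg_of_neg_pi_lt (by linarith) (by linarith)

lemma sin_half_sub_pos {γ θ : ℝ} (hγ : -Real.pi < γ) (hθ : θ < Real.pi) (h : γ < θ) :
    0 < Real.sin ((θ - γ) / 2) :=
  Real.sin_pos_of_pos_of_lt_pi (by linarith) (by linarith)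

section

variable {α β θ : ℝ} (hα : α ∈ Set.Ioo (-Real.pi) Real.pi) (hβ : β ∈ Set.Ioo (-Real.pi) Real.pi)
  (hθ : θ ∈ Set.Ioo (-Real.pi) Real.pi) (hαβ : α < β) (hθα : θ ≠ α) (hθβ : θ ≠ β)

include hα hβ hθ hαβ hθα hθβ

lemma sin_mul_cpow_half_div :
    (Real.sin ((θ - β) / 2) : ℂ) *
        ((Real.sin ((θ - α) / 2) / Real.sin ((θ - β) / 2) : ℝ) : ℂ) ^ (1 / 2 : ℂ) =
      arcPhase α β θ * (√|Real.sin ((θ - α) / 2) * Real.sin ((θ - β) / 2)| : ℝ) := by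
  have hα_neg := sin_half_sub_neg hα.2 hθ.1
  have hα_pos := sin_half_sub_pos hα.1 hθ.2
  have hβ_neg := sin_half_sub_neg hβ.2 hθ.1
  have hβ_pos := sin_half_sub_pos hβ.1 hθ.2
  generalize Real.sin ((θ - α) / 2) = u at *
  generalize Real.sin ((θ - β) / 2) = s at *
  have hs : s ≠ 0 := by
    rcases lt_or_gt_of_ne hθβ with h | h
    exacts [(hβ_neg h).ne, (hβ_pos h).ne']
  have hsqrt : √|u * s| = √|u / s| * |s| := by
    rw [← Real.sqrt_sq_eq_abs s, ← Real.sqrt_mul (abs_nonneg _), ← abs_of_nonneg (sq_nonneg s),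
      ← abs_mul]
    congr 2
    field_simp
  rw [ofReal_cpow_half, hsqrt]
  unfold arcPhase
  rcases lt_or_gt_of_ne hθα with hlt | hgt
  · have hs_neg := hβ_neg (hlt.trans hαβ)
    rw [if_neg (div_nonneg_of_nonpos (hα_neg hlt).le hs_neg.le).not_gt, if_pos hlt,
      abs_of_neg hs_neg]
    push_cast
    ring
  rw [if_neg hgt.not_gt]
  rcases lt_or_gt_of_ne hθβ with hlt' | hgt'
  · rw [if_pos (div_neg_of_pos_of_neg (hα_pos hgt) (hβ_neg hlt')), if_pos hlt',
      abs_of_neg (hβ_neg hlt')]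
    push_cast
    ring
  · rw [if_neg (div_pos (hα_pos hgt) (hβ_pos hgt')).not_gt, if_neg hgt'.not_gt,
      abs_of_pos (hβ_pos hgt')]
    push_cast
    ring

lemma arcSqrt_exp :
    arcSqrt (exp (α * I)) (exp (β * I)) (exp (θ * I)) =
      2 * I * exp ((θ / 2 + (α + β) / 4 : ℝ) * I) * arcPhase α β θ *
        (√|Real.sin ((θ - α) / 2) * Real.sin ((θ - β) / 2)| : ℝ) := by
  have hsin : Real.sin ((θ - β) / 2) ≠ 0 := by
    rcases lt_or_gt_of_ne hθβ with h | h
    exacts [(sin_half_sub_neg hβ.2 hθ.1 h).ne, (sin_half_sub_pos hβ.1 hθ.2 h).ne']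
  have harg : ∀ γ ∈ Set.Ioo (-Real.pi) Real.pi, arg (exp (γ * I)) = γ := fun γ hγ => by
    rw [arg_exp_mul_I, toIocMod_eq_self]; exact ⟨hγ.1, by linarith [hγ.2]⟩
  have hexp : exp ((θ / 2 + (α + β) / 4 : ℝ) * I) =
      exp (((θ + β) / 2 : ℝ) * I) * exp (-((β - α) / 4 : ℝ) * I) := by
    rw [← Complex.exp_add]; congr 1; push_cast; ring
  rw [arcSqrt, harg α hα, harg β hβ, exp_sub_div_exp_sub_mul_exp hsin, exp_sub_exp, hexp]
  linear_combination (2 * I * (exp (((θ + β) / 2 : ℝ) * I) * exp (-((β - α) / 4 : ℝ) * I))) *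
    sin_mul_cpow_half_div hα hβ hθ hαβ hθα hθβ

lemma arcSqrt_exp_neg :
    arcSqrt (exp ((-β : ℝ) * I)) (exp ((-α : ℝ) * I)) (exp ((-θ : ℝ) * I)) =
      starRingEnd ℂ (arcSqrt (exp (α * I)) (exp (β * I)) (exp (θ * I))) := by
  have hneg : ∀ γ ∈ Set.Ioo (-Real.pi) Real.pi, -γ ∈ Set.Ioo (-Real.pi) Real.pi := fun γ hγ =>
    ⟨neg_lt_neg hγ.2, neg_lt.1 hγ.1⟩
  have hsin : ∀ γ, Real.sin ((-θ - -γ) / 2) = -Real.sin ((θ - γ) / 2) := fun γ => by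
    rw [← Real.sin_neg]; congr 1; ring
  rw [arcSqrt_exp hα hβ hθ hαβ hθα hθβ, arcSqrt_exp (hneg _ hβ) (hneg _ hα) (hneg _ hθ)
    (neg_lt_neg hαβ) (neg_injective.ne hθβ) (neg_injective.ne hθα), arcPhase_neg hαβ hθα hθβ, hsin,
    hsin, neg_mul_neg, mul_comm (Real.sin ((θ - β) / 2))]
  simp only [map_mul, conj_exp_mul_I, conj_ofReal, conj_I, map_ofNat]
  rw [show -θ / 2 + (-β + -α) / 4 = -(θ / 2 + (α + β) / 4) by ring]
  ring

end

lemma sqrt_cos_sub_cos_mul_sqrt (α β θ : ℝ) :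
    √|Real.cos θ - Real.cos α| * √|Real.cos θ - Real.cos β| =
      √|Real.sin ((θ - α) / 2) * Real.sin ((θ - β) / 2)| *
        √|Real.sin ((θ - -β) / 2) * Real.sin ((θ - -α) / 2)| * 2 := by
  have hcos : ∀ γ, Real.cos θ - Real.cos γ =
      -2 * (Real.sin ((θ - γ) / 2) * Real.sin ((θ - -γ) / 2)) := fun γ => by
    rw [Real.cos_sub_cos, sub_neg_eq_add]; ring
  have hsqrt : ∀ x : ℝ, √x * 2 = √(x * |4|) := fun x => by
    rw [abs_of_pos four_pos, Real.sqrt_mul' x zero_le_four, show (4 : ℝ) = 2 ^ 2 by norm_num,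
      Real.sqrt_sq zero_le_two]
  rw [← Real.sqrt_mul (abs_nonneg _), ← Real.sqrt_mul (abs_nonneg _), hsqrt, ← abs_mul, ← abs_mul,
    ← abs_mul, hcos, hcos]
  ring_nf

lemma arcSqrt_mul_arcSqrt_exp {α β θ : ℝ} (hα : 0 < α) (hβ : β < Real.pi)
    (hθ : θ ∈ Set.Ioo 0 Real.pi) (hαβ : α < β) (hθα : θ ≠ α) (hθβ : θ ≠ β) :
    arcSqrt (exp (α * I)) (exp (β * I)) (exp (θ * I)) *
      arcSqrt (exp ((-β : ℝ) * I)) (exp ((-α : ℝ) * I)) (exp (θ * I)) =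
    -2 * exp (θ * I) * arcPhase α β θ *
      ((√|Real.cos θ - Real.cos α| * √|Real.cos θ - Real.cos β| : ℝ) : ℂ) := by
  obtain ⟨hθ₀, hθπ⟩ := hθ
  have hphase : arcPhase (-β) (-α) θ = 1 := by
    rw [arcPhase, if_neg (by linarith), if_neg (by linarith)]
  have hexp : exp (θ * I) = exp ((θ / 2 + (α + β) / 4 : ℝ) * I) *
      exp ((θ / 2 + (-β + -α) / 4 : ℝ) * I) := by
    rw [← Complex.exp_add]; congr 1; push_cast; ring
  rw [arcSqrt_exp ⟨by linarith, by linarith⟩ ⟨by linarith, by linarith⟩ ⟨by linarith, hθπ⟩ hαβ hθα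
      hθβ,
    arcSqrt_exp (α := -β) (β := -α) ⟨by linarith, by linarith⟩ ⟨by linarith, by linarith⟩
      ⟨by linarith, hθπ⟩ (by linarith) (by linarith) (by linarith), hphase, hexp,
    sqrt_cos_sub_cos_mul_sqrt]
  simp only [ofReal_mul, ofReal_ofNat]
  linear_combination (4 * exp ((θ / 2 + (α + β) / 4 : ℝ) * I) *
      exp ((θ / 2 + (-β + -α) / 4 : ℝ) * I) * arcPhase α β θ *
      (√|Real.sin ((θ - α) / 2) * Real.sin ((θ - β) / 2)| *
      √|Real.sin ((θ - -β) / 2) * Real.sin ((θ - -α) / 2)|)) * I_sq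

end SquareRootOnCircle

section RhatOnCircle

open Complex Finset

namespace IsNodes

variable {ℓ : ℕ} {t : ℕ → ℝ} {η : ℕ → ℂ} {i : ℕ} {θ : ℝ}

lemma I_pow_min_succ (h : IsNodes ℓ t) (hi : i ≤ 2 * ℓ) (hθ : θ ∈ Set.Ioo (t i) (t (i + 1)))
    {n : ℕ} (hn : n < ℓ) :
    I ^ min i (2 * (n + 1)) =
      -(I ^ min i (2 * n) * arcPhase (t (2 * (n + 1) - 1)) (t (2 * (n + 1))) θ) := by
  unfold arcPhase
  rw [show 2 * (n + 1) - 1 = 2 * n + 1 by omega]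
  rcases Nat.lt_or_ge i (2 * n + 1) with hbefore | hin
  · rw [if_pos (hθ.2.trans_le (h.le_of_le hbefore (by omega))), min_eq_left (by omega),
      min_eq_left (by omega), mul_neg_one, neg_neg]
  rw [if_neg ((h.le_of_le hin (by omega)).trans hθ.1.le).not_gt,
    min_eq_right (show 2 * n ≤ i by omega)]
  rcases Nat.lt_or_ge i (2 * (n + 1)) with hin' | hafter
  · rw [if_pos (hθ.2.trans_le (h.le_of_le hin' (by omega))), min_eq_left (by omega),
      show i = 2 * n + 1 by omega, pow_succ, mul_neg, neg_neg]
  · rw [if_neg ((h.le_of_le hafter (by omega)).trans hθ.1.le).not_gt, min_eq_right (by omega),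
      mul_add, pow_add, mul_one, I_sq, mul_neg_one, mul_one]

lemma weight_succ_inv (n : ℕ) (t : ℕ → ℝ) (θ : ℝ) :
    (weight (n + 1) t θ)⁻¹ = (weight n t θ)⁻¹ *
      (√|Real.cos θ - Real.cos (t (2 * (n + 1) - 1))| *
        √|Real.cos θ - Real.cos (t (2 * (n + 1)))|) := by
  rw [weight, show 2 * (n + 1) = 2 * n + 1 + 1 by ring, prod_Icc_succ_top (by omega),
    prod_Icc_succ_top (by omega), ← weight, mul_inv, mul_inv, inv_inv, inv_inv, mul_assoc,
    Nat.add_sub_cancel]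

variable (h : IsNodes ℓ t) (hη : ∀ j ∈ Icc 1 (2 * ℓ), η j = exp (t j * I)) (hi : i ≤ 2 * ℓ)
  (hθ : θ ∈ Set.Ioo (t i) (t (i + 1)))

include h hη hi hθ

lemma arcSqrt_pair_exp {k : ℕ} (hk : k ∈ Icc 1 ℓ) :
    arcSqrt (η (2 * k - 1)) (η (2 * k)) (exp (θ * I)) *
      arcSqrt (starRingEnd ℂ (η (2 * k))) (starRingEnd ℂ (η (2 * k - 1))) (exp (θ * I)) =
    -2 * exp (θ * I) * arcPhase (t (2 * k - 1)) (t (2 * k)) θ *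
      ((√|Real.cos θ - Real.cos (t (2 * k - 1))| *
        √|Real.cos θ - Real.cos (t (2 * k))| : ℝ) : ℂ) := by
  rw [mem_Icc] at hk
  rw [hη _ (by rw [mem_Icc]; omega), hη _ (by rw [mem_Icc]; omega), conj_exp_mul_I, conj_exp_mul_I]
  exact arcSqrt_mul_arcSqrt_exp (h.pos (by omega) (by omega)) (h.lt_pi (by omega))
    (h.mem_Ioo_zero_pi hi hθ) (h.lt_of_lt (by omega) (by omega))
    (h.ne_of_mem_Ioo hi (by omega) hθ) (h.ne_of_mem_Ioo hi (by omega) hθ)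

lemma arcSqrt_pair_exp_neg {k : ℕ} (hk : k ∈ Icc 1 ℓ) :
    arcSqrt (η (2 * k - 1)) (η (2 * k)) (exp ((-θ : ℝ) * I)) *
      arcSqrt (starRingEnd ℂ (η (2 * k))) (starRingEnd ℂ (η (2 * k - 1))) (exp ((-θ : ℝ) * I)) =
    starRingEnd ℂ (arcSqrt (η (2 * k - 1)) (η (2 * k)) (exp (θ * I)) *
      arcSqrt (starRingEnd ℂ (η (2 * k))) (starRingEnd ℂ (η (2 * k - 1))) (exp (θ * I))) := by
  rw [mem_Icc] at hk
  rw [hη _ (by rw [mem_Icc]; omega), hη _ (by rw [mem_Icc]; omega), conj_exp_mul_I, conj_exp_mul_I]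
  set α := t (2 * k - 1)
  set β := t (2 * k)
  have hαβ : α < β := h.lt_of_lt (by omega) (by omega)
  have hα : 0 < α := h.pos (by omega) (by omega)
  have hβ : β < Real.pi := h.lt_pi (by omega)
  have hθα : θ ≠ α := h.ne_of_mem_Ioo hi (by omega) hθ
  have hθβ : θ ≠ β := h.ne_of_mem_Ioo hi (by omega) hθ
  obtain ⟨hθ₀, hθπ⟩ := h.mem_Ioo_zero_pi hi hθ
  have hupper := arcSqrt_exp_neg (α := α) (β := β) ⟨by linarith, by linarith⟩
    ⟨by linarith, by linarith⟩ ⟨by linarith, hθπ⟩ hαβ hθα hθβ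
  have hlower := arcSqrt_exp_neg (α := -β) (β := -α) (θ := θ) ⟨by linarith, by linarith⟩
    ⟨by linarith, by linarith⟩ ⟨by linarith, hθπ⟩ (by linarith) (by linarith) (by linarith)
  rw [neg_neg, neg_neg] at hlower
  rw [hupper, hlower, map_mul, mul_comm]

lemma Rhat_exp :
    Rhat η ℓ (exp (θ * I)) = 2 ^ ℓ * exp (θ * I) ^ ℓ * I ^ i * ((weight ℓ t θ)⁻¹ : ℝ) := by
  have hpartial : ∀ n ≤ ℓ, Rhat η n (exp (θ * I)) =
      2 ^ n * exp (θ * I) ^ n * I ^ (min i (2 * n)) * ((weight n t θ)⁻¹ : ℝ) := by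
    intro n
    induction n with
    | zero => intro _; simp [Rhat, weight]
    | succ n ih =>
      intro hn
      rw [Rhat, prod_Icc_succ_top (by omega), ← Rhat, ih (by omega),
        h.arcSqrt_pair_exp hη hi hθ (by rw [mem_Icc]; omega), weight_succ_inv,
        h.I_pow_min_succ hi hθ (by omega), ofReal_mul _ (√_ * √_)]
      ring
  rw [hpartial ℓ le_rfl, min_eq_left hi]

lemma Rhat_exp_neg :
    Rhat η ℓ (exp ((-θ : ℝ) * I)) = starRingEnd ℂ (Rhat η ℓ (exp (θ * I))) := by
  rw [Rhat, Rhat, map_prod]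
  exact prod_congr rfl fun k hk => h.arcSqrt_pair_exp_neg hη hi hθ hk

end IsNodes

end RhatOnCircle

section Integrability

open Finset MeasureTheory

lemma inv_sqrt_mul_inv_sqrt_le {a b x : ℝ} (hab : a ≠ b) :
    (√|x - a|)⁻¹ * (√|x - b|)⁻¹ ≤ (√(|a - b| / 2))⁻¹ * ((√|x - a|)⁻¹ + (√|x - b|)⁻¹) := by
  have hdist : 0 < |a - b| / 2 := by have := abs_pos.2 (sub_ne_zero.2 hab); positivity
  have htri : |a - b| ≤ |x - a| + |x - b| := by
    rw [abs_sub_comm x a]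
    exact abs_sub_le a x b
  have hfar : ∀ y, |a - b| / 2 ≤ y → (√y)⁻¹ ≤ (√(|a - b| / 2))⁻¹ := fun y hy =>
    inv_anti₀ (Real.sqrt_pos.2 hdist) (Real.sqrt_le_sqrt hy)
  rw [mul_add]
  rcases le_total (|a - b| / 2) |x - a| with ha | ha
  · exact (mul_le_mul_of_nonneg_right (hfar _ ha) (by positivity)).trans
      (le_add_of_nonneg_left (by positivity))
  · rw [mul_comm]
    exact (mul_le_mul_of_nonneg_right (hfar |x - b| (by linarith)) (by positivity)).trans
      (le_add_of_nonneg_right (by positivity))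

/-- By partial fractions, inverse square root singularities at distinct points do not interact. -/
lemma exists_prod_inv_sqrt_le {ι : Type*} (s : Finset ι) {c : ι → ℝ}
    (hc : Set.InjOn c s) :
    ∃ K, 0 ≤ K ∧ ∀ x, ∏ j ∈ s, (√|x - c j|)⁻¹ ≤ K * (1 + ∑ j ∈ s, (√|x - c j|)⁻¹) := by
  classical
  induction s using Finset.induction_on with
  | empty => exact ⟨1, by simp⟩
  | insert a s ha ih =>
    obtain ⟨K, hK, hs⟩ := ih (hc.mono (by simp))
    have hne : ∀ j ∈ s, c a ≠ c j := fun j hj hcaj =>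
      ha (hc (by simp) (by simp [hj]) hcaj ▸ hj)
    have hD_nonneg : 0 ≤ ∑ j ∈ s, (√(|c a - c j| / 2))⁻¹ := sum_nonneg fun j _ => by positivity
    set D := ∑ j ∈ s, (√(|c a - c j| / 2))⁻¹ with hD
    refine ⟨K * (1 + D), by positivity, fun x => ?_⟩
    rw [prod_insert ha, sum_insert ha]
    have hA : 0 ≤ (√|x - c a|)⁻¹ := by positivity
    set A := (√|x - c a|)⁻¹
    have hT_nonneg : 0 ≤ ∑ j ∈ s, (√|x - c j|)⁻¹ := sum_nonneg fun j _ => by positivity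
    set T := ∑ j ∈ s, (√|x - c j|)⁻¹ with hT
    have hcross : A * T ≤ D * (A + T) := by
      rw [hT, mul_sum, hD, sum_mul]
      refine sum_le_sum fun j hj => (inv_sqrt_mul_inv_sqrt_le (hne j hj)).trans ?_
      gcongr
      exact single_le_sum (f := fun j => (√|x - c j|)⁻¹) (fun i _ => by positivity) hj
    calc A * ∏ j ∈ s, (√|x - c j|)⁻¹ ≤ A * (K * (1 + T)) := by gcongr; exact hs x
      _ = K * (A + A * T) := by ring
      _ ≤ K * (A + D * (A + T)) := by gcongr
      _ ≤ K * ((1 + D) * (1 + (A + T))) := by gcongr; nlinarith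
      _ = K * (1 + D) * (1 + (A + T)) := by ring

lemma intervalIntegrable_inv_sqrt_abs_sub (c a b : ℝ) :
    IntervalIntegrable (fun x => (√|x - c|)⁻¹) volume a b := by
  have hpos : ∀ x : ℝ, 0 < x → IntervalIntegrable (fun x => (√|x|)⁻¹) volume 0 x := fun x hx => by
    refine (intervalIntegral.intervalIntegrable_rpow' (r := -(1 / 2)) (by norm_num)).congr
      fun y hy => ?_
    rw [Set.uIoc_of_le hx.le] at hy
    rw [Real.rpow_neg hy.1.le, ← Real.sqrt_eq_rpow, abs_of_pos hy.1]
  have heven := intervalIntegrable_of_even (fun x => by rw [abs_neg]) hpos (a := a - c) (b := b - c)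
  simpa only [sub_add_cancel] using heven.comp_sub_right c

lemma sin_add_half_ge {α θ : ℝ} (hα : α ∈ Set.Icc 0 Real.pi) (hθ : θ ∈ Set.Icc 0 Real.pi) :
    min (Real.sin (α / 2)) (Real.cos (α / 2)) ≤ Real.sin ((θ + α) / 2) := by
  rw [← Real.sin_add_pi_div_two]
  refine strictConcaveOn_sin_Icc.concaveOn.min_le_of_mem_Icc ⟨?_, ?_⟩ ⟨?_, ?_⟩ ⟨?_, ?_⟩ <;>
    linarith [hα.1, hα.2, hθ.1, hθ.2]

lemma mul_abs_sub_le_abs_cos_sub_cos {α θ : ℝ} (hα : α ∈ Set.Icc 0 Real.pi)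
    (hθ : θ ∈ Set.Icc 0 Real.pi) :
    2 / Real.pi * min (Real.sin (α / 2)) (Real.cos (α / 2)) * |θ - α| ≤
      |Real.cos θ - Real.cos α| := by
  have hsin := (sin_add_half_ge hα hθ).trans (le_abs_self _)
  have hsin' : 2 / Real.pi * |(θ - α) / 2| ≤ |Real.sin ((θ - α) / 2)| :=
    Real.mul_abs_le_abs_sin (by
      rw [abs_le]; constructor <;> linarith [hα.1, hα.2, hθ.1, hθ.2])
  rw [abs_div, abs_two] at hsin'
  calc 2 / Real.pi * min (Real.sin (α / 2)) (Real.cos (α / 2)) * |θ - α|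
      = 2 * (min (Real.sin (α / 2)) (Real.cos (α / 2)) * (2 / Real.pi * (|θ - α| / 2))) := by ring
    _ ≤ 2 * (|Real.sin ((θ + α) / 2)| * |Real.sin ((θ - α) / 2)|) := by
        gcongr
    _ = |Real.cos θ - Real.cos α| := by
        rw [Real.cos_sub_cos, abs_mul, abs_mul, abs_neg, abs_two, mul_assoc]

lemma intervalIntegrable_inv_sqrt_abs_cos_sub_cos {α : ℝ} (hα : α ∈ Set.Ioo 0 Real.pi) :
    IntervalIntegrable (fun θ => (√|Real.cos θ - Real.cos α|)⁻¹) volume 0 Real.pi := by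
  set K := 2 / Real.pi * min (Real.sin (α / 2)) (Real.cos (α / 2)) with hKdef
  have hK : 0 < K := mul_pos (div_pos two_pos Real.pi_pos) (lt_min
    (Real.sin_pos_of_pos_of_lt_pi (by linarith [hα.1]) (by linarith [hα.2, Real.pi_pos]))
    (Real.cos_pos_of_mem_Ioo ⟨by linarith [hα.1, Real.pi_pos], by linarith [hα.2]⟩))
  refine ((intervalIntegrable_inv_sqrt_abs_sub α 0 Real.pi).const_mul (√K)⁻¹).mono_fun
    (Measurable.aestronglyMeasurable (by fun_prop)) ?_
  refine (ae_restrict_mem measurableSet_uIoc).mono fun θ hθ => ?_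
  rw [Set.uIoc_of_le Real.pi_pos.le] at hθ
  beta_reduce
  rw [Real.norm_of_nonneg (by positivity), Real.norm_of_nonneg (by positivity), ← mul_inv,
    ← Real.sqrt_mul hK.le]
  rcases eq_or_ne θ α with rfl | hne
  · simp only [sub_self, abs_zero, Real.sqrt_zero, inv_zero, mul_zero, le_refl]
  · exact inv_anti₀ (Real.sqrt_pos.2 (mul_pos hK (abs_pos.2 (sub_ne_zero.2 hne))))
      (Real.sqrt_le_sqrt (mul_abs_sub_le_abs_cos_sub_cos (Set.Ioo_subset_Icc_self hα)
        (Set.Ioc_subset_Icc_self hθ)))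

namespace IsNodes

variable {ℓ : ℕ} {t : ℕ → ℝ}

lemma injOn_cos (h : IsNodes ℓ t) : Set.InjOn (fun j => Real.cos (t j)) (Set.Iic (2 * ℓ + 1)) :=
  fun _ hi _ hj hij => h.strictMonoOn.injOn hi hj
    (Real.injOn_cos (h.mem_Icc_zero_pi hi) (h.mem_Icc_zero_pi hj) hij)

lemma intervalIntegrable_weight (h : IsNodes ℓ t) :
    IntervalIntegrable (weight ℓ t) volume 0 Real.pi := by
  obtain ⟨K, -, hle⟩ := exists_prod_inv_sqrt_le (Icc 1 (2 * ℓ)) (h.injOn_cos.mono fun j hj =>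
    Set.mem_Iic.2 ((Finset.mem_Icc.1 hj).2.trans (Nat.le_succ _)))
  have hsum : IntervalIntegrable
      (fun θ => K * (1 + ∑ j ∈ Icc 1 (2 * ℓ), (√|Real.cos θ - Real.cos (t j)|)⁻¹))
      volume 0 Real.pi := by
    refine (intervalIntegrable_const.add ?_).const_mul K
    rw [← Finset.sum_fn]
    refine IntervalIntegrable.sum _ fun j hj => ?_
    rw [Finset.mem_Icc] at hj
    exact intervalIntegrable_inv_sqrt_abs_cos_sub_cos ⟨h.pos hj.1 (by omega), h.lt_pi hj.2⟩
  refine hsum.mono_fun (measurable_weight ℓ t).aestronglyMeasurable (.of_forall fun θ => ?_)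
  beta_reduce
  rw [Real.norm_of_nonneg (weight_nonneg _ _ _)]
  exact (hle (Real.cos θ)).trans (le_abs_self _)

lemma intervalIntegrable_weight_two_pi (h : IsNodes ℓ t) :
    IntervalIntegrable (weight ℓ t) volume 0 (2 * Real.pi) := by
  refine h.intervalIntegrable_weight.trans ?_
  have hreflected := (h.intervalIntegrable_weight.comp_sub_left (2 * Real.pi)).symm
  simp only [weight_two_pi_sub, sub_zero] at hreflected
  rwa [two_mul, add_sub_cancel_right, ← two_mul] at hreflected

lemma intervalIntegrable_mul_weight (h : IsNodes ℓ t) {g : ℝ → ℝ} (hg : Continuous g) {a b : ℝ}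
    (ha : a ∈ Set.Icc 0 Real.pi) (hb : b ∈ Set.Icc 0 Real.pi) :
    IntervalIntegrable (fun θ => g θ * weight ℓ t θ) volume a b := by
  refine (h.intervalIntegrable_weight.continuousOn_mul hg.continuousOn).mono_set ?_
  rw [Set.uIcc_of_le Real.pi_pos.le]
  exact Set.uIcc_subset_Icc ha hb

end IsNodes

end Integrability

section DiscBranch

open Finset Complex Polynomial

/-- The monic quadratic with roots `e^{iτ}` and `e^{-iτ}`. -/
noncomputable def circleQuadratic (τ : ℝ) : ℝ[X] := X ^ 2 - C (2 * Real.cos τ) * X + 1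

/-- The polynomial `∏ (z - η_j)(z - η_j⁻¹)` whose square root is `R̂_ℓ`, for `η_j = e^{i t_j}`. -/
noncomputable def branchPoly (ℓ : ℕ) (t : ℕ → ℝ) : ℝ[X] :=
  ∏ j ∈ Icc 1 (2 * ℓ), circleQuadratic (t j)

/-- The branch of `√(u² - 2u cos τ + 1)` on the unit disc with value `1` at `0`. -/
noncomputable def sqrtFactor (τ : ℝ) (u : ℂ) : ℂ :=
  (1 - u * exp (τ * I)) ^ (2⁻¹ : ℂ) * (1 - u * exp ((-τ : ℝ) * I)) ^ (2⁻¹ : ℂ)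

/-- The holomorphic square root of `branchPoly ℓ t` on the unit disc with value `1` at `0`. In
contrast to `R̂_ℓ` it is cut nowhere inside the disc, so that Cauchy's theorem applies to it. -/
noncomputable def sqrtProd (ℓ : ℕ) (t : ℕ → ℝ) (u : ℂ) : ℂ :=
  ∏ j ∈ Icc 1 (2 * ℓ), sqrtFactor (t j) u

lemma aeval_circleQuadratic (τ : ℝ) (u : ℂ) :
    aeval u (circleQuadratic τ) = (1 - u * exp (τ * I)) * (1 - u * exp ((-τ : ℝ) * I)) := by
  have hmul : exp (τ * I) * exp ((-τ : ℝ) * I) = 1 := by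
    rw [← Complex.exp_add]; simp
  have hadd : (2 : ℂ) * Real.cos τ = exp (τ * I) + exp ((-τ : ℝ) * I) := by
    rw [ofReal_cos, Complex.cos]; push_cast; ring
  have heval : aeval u (circleQuadratic τ) = u ^ 2 - 2 * Real.cos τ * u + 1 := by
    simp [circleQuadratic]
  rw [heval, hadd]
  linear_combination -u ^ 2 * hmul

lemma sqrtProd_sq (ℓ : ℕ) (t : ℕ → ℝ) (u : ℂ) :
    sqrtProd ℓ t u ^ 2 = aeval u (branchPoly ℓ t) := by
  rw [sqrtProd, branchPoly, map_prod, ← prod_pow]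
  refine prod_congr rfl fun j _ => ?_
  rw [aeval_circleQuadratic, sqrtFactor, mul_pow, cpow_ofNat_inv_pow, cpow_ofNat_inv_pow]

lemma sqrtProd_zero (ℓ : ℕ) (t : ℕ → ℝ) : sqrtProd ℓ t 0 = 1 := by
  simp [sqrtProd, sqrtFactor]

lemma measurable_sqrtProd (ℓ : ℕ) (t : ℕ → ℝ) : Measurable (sqrtProd ℓ t) := by
  unfold sqrtProd sqrtFactor
  fun_prop

lemma norm_mul_exp (u : ℂ) (x : ℝ) : ‖u * exp (x * I)‖ = ‖u‖ := by
  rw [norm_mul, norm_exp_ofReal_mul_I, mul_one]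

lemma one_sub_mem_slitPlane {w : ℂ} (hw : ‖w‖ ≤ 1) (hne : w ≠ 1) : 1 - w ∈ slitPlane := by
  rw [mem_slitPlane_iff, sub_re, one_re, sub_im, one_im, zero_sub, neg_ne_zero,
    or_iff_not_imp_right, not_not, sub_pos]
  exact fun him => ((re_le_norm w).trans hw).lt_of_ne fun hre => hne (Complex.ext hre him)

variable {ℓ : ℕ} {t : ℕ → ℝ} {u : ℂ}

lemma aeval_branchPoly_ne_zero (hu : ‖u‖ < 1) : aeval u (branchPoly ℓ t) ≠ 0 := by
  have hne : ∀ x : ℝ, 1 - u * exp (x * I) ≠ 0 := fun x h => by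
    have := congrArg norm (sub_eq_zero.1 h)
    rw [norm_mul_exp, norm_one] at this
    linarith
  rw [branchPoly, map_prod]
  exact prod_ne_zero_iff.2 fun j _ => by
    rw [aeval_circleQuadratic]
    exact mul_ne_zero (hne _) (hne _)

lemma sqrtProd_ne_zero (hD : aeval u (branchPoly ℓ t) ≠ 0) : sqrtProd ℓ t u ≠ 0 :=
  ne_zero_pow two_ne_zero (by rwa [sqrtProd_sq])

lemma differentiableAt_sqrtProd (hu : ‖u‖ ≤ 1) (hD : aeval u (branchPoly ℓ t) ≠ 0) :
    DifferentiableAt ℂ (sqrtProd ℓ t) u := by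
  have hfactor : ∀ x : ℝ, 1 - u * exp (x * I) ≠ 0 →
      DifferentiableAt ℂ (fun u : ℂ => (1 - u * exp (x * I)) ^ (2⁻¹ : ℂ)) u := fun x hx =>
    DifferentiableAt.cpow (by fun_prop) (by fun_prop)
      (one_sub_mem_slitPlane ((norm_mul_exp _ _).trans_le hu) (sub_ne_zero.1 hx).symm)
  rw [branchPoly, map_prod, prod_ne_zero_iff] at hD
  refine DifferentiableAt.fun_finsetProd fun j hj => ?_
  have hj := hD j hj
  rw [aeval_circleQuadratic, mul_ne_zero_iff] at hj
  exact (hfactor _ hj.1).mul (hfactor _ hj.2)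

lemma conj_one_sub_cpow {w : ℂ} (hw : ‖w‖ ≤ 1) :
    starRingEnd ℂ ((1 - w) ^ (2⁻¹ : ℂ)) = (1 - starRingEnd ℂ w) ^ (2⁻¹ : ℂ) := by
  rcases eq_or_ne w 1 with rfl | hne
  · simp
  · have := conj_cpow (1 - w) (2⁻¹ : ℂ) (slitPlane_arg_ne_pi (one_sub_mem_slitPlane hw hne))
    simpa only [map_sub, map_one, map_inv₀, map_ofNat] using this.symm

lemma conj_sqrtProd (ℓ : ℕ) (t : ℕ → ℝ) (hu : ‖u‖ ≤ 1) :
    starRingEnd ℂ (sqrtProd ℓ t u) = sqrtProd ℓ t (starRingEnd ℂ u) := by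
  rw [sqrtProd, sqrtProd, map_prod]
  refine prod_congr rfl fun j _ => ?_
  rw [sqrtFactor, sqrtFactor, map_mul, conj_one_sub_cpow ((norm_mul_exp _ _).trans_le hu),
    conj_one_sub_cpow ((norm_mul_exp _ _).trans_le hu), map_mul, map_mul, conj_exp_mul_I,
    conj_exp_mul_I, neg_neg, mul_comm]

lemma aeval_circleQuadratic_exp (τ θ : ℝ) :
    aeval (exp (θ * I)) (circleQuadratic τ) =
      exp (θ * I) * ((2 * (Real.cos θ - Real.cos τ) : ℝ) : ℂ) := by
  have hmul : exp (θ * I) * exp ((-θ : ℝ) * I) = 1 := by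
    rw [← Complex.exp_add]; simp
  have hadd : (2 : ℂ) * Real.cos θ = exp (θ * I) + exp ((-θ : ℝ) * I) := by
    rw [ofReal_cos, Complex.cos]; push_cast; ring
  have heval : aeval (exp (θ * I)) (circleQuadratic τ) =
      exp (θ * I) ^ 2 - 2 * Real.cos τ * exp (θ * I) + 1 := by
    simp [circleQuadratic]
  rw [heval]
  push_cast at hmul hadd ⊢
  linear_combination (-1 : ℂ) * hmul - exp (θ * I) * hadd

lemma aeval_branchPoly_exp_ne_zero {θ : ℝ}
    (hθ : ∀ j ∈ Icc 1 (2 * ℓ), Real.cos θ ≠ Real.cos (t j)) :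
    aeval (exp (θ * I)) (branchPoly ℓ t) ≠ 0 := by
  rw [branchPoly, map_prod]
  exact prod_ne_zero_iff.2 fun j hj => by
    rw [aeval_circleQuadratic_exp]
    exact mul_ne_zero (Complex.exp_ne_zero _)
      (ofReal_ne_zero.2 (mul_ne_zero two_ne_zero (sub_ne_zero.2 (hθ j hj))))

lemma one_sub_exp_cpow_of_pos {ψ : ℝ} (hψ : ψ ∈ Set.Ioo 0 (2 * Real.pi)) :
    (1 - exp (ψ * I)) ^ (2⁻¹ : ℂ) =
      (√(2 * |Real.sin (ψ / 2)|) : ℝ) * exp (((ψ - Real.pi) / 4 : ℝ) * I) := by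
  obtain ⟨hψ₀, hψ₁⟩ := hψ
  have hsin : 0 < Real.sin (ψ / 2) := Real.sin_pos_of_pos_of_lt_pi (by linarith) (by linarith)
  rw [abs_of_pos hsin]
  have hre : 0 < ((√(2 * Real.sin (ψ / 2)) : ℝ) * exp (((ψ - Real.pi) / 4 : ℝ) * I)).re := by
    rw [re_ofReal_mul, exp_ofReal_mul_I_re]
    exact mul_pos (Real.sqrt_pos.2 (by positivity))
      (Real.cos_pos_of_mem_Ioo ⟨by linarith, by linarith⟩)
  rw [← sq_cpow_two_inv hre]
  congr 1
  have hexp_sq : exp (((ψ - Real.pi) / 4 : ℝ) * I) ^ 2 = -I * exp (((0 + ψ) / 2 : ℝ) * I) := by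
    rw [← Complex.exp_nat_mul, ← exp_neg_pi_div_two_mul_I, ← Complex.exp_add]
    congr 1
    push_cast
    ring
  rw [mul_pow, hexp_sq, ← ofReal_pow, Real.sq_sqrt (by positivity),
    show (1 : ℂ) = exp ((0 : ℝ) * I) by simp, exp_sub_exp, zero_sub, neg_div, Real.sin_neg]
  push_cast
  ring

lemma one_sub_exp_cpow_of_neg {ψ : ℝ} (hψ : ψ ∈ Set.Ioo (-(2 * Real.pi)) 0) :
    (1 - exp (ψ * I)) ^ (2⁻¹ : ℂ) =
      (√(2 * |Real.sin (ψ / 2)|) : ℝ) * exp (((ψ + Real.pi) / 4 : ℝ) * I) := by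
  have hpos := one_sub_exp_cpow_of_pos (ψ := -ψ) ⟨neg_pos.2 hψ.2, neg_lt.1 hψ.1⟩
  rw [← conj_exp_mul_I, ← conj_one_sub_cpow (norm_exp_ofReal_mul_I ψ).le] at hpos
  rw [← starRingEnd_self_apply ((1 - exp (ψ * I)) ^ (2⁻¹ : ℂ)), hpos, map_mul, conj_ofReal,
    conj_exp_mul_I, neg_div, Real.sin_neg, abs_neg]
  congr 3
  rw [← neg_div, neg_sub, sub_neg_eq_add, add_comm]

lemma sqrtFactor_exp {τ θ : ℝ} (hτ : τ ∈ Set.Ioo 0 Real.pi) (hθ : θ ∈ Set.Ioo 0 Real.pi)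
    (hne : θ ≠ τ) :
    sqrtFactor τ (exp (θ * I)) = exp ((θ / 2 : ℝ) * I) * (if τ < θ then -I else 1) *
      ((√2 * √|Real.cos θ - Real.cos τ| : ℝ) : ℂ) := by
  obtain ⟨hτ₀, hτπ⟩ := hτ
  obtain ⟨hθ₀, hθπ⟩ := hθ
  have hexp : ∀ x : ℝ, exp (θ * I) * exp (x * I) = exp ((θ + x : ℝ) * I) := fun x => by
    rw [← Complex.exp_add]; congr 1; push_cast; ring
  have hsqrt : √2 * √|Real.cos θ - Real.cos τ| =
      √(2 * |Real.sin ((θ + τ) / 2)|) * √(2 * |Real.sin ((θ + -τ) / 2)|) := by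
    rw [← Real.sqrt_mul (by positivity), ← Real.sqrt_mul (by positivity), Real.cos_sub_cos, abs_mul,
      abs_mul, abs_neg, abs_two, ← sub_eq_add_neg]
    congr 1
    ring
  rw [sqrtFactor, hexp, hexp, one_sub_exp_cpow_of_pos ⟨by linarith, by linarith⟩, hsqrt]
  rcases lt_or_gt_of_ne hne with h | h
  · have hphase : exp ((θ / 2 : ℝ) * I) = exp (((θ + τ - Real.pi) / 4 : ℝ) * I) *
        exp (((θ + -τ + Real.pi) / 4 : ℝ) * I) := by
      rw [← Complex.exp_add]; congr 1; push_cast; ring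
    rw [one_sub_exp_cpow_of_neg ⟨by linarith, by linarith⟩, if_neg h.not_gt, hphase]
    push_cast
    ring
  · have hphase : exp ((θ / 2 : ℝ) * I) * -I = exp (((θ + τ - Real.pi) / 4 : ℝ) * I) *
        exp (((θ + -τ - Real.pi) / 4 : ℝ) * I) := by
      rw [← Complex.exp_add, ← exp_neg_pi_div_two_mul_I, ← Complex.exp_add]
      congr 1; push_cast; ring
    rw [one_sub_exp_cpow_of_pos ⟨by linarith, by linarith⟩, if_pos h, hphase]
    push_cast
    ring

namespace IsNodes

variable {i : ℕ} {θ : ℝ}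

lemma neg_I_pow_min_succ (h : IsNodes ℓ t) (hi : i ≤ 2 * ℓ) (hθ : θ ∈ Set.Ioo (t i) (t (i + 1)))
    {n : ℕ} (hn : n < 2 * ℓ) :
    (-I) ^ min i (n + 1) = (-I) ^ min i n * (if t (n + 1) < θ then -I else 1) := by
  rcases Nat.lt_or_ge i (n + 1) with hin | hin
  · have := h.le_of_le (show i + 1 ≤ n + 1 by omega) (by omega)
    rw [if_neg (by linarith [hθ.2]), min_eq_left (by omega), min_eq_left (by omega), mul_one]
  · have := h.le_of_le hin (by omega)
    rw [if_pos (by linarith [hθ.1]), min_eq_right hin, min_eq_right (by omega), pow_succ]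

lemma sqrtProd_exp (h : IsNodes ℓ t) (hi : i ≤ 2 * ℓ) (hθ : θ ∈ Set.Ioo (t i) (t (i + 1))) :
    sqrtProd ℓ t (exp (θ * I)) =
      2 ^ ℓ * exp (θ * I) ^ ℓ * (-I) ^ i * ((weight ℓ t θ)⁻¹ : ℝ) := by
  have hpartial : ∀ n ≤ 2 * ℓ, ∏ j ∈ Icc 1 n, sqrtFactor (t j) (exp (θ * I)) =
      (exp ((θ / 2 : ℝ) * I) * (√2 : ℝ)) ^ n * (-I) ^ min i n *
        ((∏ j ∈ Icc 1 n, √|Real.cos θ - Real.cos (t j)| : ℝ) : ℂ) := by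
    intro n
    induction n with
    | zero => intro _; simp
    | succ n ih =>
      intro hn
      rw [prod_Icc_succ_top (by omega), prod_Icc_succ_top (by omega), ih (by omega),
        sqrtFactor_exp ⟨h.pos (by omega) (by omega), h.lt_pi hn⟩ (h.mem_Ioo_zero_pi hi hθ)
          (h.ne_of_mem_Ioo hi (by omega) hθ), h.neg_I_pow_min_succ hi hθ hn]
      push_cast
      ring
  have hbase : (exp ((θ / 2 : ℝ) * I) * (√2 : ℝ)) ^ 2 = 2 * exp (θ * I) := by
    rw [mul_pow, ← ofReal_pow, Real.sq_sqrt zero_le_two, ← Complex.exp_nat_mul, mul_comm]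
    congr 2
    push_cast
    ring
  rw [sqrtProd, hpartial _ le_rfl, min_eq_left hi, weight, prod_inv_distrib, inv_inv, pow_mul,
    hbase, mul_pow]

end IsNodes

lemma norm_cpow_two_inv (z : ℂ) : ‖z ^ (2⁻¹ : ℂ)‖ = √‖z‖ := by
  rw [eq_comm, Real.sqrt_eq_iff_mul_self_eq (norm_nonneg _) (norm_nonneg _), ← norm_mul, ← sq,
    cpow_ofNat_inv_pow]

lemma norm_one_sub_le_two_mul {r : ℝ} (hr : r ∈ Set.Icc 0 1) {w : ℂ} (hw : ‖w‖ = 1) :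
    ‖1 - w‖ ≤ 2 * ‖1 - r * w‖ := by
  have hrw : ‖r * w‖ = r := by rw [norm_mul, hw, mul_one, norm_real, Real.norm_of_nonneg hr.1]
  have hdist : ‖r * w - w‖ = 1 - r := by
    rw [show (r : ℂ) * w - w = ((r - 1 : ℝ) : ℂ) * w by push_cast; ring, norm_mul, hw, mul_one,
      norm_real, Real.norm_eq_abs, abs_of_nonpos (by linarith [hr.2]), neg_sub]
  have hradial : 1 - r ≤ ‖1 - r * w‖ := by
    simpa only [norm_one, hrw] using norm_sub_norm_le (1 : ℂ) (r * w)
  linarith [norm_sub_le_norm_sub_add_norm_sub (1 : ℂ) (r * w) w]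

lemma norm_inv_sqrtFactor_le {r : ℝ} (hr : r ∈ Set.Icc 0 1) {τ θ : ℝ}
    (hcos : Real.cos θ ≠ Real.cos τ) :
    ‖(sqrtFactor τ (r * exp (θ * I)))⁻¹‖ ≤ √2 * (√|Real.cos θ - Real.cos τ|)⁻¹ := by
  have hpos : 0 < |Real.cos θ - Real.cos τ| := abs_pos.2 (sub_ne_zero.2 hcos)
  have hle : ∀ x : ℝ, ‖1 - exp (θ * I) * exp (x * I)‖ ≤ 2 * ‖1 - r * exp (θ * I) * exp (x * I)‖ :=
    fun x => mul_assoc (r : ℂ) _ _ ▸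
      norm_one_sub_le_two_mul hr (by rw [norm_mul_exp, norm_exp_ofReal_mul_I])
  have hnorm : ‖1 - exp (θ * I) * exp (τ * I)‖ * ‖1 - exp (θ * I) * exp ((-τ : ℝ) * I)‖ =
      2 * |Real.cos θ - Real.cos τ| := by
    rw [← norm_mul, ← aeval_circleQuadratic, aeval_circleQuadratic_exp, norm_mul,
      norm_exp_ofReal_mul_I, one_mul, norm_real, Real.norm_eq_abs, abs_mul, abs_two]
  have hprod := mul_le_mul (hle τ) (hle (-τ)) (norm_nonneg _) (by positivity)
  rw [hnorm] at hprod
  calc ‖(sqrtFactor τ (r * exp (θ * I)))⁻¹‖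
      = (√(‖1 - r * exp (θ * I) * exp (τ * I)‖ *
          ‖1 - r * exp (θ * I) * exp ((-τ : ℝ) * I)‖))⁻¹ := by
        rw [sqrtFactor, norm_inv, norm_mul, norm_cpow_two_inv, norm_cpow_two_inv,
          ← Real.sqrt_mul (norm_nonneg _)]
    _ ≤ (√(|Real.cos θ - Real.cos τ| / 2))⁻¹ :=
        inv_anti₀ (Real.sqrt_pos.2 (by positivity)) (Real.sqrt_le_sqrt (by linarith))
    _ = √2 * (√|Real.cos θ - Real.cos τ|)⁻¹ := by
        rw [Real.sqrt_div hpos.le, inv_div, div_eq_mul_inv]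

lemma norm_inv_sqrtProd_le {r : ℝ} (hr : r ∈ Set.Icc 0 1) {θ : ℝ}
    (hθ : ∀ j ∈ Icc 1 (2 * ℓ), Real.cos θ ≠ Real.cos (t j)) :
    ‖(sqrtProd ℓ t (r * exp (θ * I)))⁻¹‖ ≤ 2 ^ ℓ * weight ℓ t θ := by
  rw [sqrtProd, ← prod_inv_distrib, norm_prod]
  refine (prod_le_prod (fun j _ => norm_nonneg _)
    fun j hj => norm_inv_sqrtFactor_le hr (hθ j hj)).trans (le_of_eq ?_)
  rw [prod_mul_distrib, prod_const, Nat.card_Icc, Nat.add_sub_cancel, pow_mul,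
    Real.sq_sqrt zero_le_two, weight]

end DiscBranch

section Residue

open Complex Polynomial

/-- Since `f - g = (f² - g²) / (f + g)`, the quotient is `f / g = 1 + O((z - c)^{n + 1})`. -/
lemma iteratedDeriv_div_eq_zero_of_le_analyticOrderAt {f g : ℂ → ℂ} {c : ℂ} {n : ℕ} (hn : n ≠ 0)
    (hf : AnalyticAt ℂ f c) (hg : AnalyticAt ℂ g c) (hfg : f c = g c) (hgc : g c ≠ 0)
    (hord : (n + 1 : ℕ) ≤ analyticOrderAt (f ^ 2 - g ^ 2) c) :
    iteratedDeriv n (f / g) c = 0 := by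
  have hsum : analyticOrderAt (f + g) c = 0 := by
    rw [(hf.add hg).analyticOrderAt_eq_zero, Pi.add_apply, hfg]
    simpa [← two_mul] using hgc
  have hsub : (n + 1 : ℕ) ≤ analyticOrderAt (f - g) c := by
    rwa [sq_sub_sq, analyticOrderAt_mul (hf.add hg) (hf.sub hg), hsum, zero_add] at hord
  have hquot : (n + 1 : ℕ) ≤ analyticOrderAt ((f - g) * g⁻¹) c := by
    rw [analyticOrderAt_mul (hf.sub hg) (hg.inv hgc)]
    exact hsub.trans le_self_add
  have hzero := (natCast_le_analyticOrderAt_iff_iteratedDeriv_eq_zero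
    ((hf.sub hg).mul (hg.inv hgc))).1 hquot n n.lt_succ_self
  have heq : f / g =ᶠ[nhds c] fun z => 1 + ((f - g) * g⁻¹) z := by
    filter_upwards [hg.continuousAt.eventually_ne hgc] with z hz
    simp only [Pi.div_apply, Pi.mul_apply, Pi.sub_apply, Pi.inv_apply]
    field_simp
    ring
  rw [heq.iteratedDeriv_eq, iteratedDeriv_const_add hn.bot_lt]
  exact hzero

section ProdCircleQuadratic

lemma mul_circleQuadratic (f : ℝ[X]) (τ : ℝ) :
    f * circleQuadratic τ = f * X ^ 2 - C (2 * Real.cos τ) * (f * X) + f := by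
  rw [circleQuadratic]
  ring

variable {ι : Type*} (s : Finset ι) (τ : ι → ℝ)

lemma coeff_zero_prod_circleQuadratic : (∏ j ∈ s, circleQuadratic (τ j)).coeff 0 = 1 := by
  rw [coeff_zero_prod]
  exact Finset.prod_eq_one fun j _ => by simp [circleQuadratic]

lemma coeff_one_prod_circleQuadratic :
    (∏ j ∈ s, circleQuadratic (τ j)).coeff 1 = -2 * ∑ j ∈ s, Real.cos (τ j) := by
  induction s using Finset.cons_induction with
  | empty => simp [coeff_one]
  | cons j s hj ih =>
    rw [Finset.prod_cons, Finset.sum_cons, mul_comm, mul_circleQuadratic, coeff_add, coeff_sub,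
      coeff_mul_X_pow', if_neg (by norm_num), coeff_C_mul, coeff_mul_X, ih,
      coeff_zero_prod_circleQuadratic]
    ring

lemma coeff_two_prod_circleQuadratic :
    (∏ j ∈ s, circleQuadratic (τ j)).coeff 2 =
      s.card + 2 * ((∑ j ∈ s, Real.cos (τ j)) ^ 2 - ∑ j ∈ s, Real.cos (τ j) ^ 2) := by
  induction s using Finset.cons_induction with
  | empty => simp [coeff_one]
  | cons j s hj ih =>
    rw [Finset.prod_cons, Finset.sum_cons, Finset.sum_cons, Finset.card_cons, mul_comm,
      mul_circleQuadratic, coeff_add, coeff_sub, coeff_mul_X_pow', if_pos le_rfl, Nat.sub_self,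
      coeff_C_mul, coeff_mul_X, ih, coeff_one_prod_circleQuadratic, coeff_zero_prod_circleQuadratic]
    push_cast
    ring

end ProdCircleQuadratic

section Dvd

variable {ℓ : ℕ} {t : ℕ → ℝ} {f : ℝ[X]}

lemma X_sq_dvd_sq_sub_branchPoly (h₀ : f.coeff 0 = 1)
    (h₁ : f.coeff 1 = -∑ j ∈ Finset.Icc 1 (2 * ℓ), Real.cos (t j)) :
    X ^ 2 ∣ f ^ 2 - branchPoly ℓ t := by
  rw [X_pow_dvd_iff]
  intro d hd
  rw [coeff_sub, sq, branchPoly, sub_eq_zero]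
  interval_cases d
  · rw [mul_coeff_zero, h₀, coeff_zero_prod_circleQuadratic, one_mul]
  · rw [mul_coeff_one, h₀, h₁, coeff_one_prod_circleQuadratic]
    ring

lemma X_cube_dvd_sq_sub_branchPoly (h₀ : f.coeff 0 = 1)
    (h₁ : f.coeff 1 = -∑ j ∈ Finset.Icc 1 (2 * ℓ), Real.cos (t j))
    (h₂ : f.coeff 2 = (∑ j ∈ Finset.Icc 1 (2 * ℓ), Real.cos (t j)) ^ 2 / 2 -
      ∑ j ∈ Finset.Icc 1 (2 * ℓ), Real.cos (t j) ^ 2 + ℓ) :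
    X ^ 3 ∣ f ^ 2 - branchPoly ℓ t := by
  rw [X_pow_dvd_iff]
  intro d hd
  obtain hd | rfl : d < 2 ∨ d = 2 := by omega
  · exact X_pow_dvd_iff.1 (X_sq_dvd_sq_sub_branchPoly h₀ h₁) d hd
  · have hsq : (f * f).coeff 2 = 2 * (f.coeff 0 * f.coeff 2) + f.coeff 1 ^ 2 := by
      rw [coeff_mul, Finset.Nat.sum_antidiagonal_eq_sum_range_succ_mk]
      simp only [Finset.sum_range_succ, Finset.sum_range_zero]
      ring
    rw [coeff_sub, sq, branchPoly, sub_eq_zero, hsq, h₀, h₁, h₂, coeff_two_prod_circleQuadratic,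
      Nat.card_Icc]
    push_cast
    ring

/-- The integrand of the contour integral which computes the coefficient of `uⁿ` in
`f / sqrtProd ℓ t`, after division by `du / u`. -/
noncomputable def cauchyIntegrand (ℓ : ℕ) (t : ℕ → ℝ) (f : ℝ[X]) (n : ℕ) (u : ℂ) : ℂ :=
  aeval u f / sqrtProd ℓ t u / u ^ n

lemma analyticAt_sqrtProd {u : ℂ} (hu : ‖u‖ < 1) : AnalyticAt ℂ (sqrtProd ℓ t) u :=
  DifferentiableOn.analyticAt (s := Metric.ball 0 1)
    (fun v hv => by
      rw [mem_ball_zero_iff] at hv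
      exact (differentiableAt_sqrtProd hv.le
        (aeval_branchPoly_ne_zero hv)).differentiableWithinAt)
    (Metric.isOpen_ball.mem_nhds (mem_ball_zero_iff.2 hu))

lemma analyticAt_aeval (f : ℝ[X]) (u : ℂ) : AnalyticAt ℂ (fun u => aeval u f) u :=
  analyticAt_id.aeval_polynomial f

lemma iteratedDeriv_aeval_div_sqrtProd_zero {n : ℕ} (hn : n ≠ 0) (h₀ : f.coeff 0 = 1)
    (hf : X ^ (n + 1) ∣ f ^ 2 - branchPoly ℓ t) :
    iteratedDeriv n ((fun u => aeval u f) / sqrtProd ℓ t) 0 = 0 := by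
  have hsqrt : AnalyticAt ℂ (sqrtProd ℓ t) 0 := analyticAt_sqrtProd (by simp)
  refine iteratedDeriv_div_eq_zero_of_le_analyticOrderAt hn (analyticAt_aeval f 0) hsqrt ?_ ?_ ?_
  · rw [sqrtProd_zero, ← coeff_zero_eq_aeval_zero', h₀, map_one]
  · rw [sqrtProd_zero]
    exact one_ne_zero
  · obtain ⟨g, hg⟩ := hf
    refine (natCast_le_analyticOrderAt (((analyticAt_aeval f 0).pow 2).sub (hsqrt.pow 2))).2
      ⟨fun u => aeval u g, analyticAt_aeval g 0, Filter.Eventually.of_forall fun u => ?_⟩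
    have := congrArg (aeval u) hg
    simpa [sqrtProd_sq] using this

lemma circleIntegral_cauchyIntegrand_div_eq_zero {n : ℕ} (hn : n ≠ 0) (h₀ : f.coeff 0 = 1)
    (hf : X ^ (n + 1) ∣ f ^ 2 - branchPoly ℓ t) {r : ℝ} (hr : r ∈ Set.Ioo 0 1) :
    (∮ u in C(0, r), cauchyIntegrand ℓ t f n u / u) = 0 := by
  have hd : DiffContOnCl ℂ ((fun u => aeval u f) / sqrtProd ℓ t) (Metric.ball 0 r) := by
    refine DifferentiableOn.diffContOnCl_ball (U := Metric.ball 0 1) (fun u hu => ?_)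
      (Metric.closedBall_subset_ball hr.2)
    rw [mem_ball_zero_iff] at hu
    exact ((analyticAt_aeval f u).differentiableAt.div
      (analyticAt_sqrtProd hu).differentiableAt
      (sqrtProd_ne_zero (aeval_branchPoly_ne_zero hu))).differentiableWithinAt
  have hcauchy := hd.circleIntegral_one_div_sub_center_pow_smul hr.1 n
  rw [iteratedDeriv_aeval_div_sqrtProd_zero hn h₀ hf, smul_zero] at hcauchy
  rw [← hcauchy]
  congr 1
  funext u
  simp only [cauchyIntegrand, Pi.div_apply, sub_zero, smul_eq_mul, pow_succ, mul_inv,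
    div_eq_mul_inv]
  ring

lemma integral_cauchyIntegrand_mul_exp_eq_zero {n : ℕ} (hn : n ≠ 0) (h₀ : f.coeff 0 = 1)
    (hf : X ^ (n + 1) ∣ f ^ 2 - branchPoly ℓ t) {r : ℝ} (hr : r ∈ Set.Ioo 0 1) :
    ∫ θ in (0 : ℝ)..2 * Real.pi, cauchyIntegrand ℓ t f n (r * exp (θ * I)) = 0 := by
  have hcircle := circleIntegral_cauchyIntegrand_div_eq_zero hn h₀ hf hr
  have hintegrand : ∀ θ : ℝ, deriv (circleMap 0 r) θ •
      (cauchyIntegrand ℓ t f n (circleMap 0 r θ) / circleMap 0 r θ) =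
      I * cauchyIntegrand ℓ t f n (r * exp (θ * I)) := fun θ => by
    have hne : circleMap 0 r θ ≠ 0 := circleMap_ne_center hr.1.ne'
    rw [deriv_circleMap, smul_eq_mul, mul_assoc, mul_left_comm, mul_div_cancel₀ _ hne,
      circleMap_zero]
  simp only [circleIntegral, hintegrand, intervalIntegral.integral_const_mul] at hcircle
  exact (mul_eq_zero.1 hcircle).resolve_left I_ne_zero

end Dvd

end Residue

section FirstGap

open Complex Polynomial Filter Topology MeasureTheory

variable {ℓ : ℕ} {t : ℕ → ℝ} {f : ℝ[X]} {n : ℕ}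

lemma ae_cos_ne_const (c : ℝ) : ∀ᵐ θ : ℝ, Real.cos θ ≠ c := by
  have hcountable : {θ : ℝ | Real.cos θ = c}.Countable := by
    rcases {θ : ℝ | Real.cos θ = c}.eq_empty_or_nonempty with hempty | ⟨α, rfl⟩
    · exact hempty ▸ Set.countable_empty
    · refine ((Set.countable_range fun k : ℤ => α - 2 * k * Real.pi).union
        (Set.countable_range fun k : ℤ => 2 * k * Real.pi - α)).mono fun θ hθ => ?_
      obtain ⟨k, hk | hk⟩ := Real.cos_eq_cos_iff.1 hθ
      · exact Or.inl ⟨k, by linarith⟩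
      · exact Or.inr ⟨k, by linarith⟩
  exact compl_mem_ae_iff.2 (hcountable.measure_zero volume)

lemma ae_cos_ne (ℓ : ℕ) (t : ℕ → ℝ) :
    ∀ᵐ θ : ℝ, ∀ j ∈ Finset.Icc 1 (2 * ℓ), Real.cos θ ≠ Real.cos (t j) :=
  (Finset.eventually_all _).2 fun _ _ => ae_cos_ne_const _

lemma measurable_cauchyIntegrand : Measurable (cauchyIntegrand ℓ t f n) :=
  ((f.continuous_aeval.measurable).div (measurable_sqrtProd ℓ t)).div (measurable_id.pow_const n)

lemma continuousAt_cauchyIntegrand {u : ℂ} (hu : ‖u‖ ≤ 1) (hu₀ : u ≠ 0)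
    (hD : aeval u (branchPoly ℓ t) ≠ 0) : ContinuousAt (cauchyIntegrand ℓ t f n) u :=
  (f.continuous_aeval.continuousAt.div (differentiableAt_sqrtProd hu hD).continuousAt
    (sqrtProd_ne_zero hD)).div (continuousAt_id.pow n) (pow_ne_zero n hu₀)

lemma norm_cauchyIntegrand_le {M : ℝ} (hM : ∀ u ∈ Metric.closedBall (0 : ℂ) 1, ‖aeval u f‖ ≤ M)
    {r : ℝ} (hr : r ∈ Set.Icc (1 / 2) 1) {θ : ℝ}
    (hθ : ∀ j ∈ Finset.Icc 1 (2 * ℓ), Real.cos θ ≠ Real.cos (t j)) :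
    ‖cauchyIntegrand ℓ t f n (r * exp (θ * I))‖ ≤ M * 2 ^ ℓ * 2 ^ n * weight ℓ t θ := by
  have hr₀ : 0 < r := by linarith [hr.1]
  have hnorm : ‖(r : ℂ) * exp (θ * I)‖ = r := by
    rw [norm_mul_exp, norm_real, Real.norm_of_nonneg hr₀.le]
  have hnum : ‖aeval ((r : ℂ) * exp (θ * I)) f‖ ≤ M :=
    hM _ (by rw [mem_closedBall_zero_iff, hnorm]; exact hr.2)
  have hpow : (r ^ n)⁻¹ ≤ 2 ^ n := by
    rw [← inv_pow]
    refine pow_le_pow_left₀ (by positivity) ?_ n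
    rw [inv_le_comm₀ hr₀ two_pos]
    linarith [hr.1]
  have hw := weight_nonneg ℓ t θ
  have hM₀ : 0 ≤ M := (norm_nonneg _).trans hnum
  calc ‖cauchyIntegrand ℓ t f n (r * exp (θ * I))‖
      = ‖aeval ((r : ℂ) * exp (θ * I)) f‖ * ‖(sqrtProd ℓ t (r * exp (θ * I)))⁻¹‖ * (r ^ n)⁻¹ := by
        rw [cauchyIntegrand, div_eq_mul_inv, div_eq_mul_inv, norm_mul, norm_mul, norm_inv (_ ^ n),
          norm_pow, hnorm]
    _ ≤ M * (2 ^ ℓ * weight ℓ t θ) * 2 ^ n := by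
        gcongr
        exact norm_inv_sqrtProd_le ⟨hr₀.le, hr.2⟩ hθ
    _ = M * 2 ^ ℓ * 2 ^ n * weight ℓ t θ := by ring

lemma exists_norm_aeval_le (f : ℝ[X]) :
    ∃ M, ∀ u ∈ Metric.closedBall (0 : ℂ) 1, ‖aeval u f‖ ≤ M :=
  (isCompact_closedBall 0 1).exists_bound_of_continuousOn f.continuous_aeval.continuousOn

lemma tendsto_cauchyIntegrand {θ : ℝ}
    (hθ : ∀ j ∈ Finset.Icc 1 (2 * ℓ), Real.cos θ ≠ Real.cos (t j)) :
    Tendsto (fun r : ℝ => cauchyIntegrand ℓ t f n (r * exp (θ * I))) (𝓝[<] 1)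
      (𝓝 (cauchyIntegrand ℓ t f n (exp (θ * I)))) := by
  have hcont : ContinuousAt (cauchyIntegrand ℓ t f n) (((1 : ℝ) : ℂ) * exp (θ * I)) := by
    rw [ofReal_one, one_mul]
    exact continuousAt_cauchyIntegrand (norm_exp_ofReal_mul_I θ).le (Complex.exp_ne_zero _)
      (aeval_branchPoly_exp_ne_zero hθ)
  have hcomp : ContinuousAt (fun r : ℝ => cauchyIntegrand ℓ t f n (r * exp (θ * I))) 1 :=
    ContinuousAt.comp (f := fun r : ℝ => (r : ℂ) * exp (θ * I)) hcont (by fun_prop)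
  simpa [ContinuousAt] using hcomp.mono_left nhdsWithin_le_nhds

lemma cauchyIntegrand_conj {u : ℂ} (hu : ‖u‖ ≤ 1) :
    cauchyIntegrand ℓ t f n (starRingEnd ℂ u) = starRingEnd ℂ (cauchyIntegrand ℓ t f n u) := by
  rw [cauchyIntegrand, cauchyIntegrand, map_div₀, map_div₀, map_pow, conj_sqrtProd _ _ hu,
    aeval_conj]

lemma re_cauchyIntegrand_exp_two_pi_sub (θ : ℝ) :
    (cauchyIntegrand ℓ t f n (exp ((2 * Real.pi - θ : ℝ) * I))).re =
      (cauchyIntegrand ℓ t f n (exp (θ * I))).re := by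
  have hconj : exp ((2 * Real.pi - θ : ℝ) * I) = starRingEnd ℂ (exp (θ * I)) := by
    rw [conj_exp_mul_I]
    push_cast
    rw [sub_mul, sub_eq_add_neg, Complex.exp_add, exp_two_pi_mul_I, one_mul, neg_mul]
  rw [hconj, cauchyIntegrand_conj (norm_exp_ofReal_mul_I θ).le, conj_re]

lemma integral_zero_two_mul_of_symm {g : ℝ → ℝ} {c : ℝ} (hc : 0 ≤ c)
    (hg : ∀ x, g (2 * c - x) = g x) (hint : IntervalIntegrable g volume 0 (2 * c)) :
    ∫ x in (0 : ℝ)..2 * c, g x = 2 * ∫ x in (0 : ℝ)..c, g x := by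
  have hc' : c ∈ Set.uIcc 0 (2 * c) := by
    rw [Set.uIcc_of_le (by linarith)]
    constructor <;> linarith
  have hreflect : ∫ x in c..2 * c, g x = ∫ x in (0 : ℝ)..c, g x := by
    have hsub := intervalIntegral.integral_comp_sub_left (a := 0) (b := c) g (2 * c)
    simp only [hg, sub_zero] at hsub
    rw [hsub, two_mul, add_sub_cancel_right]
  rw [← intervalIntegral.integral_add_adjacent_intervals
    (hint.mono_set (Set.uIcc_subset_uIcc_left hc'))
    (hint.mono_set (Set.uIcc_subset_uIcc_right hc')), hreflect, two_mul]

section PalindromePoly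

variable {m : ℕ}

/-- `palindrome m B` as a polynomial. -/
noncomputable def palindromePoly (m : ℕ) (B : Fin (m + 1) → ℝ) : ℝ[X] :=
  ∑ j : Fin m, C (B j.castSucc) * X ^ (2 * m - (j : ℕ)) +
    ∑ j : Fin (m + 1), C (B j) * X ^ (j : ℕ)

lemma aeval_palindromePoly (B : Fin (m + 1) → ℝ) (z : ℂ) :
    aeval z (palindromePoly m B) = palindrome m B z := by
  simp [palindromePoly, palindrome, Fin.sum_univ_castSucc, add_assoc]

lemma coeff_palindromePoly (B : Fin (m + 1) → ℝ) (j : Fin (m + 1)) :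
    (palindromePoly m B).coeff j = B j := by
  have hhigh : ∀ i : Fin m, (C (B i.castSucc) * X ^ (2 * m - (i : ℕ))).coeff (j : ℕ) = 0 :=
    fun i => by rw [coeff_C_mul_X_pow, if_neg (by omega)]
  rw [palindromePoly, coeff_add, finsetSum_coeff, finsetSum_coeff,
    Finset.sum_eq_zero fun i _ => hhigh i, zero_add, Finset.sum_eq_single j]
  · rw [coeff_C_mul_X_pow, if_pos rfl]
  · intro i _ hij
    rw [coeff_C_mul_X_pow, if_neg fun h => hij (Fin.ext h.symm)]
  · exact fun h => absurd (Finset.mem_univ j) h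

end PalindromePoly

/-- The integral of `p (cos θ) weight ℓ t θ` over the `k`-th gap, the gap number `0` being
`(0, t₁)`. -/
noncomputable def gapIntegral (ℓ : ℕ) (t : ℕ → ℝ) (k : ℕ) (p : ℝ[X]) : ℝ :=
  ∫ θ in t (2 * k)..t (2 * k + 1), p.eval (Real.cos θ) * weight ℓ t θ

namespace IsNodes

lemma intervalIntegrable_cauchyIntegrand (h : IsNodes ℓ t) (f : ℝ[X]) (n : ℕ) :
    IntervalIntegrable (fun θ : ℝ => cauchyIntegrand ℓ t f n (exp (θ * I))) volume 0
      (2 * Real.pi) := by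
  obtain ⟨M, hM⟩ := exists_norm_aeval_le f
  refine (h.intervalIntegrable_weight_two_pi.const_mul (M * 2 ^ ℓ * 2 ^ n)).mono_fun
    (measurable_cauchyIntegrand.comp (by fun_prop)).aestronglyMeasurable (ae_restrict_of_ae ?_)
  filter_upwards [ae_cos_ne ℓ t] with θ hθ
  have hle := norm_cauchyIntegrand_le (n := n) hM (r := 1) (by norm_num) hθ
  rw [ofReal_one, one_mul] at hle
  exact hle.trans (le_abs_self _)

lemma integral_cauchyIntegrand_eq_zero (h : IsNodes ℓ t) (hn : n ≠ 0) (h₀ : f.coeff 0 = 1)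
    (hf : X ^ (n + 1) ∣ f ^ 2 - branchPoly ℓ t) :
    ∫ θ in (0 : ℝ)..2 * Real.pi, cauchyIntegrand ℓ t f n (exp (θ * I)) = 0 := by
  obtain ⟨M, hM⟩ := exists_norm_aeval_le f
  have hmem : ∀ᶠ r : ℝ in 𝓝[<] 1, r ∈ Set.Ioo (1 / 2 : ℝ) 1 := Ioo_mem_nhdsLT (by norm_num)
  have hlim : Tendsto
      (fun r : ℝ => ∫ θ in (0 : ℝ)..2 * Real.pi, cauchyIntegrand ℓ t f n (r * exp (θ * I)))
      (𝓝[<] 1) (𝓝 (∫ θ in (0 : ℝ)..2 * Real.pi, cauchyIntegrand ℓ t f n (exp (θ * I)))) := by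
    refine intervalIntegral.tendsto_integral_filter_of_dominated_convergence
      (fun θ => M * 2 ^ ℓ * 2 ^ n * weight ℓ t θ) (.of_forall fun r =>
        (measurable_cauchyIntegrand.comp (by fun_prop)).aestronglyMeasurable) ?_
      (h.intervalIntegrable_weight_two_pi.const_mul _) ?_
    · filter_upwards [hmem] with r hr
      filter_upwards [ae_cos_ne ℓ t] with θ hθ _
      exact norm_cauchyIntegrand_le hM ⟨hr.1.le, hr.2.le⟩ hθ
    · filter_upwards [ae_cos_ne ℓ t] with θ hθ _
      exact tendsto_cauchyIntegrand hθ
  refine tendsto_nhds_unique hlim (tendsto_const_nhds.congr' ?_)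
  filter_upwards [hmem] with r hr
  exact (integral_cauchyIntegrand_mul_exp_eq_zero hn h₀ hf
    ⟨one_half_pos.trans hr.1, hr.2⟩).symm

lemma integral_re_cauchyIntegrand_eq_zero (h : IsNodes ℓ t) (hn : n ≠ 0) (h₀ : f.coeff 0 = 1)
    (hf : X ^ (n + 1) ∣ f ^ 2 - branchPoly ℓ t) :
    ∫ θ in (0 : ℝ)..Real.pi, (cauchyIntegrand ℓ t f n (exp (θ * I))).re = 0 := by
  have hint := h.intervalIntegrable_cauchyIntegrand f n
  have hre : IntervalIntegrable (fun θ : ℝ => (cauchyIntegrand ℓ t f n (exp (θ * I))).re) volume 0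
      (2 * Real.pi) := ⟨hint.1.re, hint.2.re⟩
  have hcircle : ∫ θ in (0 : ℝ)..2 * Real.pi, (cauchyIntegrand ℓ t f n (exp (θ * I))).re = 0 :=
    (reCLM.intervalIntegral_comp_comm hint).trans
      (by rw [h.integral_cauchyIntegrand_eq_zero hn h₀ hf, map_zero])
  rw [integral_zero_two_mul_of_symm Real.pi_pos.le re_cauchyIntegrand_exp_two_pi_sub
    hre] at hcircle
  exact (mul_eq_zero.1 hcircle).resolve_left two_ne_zero

lemma re_cauchyIntegrand_exp (h : IsNodes ℓ t) (B : Fin (ℓ + n + 1) → ℝ) {i : ℕ}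
    (hi : i ≤ 2 * ℓ) {θ : ℝ} (hθ : θ ∈ Set.Ioo (t i) (t (i + 1))) :
    (cauchyIntegrand ℓ t (palindromePoly (ℓ + n) B) n (exp (θ * I))).re =
      (2 ^ ℓ)⁻¹ * (I ^ i).re * ((chebPoly (ℓ + n) B).eval (Real.cos θ) * weight ℓ t θ) := by
  have hvalue : cauchyIntegrand ℓ t (palindromePoly (ℓ + n) B) n (exp (θ * I)) =
      (((2 ^ ℓ)⁻¹ * ((chebPoly (ℓ + n) B).eval (Real.cos θ) * weight ℓ t θ) : ℝ) : ℂ) * I ^ i := by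
    have hI : ((-I) ^ i)⁻¹ = I ^ i := by rw [← inv_pow, inv_neg, inv_I, neg_neg]
    have hexp := Complex.exp_ne_zero (θ * I)
    rw [cauchyIntegrand, aeval_palindromePoly, palindrome_exp, h.sqrtProd_exp hi hθ, ← hI]
    push_cast
    field_simp
    ring
  rw [hvalue, re_ofReal_mul]
  ring

lemma sum_integral_eq_zero (h : IsNodes ℓ t) (hn : n ≠ 0) {B : Fin (ℓ + n + 1) → ℝ}
    (h₀ : B 0 = 1) (hB : X ^ (n + 1) ∣ palindromePoly (ℓ + n) B ^ 2 - branchPoly ℓ t) :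
    ∑ i ∈ Finset.range (2 * ℓ + 1), (I ^ i).re *
      ∫ θ in t i..t (i + 1), (chebPoly (ℓ + n) B).eval (Real.cos θ) * weight ℓ t θ = 0 := by
  set g : ℝ → ℝ := fun θ =>
    (cauchyIntegrand ℓ t (palindromePoly (ℓ + n) B) n (exp (θ * I))).re
  have hint : IntervalIntegrable g volume 0 (2 * Real.pi) :=
    have := h.intervalIntegrable_cauchyIntegrand (palindromePoly (ℓ + n) B) n
    ⟨this.1.re, this.2.re⟩
  have hmem : ∀ i ≤ 2 * ℓ + 1, t i ∈ Set.uIcc 0 (2 * Real.pi) := fun i hi => by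
    rw [Set.uIcc_of_le Real.two_pi_pos.le]
    exact ⟨h.nonneg hi, (h.le_pi hi).trans (by linarith [Real.pi_pos])⟩
  have harc : ∀ i ∈ Finset.range (2 * ℓ + 1), ∫ θ in t i..t (i + 1), g θ =
      (2 ^ ℓ)⁻¹ * ((I ^ i).re * ∫ θ in t i..t (i + 1),
        (chebPoly (ℓ + n) B).eval (Real.cos θ) * weight ℓ t θ) := fun i hi => by
    have hi' : i ≤ 2 * ℓ := Nat.lt_succ_iff.1 (Finset.mem_range.1 hi)
    rw [← mul_assoc, ← intervalIntegral.integral_const_mul]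
    exact intervalIntegral.integral_congr_Ioo_of_le (h.lt i hi').le fun θ hθ =>
      h.re_cauchyIntegrand_exp B hi' hθ
  have hsum := intervalIntegral.sum_integral_adjacent_intervals (n := 2 * ℓ + 1) fun i hi =>
    hint.mono_set (Set.uIcc_subset_uIcc (hmem i (by omega)) (hmem (i + 1) (by omega)))
  rw [h.zero, h.last, h.integral_re_cauchyIntegrand_eq_zero hn
    ((coeff_palindromePoly B 0).trans h₀) hB, Finset.sum_congr rfl harc, ← Finset.mul_sum] at hsum
  exact (mul_eq_zero.1 hsum).resolve_left (by positivity)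

/-- The bands do not contribute to the sum of the integrals over all arcs, as `Re I^{2j+1} = 0`. -/
lemma gapIntegral_zero_eq_zero (h : IsNodes ℓ t) (hn : n ≠ 0) {B : Fin (ℓ + n + 1) → ℝ}
    (h₀ : B 0 = 1) (hB : X ^ (n + 1) ∣ palindromePoly (ℓ + n) B ^ 2 - branchPoly ℓ t)
    (hgap : ∀ k ∈ Set.Icc 1 ℓ, gapIntegral ℓ t k (chebPoly (ℓ + n) B) = 0) :
    gapIntegral ℓ t 0 (chebPoly (ℓ + n) B) = 0 := by
  have hsum := h.sum_integral_eq_zero hn h₀ hB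
  rw [Finset.sum_eq_single_of_mem 0 (by simp)] at hsum
  · simpa [gapIntegral] using hsum
  · intro i hi hi₀
    rw [Finset.mem_range] at hi
    obtain ⟨j, rfl | rfl⟩ := Nat.even_or_odd' i
    · exact mul_eq_zero_of_right _ (hgap j ⟨by omega, by omega⟩)
    · have hre : (I ^ (2 * j + 1)).re = 0 := by
        rw [pow_succ, pow_mul, I_sq]
        rcases neg_one_pow_eq_or ℂ j with hj | hj <;> simp [hj]
      rw [hre, zero_mul]

lemma gapIntegral_zero_eq_zero_of_first (h : IsNodes ℓ t) {B : Fin (ℓ + 1 + 1) → ℝ} (h₀ : B 0 = 1)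
    (h₁ : B 1 = -∑ j ∈ Finset.Icc 1 (2 * ℓ), Real.cos (t j))
    (hgap : ∀ k ∈ Set.Icc 1 ℓ, gapIntegral ℓ t k (chebPoly (ℓ + 1) B) = 0) :
    gapIntegral ℓ t 0 (chebPoly (ℓ + 1) B) = 0 :=
  h.gapIntegral_zero_eq_zero one_ne_zero h₀ (X_sq_dvd_sq_sub_branchPoly
    ((coeff_palindromePoly B 0).trans h₀) ((coeff_palindromePoly B 1).trans h₁)) hgap

lemma gapIntegral_zero_eq_zero_of_second (h : IsNodes ℓ t) {C : Fin (ℓ + 2 + 1) → ℝ}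
    (h₀ : C 0 = 1) (h₁ : C 1 = -∑ j ∈ Finset.Icc 1 (2 * ℓ), Real.cos (t j))
    (h₂ : C 2 = (∑ j ∈ Finset.Icc 1 (2 * ℓ), Real.cos (t j)) ^ 2 / 2 -
      ∑ j ∈ Finset.Icc 1 (2 * ℓ), Real.cos (t j) ^ 2 + ℓ)
    (hgap : ∀ k ∈ Set.Icc 1 ℓ, gapIntegral ℓ t k (chebPoly (ℓ + 2) C) = 0) :
    gapIntegral ℓ t 0 (chebPoly (ℓ + 2) C) = 0 :=
  h.gapIntegral_zero_eq_zero two_ne_zero h₀ (X_cube_dvd_sq_sub_branchPoly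
    ((coeff_palindromePoly C 0).trans h₀) ((coeff_palindromePoly C 1).trans h₁)
    ((coeff_palindromePoly C 2).trans h₂)) hgap

end IsNodes

end FirstGap

section GapRoots

open MeasureTheory Polynomial

/-- The image of the open `k`-th gap under `cos`. -/
def cosGap (t : ℕ → ℝ) (k : ℕ) : Set ℝ :=
  Set.Ioo (Real.cos (t (2 * k + 1))) (Real.cos (t (2 * k)))

lemma continuous_eval_cos (p : ℝ[X]) : Continuous fun θ => p.eval (Real.cos θ) :=
  p.continuous.comp Real.continuous_cos

lemma pos_or_neg_of_ne_zero {g : ℝ → ℝ} (hg : Continuous g) {a b : ℝ}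
    (hne : ∀ x ∈ Set.Ioo a b, g x ≠ 0) :
    (∀ x ∈ Set.Ioo a b, 0 < g x) ∨ ∀ x ∈ Set.Ioo a b, g x < 0 := by
  by_contra! hcon
  obtain ⟨⟨x, hx, hgx⟩, y, hy, hgy⟩ := hcon
  obtain ⟨z, hz, hgz⟩ := isPreconnected_Ioo.intermediate_value hx hy hg.continuousOn ⟨hgx, hgy⟩
  exact hne z hz hgz

lemma card_le_natDegree {p : ℝ[X]} (hp : p ≠ 0) {s : Finset ℝ} (hs : ∀ x ∈ s, p.eval x = 0) :
    s.card ≤ p.natDegree :=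
  card_le_degree_of_subset_roots fun x hx => (mem_roots hp).2 (hs x hx)

lemma ae_eval_cos_ne_zero {p : ℝ[X]} (hp : p ≠ 0) : ∀ᵐ θ : ℝ, p.eval (Real.cos θ) ≠ 0 := by
  filter_upwards [(Filter.eventually_all_finset p.roots.toFinset).2 fun c _ => ae_cos_ne_const c]
    with θ hθ hroot
  exact hθ _ (by simpa [hp] using hroot) rfl

lemma gapIntegral_neg (ℓ : ℕ) (t : ℕ → ℝ) (k : ℕ) (p : ℝ[X]) :
    gapIntegral ℓ t k (-p) = -gapIntegral ℓ t k p := by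
  simp only [gapIntegral, eval_neg, neg_mul, intervalIntegral.integral_neg]

namespace IsNodes

variable {ℓ : ℕ} {t : ℕ → ℝ} {k : ℕ}

lemma cos_mem_cosGap (h : IsNodes ℓ t) (hk : k ≤ ℓ) {θ : ℝ}
    (hθ : θ ∈ Set.Ioo (t (2 * k)) (t (2 * k + 1))) : Real.cos θ ∈ cosGap t k := by
  have hθπ := Set.Ioo_subset_Icc_self (h.mem_Ioo_zero_pi (by omega) hθ)
  exact ⟨Real.strictAntiOn_cos hθπ (h.mem_Icc_zero_pi (by omega)) hθ.2,
    Real.strictAntiOn_cos (h.mem_Icc_zero_pi (by omega)) hθπ hθ.1⟩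

lemma cosGap_lt (h : IsNodes ℓ t) {j : ℕ} (hjk : j < k) (hk : k ≤ ℓ) {x y : ℝ}
    (hx : x ∈ cosGap t j) (hy : y ∈ cosGap t k) : y < x :=
  (hy.2.trans_le (Real.antitoneOn_cos (h.mem_Icc_zero_pi (by omega)) (h.mem_Icc_zero_pi (by omega))
    (h.le_of_le (by omega) (by omega)))).trans hx.1

lemma eq_of_mem_cosGap (h : IsNodes ℓ t) {j : ℕ} (hj : j ≤ ℓ) (hk : k ≤ ℓ) {x : ℝ}
    (hxj : x ∈ cosGap t j) (hxk : x ∈ cosGap t k) : j = k := by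
  by_contra hjk
  rcases Nat.lt_or_gt_of_ne hjk with hlt | hlt
  · exact (h.cosGap_lt hlt hk hxj hxk).ne rfl
  · exact (h.cosGap_lt hlt hj hxk hxj).ne rfl

lemma intervalIntegrable_eval_cos_mul_weight (h : IsNodes ℓ t) (hk : k ≤ ℓ) (p : ℝ[X]) :
    IntervalIntegrable (fun θ => p.eval (Real.cos θ) * weight ℓ t θ) volume (t (2 * k))
      (t (2 * k + 1)) :=
  h.intervalIntegrable_mul_weight (continuous_eval_cos p) (h.mem_Icc_zero_pi (by omega))
    (h.mem_Icc_zero_pi (by omega))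

lemma gapIntegral_mul_add_mul (h : IsNodes ℓ t) (hk : k ≤ ℓ) (a b : ℝ) (p q : ℝ[X]) :
    gapIntegral ℓ t k (C a * p + C b * q) =
      a * gapIntegral ℓ t k p + b * gapIntegral ℓ t k q := by
  simp only [gapIntegral]
  rw [← intervalIntegral.integral_const_mul, ← intervalIntegral.integral_const_mul,
    ← intervalIntegral.integral_add
      ((h.intervalIntegrable_eval_cos_mul_weight hk p).const_mul a)
      ((h.intervalIntegrable_eval_cos_mul_weight hk q).const_mul b)]
  refine intervalIntegral.integral_congr fun θ _ => ?_
  simp only [eval_add, eval_mul, eval_C]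
  ring

lemma gapIntegral_pos (h : IsNodes ℓ t) (hk : k ≤ ℓ) {p : ℝ[X]} (hp : p ≠ 0)
    (hnonneg : ∀ x ∈ cosGap t k, 0 ≤ p.eval x) : 0 < gapIntegral ℓ t k p := by
  have hlt : t (2 * k) < t (2 * k + 1) := h.lt _ (by omega)
  have hint := h.intervalIntegrable_eval_cos_mul_weight hk p
  have hgap : ∀ θ ∈ Set.Ioo (t (2 * k)) (t (2 * k + 1)),
      0 ≤ p.eval (Real.cos θ) * weight ℓ t θ := fun θ hθ =>
    mul_nonneg (hnonneg _ (h.cos_mem_cosGap hk hθ)) (weight_nonneg ℓ t θ)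
  rw [gapIntegral, intervalIntegral.integral_of_le hlt.le, integral_Ioc_eq_integral_Ioo]
  refine (setIntegral_nonneg measurableSet_Ioo hgap).lt_of_ne' fun hzero => ?_
  rw [setIntegral_eq_zero_iff_of_nonneg_ae
    ((ae_restrict_iff' measurableSet_Ioo).2 (.of_forall hgap))
    (hint.1.mono_set Set.Ioo_subset_Ioc_self)] at hzero
  have hfalse : ∀ᵐ _ ∂volume.restrict (Set.Ioo (t (2 * k)) (t (2 * k + 1))), False := by
    filter_upwards [hzero, ae_restrict_of_ae (ae_eval_cos_ne_zero hp),
      ae_restrict_mem measurableSet_Ioo] with θ hθ hne hmem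
    exact mul_ne_zero hne (h.weight_pos (by omega) hmem).ne' hθ
  rw [Filter.eventually_false_iff_eq_bot, ae_eq_bot, Measure.restrict_eq_zero, Real.volume_Ioo,
    ENNReal.ofReal_eq_zero, sub_nonpos] at hfalse
  exact hfalse.not_gt hlt

/-- Otherwise `r * g` would have constant sign on the gap. -/
lemma exists_root_of_nonneg_mul (h : IsNodes ℓ t) (hk : k ≤ ℓ) {r g : ℝ[X]} (hr : r ≠ 0)
    (hnonneg : ∀ x, 0 ≤ r.eval x) (hzero : gapIntegral ℓ t k (r * g) = 0) :
    ∃ x ∈ cosGap t k, g.eval x = 0 := by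
  by_contra! hne
  have hpos : ∀ f : ℝ[X], (∀ x ∈ cosGap t k, 0 < f.eval x) → 0 < gapIntegral ℓ t k (r * f) := by
    intro f hf
    have hf₀ : f ≠ 0 := by
      rintro rfl
      exact (hf _ (h.cos_mem_cosGap hk (Set.nonempty_Ioo.2 (h.lt _ (by omega))).some_mem)).ne'
        eval_zero
    refine h.gapIntegral_pos hk (mul_ne_zero hr hf₀) fun x hx => ?_
    rw [eval_mul]
    exact mul_nonneg (hnonneg x) (hf x hx).le
  rcases pos_or_neg_of_ne_zero g.continuous hne with hg | hg
  · exact (hpos g hg).ne' hzero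
  · refine (hpos (-g) fun x hx => ?_).ne' ?_
    · rw [eval_neg]
      exact neg_pos.2 (hg x hx)
    · rw [mul_neg, gapIntegral_neg, hzero, neg_zero]

lemma exists_root (h : IsNodes ℓ t) (hk : k ≤ ℓ) {p : ℝ[X]} (hzero : gapIntegral ℓ t k p = 0) :
    ∃ x ∈ cosGap t k, p.eval x = 0 :=
  h.exists_root_of_nonneg_mul hk one_ne_zero (fun x => by simp) (by rwa [one_mul])

lemma exists_roots_finset (h : IsNodes ℓ t) {p : ℝ[X]} {K : Finset ℕ} (hK : ∀ k ∈ K, k ≤ ℓ)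
    (hroot : ∀ k ∈ K, ∃ x ∈ cosGap t k, p.eval x = 0) :
    ∃ s : Finset ℝ, s.card = K.card ∧ ∀ x ∈ s, p.eval x = 0 ∧ ∃ k ∈ K, x ∈ cosGap t k := by
  choose! x hx using hroot
  refine ⟨K.image x, Finset.card_image_of_injOn fun i hi j hj hij =>
    h.eq_of_mem_cosGap (hK i hi) (hK j hj) (hx i hi).1 (hij ▸ (hx j hj).1), fun y hy => ?_⟩
  obtain ⟨k, hk, rfl⟩ := Finset.mem_image.1 hy
  exact ⟨(hx k hk).2, k, hk, (hx k hk).1⟩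

lemma eq_zero_of_gapIntegral (h : IsNodes ℓ t) {p : ℝ[X]} {K : Finset ℕ} (hK : ∀ k ∈ K, k ≤ ℓ)
    (hdeg : p.natDegree < K.card) (hzero : ∀ k ∈ K, gapIntegral ℓ t k p = 0) : p = 0 := by
  by_contra hp
  obtain ⟨s, hcard, hs⟩ :=
    h.exists_roots_finset hK fun k hk => h.exists_root (hK k hk) (hzero k hk)
  exact (card_le_natDegree hp fun x hx => (hs x hx).1).not_gt (hcard ▸ hdeg)

/-- Removing a double root would leave a cofactor of degree at most `ℓ` that still has a root in
each of the `ℓ + 1` gaps. -/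
lemma derivative_ne_zero_of_root (h : IsNodes ℓ t) {f : ℝ[X]} (hf : f ≠ 0)
    (hdeg : f.natDegree ≤ ℓ + 2) (hzero : ∀ k ≤ ℓ, gapIntegral ℓ t k f = 0) {x₀ : ℝ}
    (hroot : f.eval x₀ = 0) : (derivative f).eval x₀ ≠ 0 := by
  intro hroot'
  have hmult : 2 ≤ f.rootMultiplicity x₀ := (one_lt_rootMultiplicity_iff_isRoot hf).2
    ⟨hroot, hroot'⟩
  obtain ⟨g, hfg⟩ := (le_rootMultiplicity_iff hf).1 hmult
  have hsq : (X - C x₀) ^ 2 ≠ 0 := pow_ne_zero 2 (X_sub_C_ne_zero x₀)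
  have hg : g ≠ 0 := right_ne_zero_of_mul (hfg ▸ hf)
  have hgap : ∀ j ∈ Finset.range (ℓ + 1), ∃ x ∈ cosGap t j, g.eval x = 0 := fun j hj => by
    have hj' : j ≤ ℓ := Nat.lt_succ_iff.1 (Finset.mem_range.1 hj)
    exact h.exists_root_of_nonneg_mul hj' hsq (fun x => by simpa using sq_nonneg (x - x₀))
      (hfg ▸ hzero j hj')
  obtain ⟨s, hcard, hs⟩ := h.exists_roots_finset
    (fun j hj => Nat.lt_succ_iff.1 (Finset.mem_range.1 hj)) hgap
  have hle := card_le_natDegree hg fun x hx => (hs x hx).1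
  rw [hfg, natDegree_mul hsq hg, natDegree_pow, natDegree_X_sub_C] at hdeg
  rw [hcard, Finset.card_range] at hle
  omega

end IsNodes

end GapRoots

section Pencil

open Polynomial Filter

lemma hasDerivAt_eval_div {p q : ℝ[X]} {x : ℝ} (hp : p.eval x ≠ 0) :
    HasDerivAt (fun x => q.eval x / p.eval x)
      ((wronskian p q).eval x / p.eval x ^ 2) x := by
  refine ((q.hasDerivAt x).div (p.hasDerivAt x) hp).congr_deriv ?_
  simp only [wronskian, eval_sub, eval_mul]
  ring

/-- The numerators of the two differentials, as polynomials in `cos θ`. -/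
structure IsPencil (ℓ : ℕ) (t : ℕ → ℝ) (p q : ℝ[X]) : Prop where
  nodes : IsNodes ℓ t
  natDegree_left : p.natDegree = ℓ + 1
  natDegree_right : q.natDegree = ℓ + 2
  leadingCoeff_left : 0 < p.leadingCoeff
  leadingCoeff_right : 0 < q.leadingCoeff
  gap_left : ∀ k ≤ ℓ, gapIntegral ℓ t k p = 0
  gap_right : ∀ k ≤ ℓ, gapIntegral ℓ t k q = 0

namespace IsPencil

variable {ℓ : ℕ} {t : ℕ → ℝ} {p q : ℝ[X]}

lemma left_ne_zero (H : IsPencil ℓ t p q) : p ≠ 0 :=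
  leadingCoeff_ne_zero.1 H.leadingCoeff_left.ne'

lemma coeff_left (H : IsPencil ℓ t p q) : p.coeff (ℓ + 1) = p.leadingCoeff := by
  rw [leadingCoeff, H.natDegree_left]

lemma coeff_right (H : IsPencil ℓ t p q) : q.coeff (ℓ + 2) = q.leadingCoeff := by
  rw [leadingCoeff, H.natDegree_right]

lemma comb_ne_zero (H : IsPencil ℓ t p q) {a b : ℝ} (hab : a ≠ 0 ∨ b ≠ 0) :
    C a * p + C b * q ≠ 0 := fun hzero => by
  have hp : p.coeff (ℓ + 2) = 0 := coeff_eq_zero_of_natDegree_lt (by rw [H.natDegree_left]; omega)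
  have htop := congrArg (fun f => f.coeff (ℓ + 2)) hzero
  simp only [coeff_add, coeff_C_mul, hp, mul_zero, zero_add, coeff_zero, H.coeff_right,
    mul_eq_zero, H.leadingCoeff_right.ne', or_false] at htop
  have hnext := congrArg (fun f => f.coeff (ℓ + 1)) hzero
  simp only [htop, map_zero, zero_mul, add_zero, coeff_C_mul, coeff_zero, H.coeff_left,
    mul_eq_zero, H.leadingCoeff_left.ne', or_false] at hnext
  exact hab.elim (· hnext) (· htop)

lemma natDegree_comb_le (H : IsPencil ℓ t p q) (a b : ℝ) :
    (C a * p + C b * q).natDegree ≤ ℓ + 2 :=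
  natDegree_add_le_of_degree_le
    ((natDegree_C_mul_le _ _).trans (H.natDegree_left.le.trans (Nat.le_succ _)))
    ((natDegree_C_mul_le _ _).trans H.natDegree_right.le)

lemma gapIntegral_comb (H : IsPencil ℓ t p q) (a b : ℝ) {k : ℕ} (hk : k ≤ ℓ) :
    gapIntegral ℓ t k (C a * p + C b * q) = 0 := by
  rw [H.nodes.gapIntegral_mul_add_mul hk, H.gap_left k hk, H.gap_right k hk, mul_zero, mul_zero,
    add_zero]

/-- A zero of the Wronskian would be a double root of some combination of `p` and `q`. -/
lemma wronskian_ne_zero (H : IsPencil ℓ t p q) (x : ℝ) : (wronskian p q).eval x ≠ 0 := by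
  have hsimple : ∀ a b : ℝ, (a ≠ 0 ∨ b ≠ 0) → a * p.eval x + b * q.eval x = 0 →
      a * (derivative p).eval x + b * (derivative q).eval x ≠ 0 := fun a b hab hroot => by
    simpa using H.nodes.derivative_ne_zero_of_root (H.comb_ne_zero hab) (H.natDegree_comb_le a b)
      (fun k hk => H.gapIntegral_comb a b hk) (x₀ := x) (by simpa using hroot)
  intro hW
  simp only [wronskian, eval_sub, eval_mul] at hW
  by_cases hpq : q.eval x ≠ 0 ∨ -p.eval x ≠ 0
  · exact hsimple _ _ hpq (by ring) (by linear_combination -hW)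
  · push Not at hpq
    have hp : p.eval x = 0 := neg_eq_zero.1 hpq.2
    have hp' : (derivative p).eval x ≠ 0 := by
      simpa using hsimple 1 0 (Or.inl one_ne_zero) (by simp [hp])
    exact hsimple ((derivative q).eval x) (-(derivative p).eval x) (Or.inr (neg_ne_zero.2 hp'))
      (by rw [hp, hpq.1]; ring) (by ring)

lemma natDegree_derivative_left_le (H : IsPencil ℓ t p q) : (derivative p).natDegree ≤ ℓ :=
  (natDegree_derivative_le p).trans_eq (by rw [H.natDegree_left, Nat.add_sub_cancel])

lemma natDegree_derivative_right_le (H : IsPencil ℓ t p q) :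
    (derivative q).natDegree ≤ ℓ + 1 :=
  (natDegree_derivative_le q).trans_eq (by rw [H.natDegree_right]; rfl)

lemma natDegree_wronskian_le (H : IsPencil ℓ t p q) :
    (wronskian p q).natDegree ≤ (ℓ + 1) + (ℓ + 1) := by
  refine natDegree_sub_le_of_le
    (natDegree_mul_le_of_le H.natDegree_left.le H.natDegree_derivative_right_le)
    ((natDegree_mul_le_of_le H.natDegree_derivative_left_le H.natDegree_right.le).trans_eq
      (by ring)) |>.trans_eq (max_self _)

lemma coeff_wronskian (H : IsPencil ℓ t p q) :
    (wronskian p q).coeff ((ℓ + 1) + (ℓ + 1)) = p.leadingCoeff * q.leadingCoeff := by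
  rw [wronskian, coeff_sub,
    coeff_mul_add_eq_of_natDegree_le H.natDegree_left.le H.natDegree_derivative_right_le,
    show ℓ + 1 + (ℓ + 1) = ℓ + (ℓ + 2) by ring,
    coeff_mul_add_eq_of_natDegree_le H.natDegree_derivative_left_le H.natDegree_right.le,
    coeff_derivative, coeff_derivative, H.coeff_left, H.coeff_right]
  push_cast
  ring

/-- The Wronskian has no zeros and is positive near infinity. -/
lemma wronskian_pos (H : IsPencil ℓ t p q) (x : ℝ) : 0 < (wronskian p q).eval x := by
  have hcoeff : 0 < (wronskian p q).coeff ((ℓ + 1) + (ℓ + 1)) := by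
    rw [H.coeff_wronskian]
    exact mul_pos H.leadingCoeff_left H.leadingCoeff_right
  have hdeg : (wronskian p q).natDegree = (ℓ + 1) + (ℓ + 1) :=
    H.natDegree_wronskian_le.antisymm (le_natDegree_of_ne_zero hcoeff.ne')
  have htop : Tendsto (fun x => (wronskian p q).eval x) atTop atTop :=
    tendsto_atTop_of_leadingCoeff_nonneg _ (natDegree_pos_iff_degree_pos.1 (by omega))
      (by rw [leadingCoeff, hdeg]; exact hcoeff.le)
  obtain ⟨y, hy⟩ := (htop.eventually_gt_atTop 0).exists
  by_contra! hx
  obtain ⟨z, -, hz⟩ := isPreconnected_univ.intermediate_value (Set.mem_univ x) (Set.mem_univ y)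
    (wronskian p q).continuous.continuousOn ⟨hx, hy.le⟩
  exact H.wronskian_ne_zero z hz

lemma strictMonoOn_div (H : IsPencil ℓ t p q) {s : Set ℝ} (hs : Convex ℝ s)
    (hp : ∀ x ∈ s, p.eval x ≠ 0) : StrictMonoOn (fun x => q.eval x / p.eval x) s := by
  refine strictMonoOn_of_deriv_pos hs
    (fun x hx => (hasDerivAt_eval_div (hp x hx)).continuousAt.continuousWithinAt) fun x hx => ?_
  have hpx := hp x (interior_subset hx)
  rw [(hasDerivAt_eval_div hpx).deriv]
  exact div_pos (H.wronskian_pos x) (sq_pos_of_ne_zero hpx)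

lemma cosGap_last (H : IsPencil ℓ t p q) :
    cosGap t ℓ = Set.Ioo (-1) (Real.cos (t (2 * ℓ))) := by
  rw [cosGap, H.nodes.last, Real.cos_pi]

lemma exists_eq_prod (H : IsPencil ℓ t p q) : ∃ x : ℕ → ℝ, (∀ k ≤ ℓ, x k ∈ cosGap t k) ∧
    p = C p.leadingCoeff * ∏ k ∈ Finset.range (ℓ + 1), (X - C (x k)) := by
  have hroot : ∀ k ≤ ℓ, ∃ x ∈ cosGap t k, p.eval x = 0 := fun k hk =>
    H.nodes.exists_root hk (H.gap_left k hk)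
  choose! x hx using hroot
  have hinj : Set.InjOn x (Finset.range (ℓ + 1)) := fun i hi j hj hij => by
    have hi' : i ≤ ℓ := Nat.lt_succ_iff.1 (Finset.mem_range.1 hi)
    have hj' : j ≤ ℓ := Nat.lt_succ_iff.1 (Finset.mem_range.1 hj)
    exact H.nodes.eq_of_mem_cosGap hi' hj' (hx i hi').1 (hij ▸ (hx j hj').1)
  have hcard : ((Finset.range (ℓ + 1)).image x).card = p.natDegree := by
    rw [Finset.card_image_of_injOn hinj, Finset.card_range, H.natDegree_left]
  have hroots : p.roots = ((Finset.range (ℓ + 1)).image x).val := by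
    refine roots_eq_of_natDegree_le_card_of_ne_zero (fun y hy => ?_) hcard.ge H.left_ne_zero
    obtain ⟨k, hk, rfl⟩ := Finset.mem_image.1 hy
    exact (hx k (Nat.lt_succ_iff.1 (Finset.mem_range.1 hk))).2
  refine ⟨x, fun k hk => (hx k hk).1, ?_⟩
  have hprod := C_leadingCoeff_mul_prod_multiset_X_sub_C (p := p) (by rw [hroots, ← hcard]; rfl)
  rw [hroots] at hprod
  rw [← Finset.prod_image (s := Finset.range (ℓ + 1)) (g := x) (f := fun y => X - C y) hinj]
  exact hprod.symm

/-- All roots of `p` but one lie to the right of the last gap. -/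
lemma exists_factor (H : IsPencil ℓ t p q) : ∃ x₀ ∈ cosGap t ℓ, ∃ D : ℝ[X],
    (∀ y ≤ Real.cos (t (2 * ℓ)), 0 < D.eval y) ∧ C ((-1) ^ ℓ) * p = D * (X - C x₀) := by
  obtain ⟨x, hx, hprod⟩ := H.exists_eq_prod
  refine ⟨x ℓ, hx ℓ le_rfl,
    C p.leadingCoeff * ∏ k ∈ Finset.range ℓ, (C (x k) - X), fun y hy => ?_, ?_⟩
  · rw [eval_mul, eval_C, eval_prod]
    refine mul_pos H.leadingCoeff_left (Finset.prod_pos fun k hk => ?_)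
    rw [Finset.mem_range] at hk
    rw [eval_sub, eval_C, eval_X, sub_pos]
    exact (hy.trans (Real.antitoneOn_cos (H.nodes.mem_Icc_zero_pi (by omega))
      (H.nodes.mem_Icc_zero_pi (by omega)) (H.nodes.le_of_le (by omega) (by omega)))).trans_lt
      (hx k hk.le).1
  · have hneg : ∏ k ∈ Finset.range ℓ, (C (x k) - X) =
        C ((-1) ^ ℓ) * ∏ k ∈ Finset.range ℓ, (X - C (x k)) := by
      simp only [← neg_sub X, Finset.prod_neg, Finset.card_range, C_pow, C_neg, C_1]
    nth_rw 1 [hprod]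
    rw [Finset.prod_range_succ, hneg]
    ring

/-- The zero of `p` in the last gap separates it into two parts on which `q / p` increases. The
combination of `p` and `q` that vanishes at the right end has a zero in the gap, and by
monotonicity this zero lies in the left part. -/
lemma div_neg_one_lt_div (H : IsPencil ℓ t p q) :
    q.eval (-1) / p.eval (-1) <
      q.eval (Real.cos (t (2 * ℓ))) / p.eval (Real.cos (t (2 * ℓ))) := by
  obtain ⟨x₀, hx₀, D, hD, hfactor⟩ := H.exists_factor
  set c := Real.cos (t (2 * ℓ)) with hc
  set v := q.eval c / p.eval c with hv
  have hp : ∀ y, (-1) ^ ℓ * p.eval y = D.eval y * (y - x₀) := fun y => by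
    simpa using congrArg (eval y) hfactor
  have hp_ne : ∀ y ≤ c, y ≠ x₀ → p.eval y ≠ 0 := fun y hy hyx hzero => by
    have := hp y
    rw [hzero, mul_zero] at this
    exact mul_ne_zero (hD y hy).ne' (sub_ne_zero.2 hyx) this.symm
  obtain ⟨z, hz, hzroot⟩ := H.nodes.exists_root le_rfl (H.gapIntegral_comb v (-1) le_rfl)
  rw [H.cosGap_last] at hx₀ hz
  have hzv : q.eval z = v * p.eval z := by
    simp only [eval_add, eval_mul, eval_C] at hzroot
    linarith
  have hz_ne : z ≠ x₀ := by
    rintro rfl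
    have hpz : p.eval z = 0 := by simpa using hp z
    refine H.wronskian_ne_zero z ?_
    rw [wronskian, eval_sub, eval_mul, eval_mul, hzv, hpz]
    ring
  have hdiv : q.eval z / p.eval z = v := by
    rw [hzv, mul_div_cancel_right₀ _ (hp_ne z hz.2.le hz_ne)]
  rcases lt_or_gt_of_ne hz_ne with hzx | hxz
  · have hmono := H.strictMonoOn_div (convex_Ico (-1) x₀) fun x hx =>
      hp_ne x (hx.2.trans hx₀.2).le hx.2.ne
    exact (hmono ⟨le_rfl, hx₀.1⟩ ⟨hz.1.le, hzx⟩ hz.1).trans_eq hdiv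
  · have hmono := H.strictMonoOn_div (convex_Ioc x₀ c) fun x hx => hp_ne x hx.2 hx.1.ne'
    exact absurd hdiv (hmono ⟨hxz, hz.2.le⟩ ⟨hx₀.2, le_rfl⟩ hz.2).ne

end IsPencil

end Pencil

section ValleyPeak

open Set Filter Topology

/-- The shape of `Im V` along the last gap: starting from `0` at `a` it decreases to a valley at
`b`, increases to a peak at `s` and decreases to `0` at `c`. For `b = a` there is no valley, for
`s = c` no peak. -/
structure IsValleyPeak (a c : ℝ) (f : ℝ → ℝ) (b s : ℝ) : Prop where
  left_le : a ≤ b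
  lt : b < s
  le_right : s ≤ c
  left_eq_zero : f a = 0
  right_eq_zero : f c = 0
  continuousOn : ContinuousOn f (Icc a c)
  strictAntiOn_left : StrictAntiOn f (Icc a b)
  strictMonoOn : StrictMonoOn f (Icc b s)
  strictAntiOn_right : StrictAntiOn f (Icc s c)
  contDiffOn : ContDiffOn ℝ 2 f (Ioo a c)
  eq_or_eq_of_deriv_eq_zero : ∀ θ ∈ Ioo a c, deriv f θ = 0 → θ = b ∨ θ = s
  deriv_deriv_valley_pos : a < b → 0 < deriv (deriv f) b
  deriv_deriv_peak_neg : s < c → deriv (deriv f) s < 0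

/-- `f` changes sign on `(a, c)` exactly at `ρ`, from negative to positive. -/
structure IsUpcrossing (a c : ℝ) (f : ℝ → ℝ) (ρ : ℝ) : Prop where
  mem : ρ ∈ Ioo a c
  eq_zero : f ρ = 0
  neg : ∀ θ ∈ Ioo a ρ, f θ < 0
  pos : ∀ θ ∈ Ioo ρ c, 0 < f θ

namespace IsValleyPeak

variable {a c b s θ : ℝ} {f g : ℝ → ℝ}

lemma valley_mem (h : IsValleyPeak a c f b s) (hb : a < b) : b ∈ Ioo a c :=
  ⟨hb, h.lt.trans_le h.le_right⟩

lemma peak_mem (h : IsValleyPeak a c f b s) (hs : s < c) : s ∈ Ioo a c :=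
  ⟨h.left_le.trans_lt h.lt, hs⟩

lemma neg_of_mem_Ioc (h : IsValleyPeak a c f b s) (hθ : θ ∈ Ioc a b) : f θ < 0 :=
  h.left_eq_zero ▸ h.strictAntiOn_left ⟨le_rfl, h.left_le⟩ ⟨hθ.1.le, hθ.2⟩ hθ.1

lemma pos_of_mem_Ico (h : IsValleyPeak a c f b s) (hθ : θ ∈ Ico s c) : 0 < f θ :=
  h.right_eq_zero ▸ h.strictAntiOn_right ⟨hθ.1, hθ.2.le⟩ ⟨h.le_right, le_rfl⟩ hθ.2

lemma valley_neg (h : IsValleyPeak a c f b s) (hb : a < b) : f b < 0 :=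
  h.neg_of_mem_Ioc ⟨hb, le_rfl⟩

lemma peak_pos (h : IsValleyPeak a c f b s) (hs : s < c) : 0 < f s :=
  h.pos_of_mem_Ico ⟨le_rfl, hs⟩

lemma valley_lt (h : IsValleyPeak a c f b s) (hb : a < b) (hθ : θ ∈ Ioo a c) (hne : θ ≠ b) :
    f b < f θ := by
  rcases hne.lt_or_gt with hlt | hgt
  · exact h.strictAntiOn_left ⟨hθ.1.le, hlt.le⟩ ⟨h.left_le, le_rfl⟩ hlt
  · rcases le_or_gt θ s with hle | hsθ
    · exact h.strictMonoOn ⟨le_rfl, h.lt.le⟩ ⟨hgt.le, hle⟩ hgt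
    · exact (h.valley_neg hb).trans (h.pos_of_mem_Ico ⟨hsθ.le, hθ.2⟩)

lemma lt_peak (h : IsValleyPeak a c f b s) (hs : s < c) (hθ : θ ∈ Ioo a c) (hne : θ ≠ s) :
    f θ < f s := by
  rcases hne.lt_or_gt with hlt | hgt
  · rcases le_or_gt b θ with hle | hθb
    · exact h.strictMonoOn ⟨hle, hlt.le⟩ ⟨h.lt.le, le_rfl⟩ hlt
    · exact (h.neg_of_mem_Ioc ⟨hθ.1, hθb.le⟩).trans (h.peak_pos hs)
  · exact h.strictAntiOn_right ⟨le_rfl, h.le_right⟩ ⟨hgt.le, hθ.2.le⟩ hgt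

lemma deriv_valley (h : IsValleyPeak a c f b s) (hb : a < b) : deriv f b = 0 := by
  have hmin : IsLocalMin f b := by
    filter_upwards [isOpen_Ioo.mem_nhds (h.valley_mem hb)] with θ hθ
    rcases eq_or_ne θ b with rfl | hne
    exacts [le_rfl, (h.valley_lt hb hθ hne).le]
  exact hmin.deriv_eq_zero

lemma deriv_peak (h : IsValleyPeak a c f b s) (hs : s < c) : deriv f s = 0 := by
  have hmax : IsLocalMax f s := by
    filter_upwards [isOpen_Ioo.mem_nhds (h.peak_mem hs)] with θ hθ
    rcases eq_or_ne θ s with rfl | hne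
    exacts [le_rfl, (h.lt_peak hs hθ hne).le]
  exact hmax.deriv_eq_zero

lemma neg_of_peak_eq (h : IsValleyPeak a c f b s) (hs : s = c) (hθ : θ ∈ Ioo a c) : f θ < 0 := by
  rcases le_or_gt θ b with hle | hbθ
  · exact h.neg_of_mem_Ioc ⟨hθ.1, hle⟩
  · have hfs : f s = 0 := hs ▸ h.right_eq_zero
    exact hfs ▸ h.strictMonoOn ⟨hbθ.le, (hs ▸ hθ.2).le⟩ ⟨h.lt.le, le_rfl⟩ (hs ▸ hθ.2)

lemma pos_of_valley_eq (h : IsValleyPeak a c f b s) (hb : b = a) (hθ : θ ∈ Ioo a c) :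
    0 < f θ := by
  rcases le_or_gt s θ with hle | hθs
  · exact h.pos_of_mem_Ico ⟨hle, hθ.2⟩
  · have hfb : f b = 0 := hb ▸ h.left_eq_zero
    exact hfb ▸ h.strictMonoOn ⟨le_rfl, h.lt.le⟩ ⟨(hb ▸ hθ.1).le, hθs.le⟩ (hb ▸ hθ.1)

lemma exists_isUpcrossing (h : IsValleyPeak a c f b s) (hb : a < b) (hs : s < c) :
    ∃ ρ ∈ Ioo b s, IsUpcrossing a c f ρ := by
  obtain ⟨ρ, hρ, hρ₀⟩ := intermediate_value_Ioo h.lt.le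
    (h.continuousOn.mono (Icc_subset_Icc hb.le hs.le)) ⟨h.valley_neg hb, h.peak_pos hs⟩
  refine ⟨ρ, hρ, ⟨hb.trans hρ.1, hρ.2.trans hs⟩, hρ₀, fun θ hθ => ?_, fun θ hθ => ?_⟩
  · rcases le_or_gt θ b with hle | hbθ
    · exact h.neg_of_mem_Ioc ⟨hθ.1, hle⟩
    · exact hρ₀ ▸ h.strictMonoOn ⟨hbθ.le, (hθ.2.trans hρ.2).le⟩ (Ioo_subset_Icc_self hρ) hθ.2
  · rcases le_or_gt s θ with hle | hθs
    · exact h.pos_of_mem_Ico ⟨hle, hθ.2⟩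
    · exact hρ₀ ▸ h.strictMonoOn (Ioo_subset_Icc_self hρ) ⟨(hρ.1.trans hθ.1).le, hθs.le⟩ hθ.1

lemma congr (h : IsValleyPeak a c f b s) (hfg : EqOn f g (Icc a c)) : IsValleyPeak a c g b s := by
  have hac : a ≤ c := h.left_le.trans (h.lt.le.trans h.le_right)
  have hderiv : EqOn (deriv f) (deriv g) (Ioo a c) :=
    (hfg.mono Ioo_subset_Icc_self).deriv isOpen_Ioo
  have hderiv₂ : EqOn (deriv (deriv f)) (deriv (deriv g)) (Ioo a c) := hderiv.deriv isOpen_Ioo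
  exact
    { h with
      left_eq_zero := hfg ⟨le_rfl, hac⟩ ▸ h.left_eq_zero
      right_eq_zero := hfg ⟨hac, le_rfl⟩ ▸ h.right_eq_zero
      continuousOn := h.continuousOn.congr hfg.symm
      strictAntiOn_left := h.strictAntiOn_left.congr
        (hfg.mono (Icc_subset_Icc_right (h.lt.le.trans h.le_right)))
      strictMonoOn := h.strictMonoOn.congr (hfg.mono (Icc_subset_Icc h.left_le h.le_right))
      strictAntiOn_right := h.strictAntiOn_right.congr
        (hfg.mono (Icc_subset_Icc_left (h.left_le.trans h.lt.le)))
      contDiffOn := h.contDiffOn.congr (hfg.symm.mono Ioo_subset_Icc_self)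
      eq_or_eq_of_deriv_eq_zero := fun θ hθ hzero =>
        h.eq_or_eq_of_deriv_eq_zero θ hθ ((hderiv hθ).trans hzero)
      deriv_deriv_valley_pos := fun hb => hderiv₂ (h.valley_mem hb) ▸ h.deriv_deriv_valley_pos hb
      deriv_deriv_peak_neg := fun hs => hderiv₂ (h.peak_mem hs) ▸ h.deriv_deriv_peak_neg hs }

end IsValleyPeak

namespace IsUpcrossing

variable {a c ρ σ θ : ℝ} {f g : ℝ → ℝ}

lemma eq_of_eq_zero (h : IsUpcrossing a c f ρ) (hθ : θ ∈ Ioo a c) (hzero : f θ = 0) : ρ = θ := by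
  rcases lt_trichotomy ρ θ with hlt | heq | hgt
  · exact absurd hzero (h.pos θ ⟨hlt, hθ.2⟩).ne'
  · exact heq
  · exact absurd hzero (h.neg θ ⟨hθ.1, hgt⟩).ne

lemma lt_of_neg (h : IsUpcrossing a c f ρ) (hθ : θ ∈ Ioo a c) (hneg : f θ < 0) : θ < ρ := by
  by_contra! hle
  rcases hle.eq_or_lt with rfl | hlt
  exacts [hneg.ne h.eq_zero, hneg.not_gt (h.pos θ ⟨hlt, hθ.2⟩)]

lemma lt_of_lt (hf : IsUpcrossing a c f ρ) (hg : IsUpcrossing a c g σ) (hlt : f σ < g σ) :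
    σ < ρ :=
  hf.lt_of_neg hg.mem (hg.eq_zero ▸ hlt)

end IsUpcrossing

/-- A family of functions on `[a, c]`, increasing in the parameter `ξ`, of which the valley is
present for `ξ < ξ₁` and the peak for `ξ > ξ₀`; both move towards `a` as `ξ` increases. -/
structure IsValleyPeakFamily (a c ξ₀ ξ₁ : ℝ) (f : ℝ → ℝ → ℝ) (b s : ℝ → ℝ) : Prop where
  lt : ξ₀ < ξ₁
  isValleyPeak : ∀ ξ, IsValleyPeak a c (f ξ) (b ξ) (s ξ)
  left_lt_valley_iff : ∀ ξ, a < b ξ ↔ ξ < ξ₁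
  peak_lt_right_iff : ∀ ξ, s ξ < c ↔ ξ₀ < ξ
  strictAntiOn_valley : StrictAntiOn b (Iio ξ₁)
  strictAntiOn_peak : StrictAntiOn s (Ioi ξ₀)
  strictMono : ∀ θ ∈ Ioo a c, StrictMono fun ξ => f ξ θ
  continuous : ∀ θ ∈ Ioo a c, Continuous fun ξ => f ξ θ

namespace IsValleyPeakFamily

variable {a c ξ₀ ξ₁ ξ θ : ℝ} {f g : ℝ → ℝ → ℝ} {b s ρ : ℝ → ℝ}

lemma congr (h : IsValleyPeakFamily a c ξ₀ ξ₁ f b s) (hfg : ∀ ξ, EqOn (f ξ) (g ξ) (Icc a c)) :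
    IsValleyPeakFamily a c ξ₀ ξ₁ g b s :=
  { h with
    isValleyPeak := fun ξ => (h.isValleyPeak ξ).congr (hfg ξ)
    strictMono := fun θ hθ => by
      simpa only [hfg _ (Ioo_subset_Icc_self hθ)] using h.strictMono θ hθ
    continuous := fun θ hθ => by
      simpa only [hfg _ (Ioo_subset_Icc_self hθ)] using h.continuous θ hθ }

lemma peak_eq_right (h : IsValleyPeakFamily a c ξ₀ ξ₁ f b s) (hξ : ξ ≤ ξ₀) : s ξ = c :=
  (h.isValleyPeak ξ).le_right.antisymm
    (not_lt.1 fun hlt => hξ.not_gt ((h.peak_lt_right_iff ξ).1 hlt))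

lemma valley_eq_left (h : IsValleyPeakFamily a c ξ₀ ξ₁ f b s) (hξ : ξ₁ ≤ ξ) : b ξ = a :=
  (not_lt.1 fun hlt => hξ.not_gt ((h.left_lt_valley_iff ξ).1 hlt)).antisymm
    (h.isValleyPeak ξ).left_le

lemma valley_mem (h : IsValleyPeakFamily a c ξ₀ ξ₁ f b s) (hξ : ξ < ξ₁) : b ξ ∈ Ioo a c :=
  (h.isValleyPeak ξ).valley_mem ((h.left_lt_valley_iff ξ).2 hξ)

lemma peak_mem (h : IsValleyPeakFamily a c ξ₀ ξ₁ f b s) (hξ : ξ₀ < ξ) : s ξ ∈ Ioo a c :=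
  (h.isValleyPeak ξ).peak_mem ((h.peak_lt_right_iff ξ).2 hξ)

lemma neg_of_le (h : IsValleyPeakFamily a c ξ₀ ξ₁ f b s) (hξ : ξ ≤ ξ₀) (hθ : θ ∈ Ioo a c) :
    f ξ θ < 0 :=
  (h.isValleyPeak ξ).neg_of_peak_eq (h.peak_eq_right hξ) hθ

lemma eq_valley_of_deriv_eq_zero (h : IsValleyPeakFamily a c ξ₀ ξ₁ f b s) (hξ : ξ ≤ ξ₀)
    (hθ : θ ∈ Ioo a c) (hderiv : deriv (f ξ) θ = 0) : θ = b ξ :=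
  ((h.isValleyPeak ξ).eq_or_eq_of_deriv_eq_zero θ hθ hderiv).resolve_right fun hs =>
    hθ.2.ne (hs.trans (h.peak_eq_right hξ))

lemma exists_upcrossings (h : IsValleyPeakFamily a c ξ₀ ξ₁ f b s) :
    ∃ ρ : ℝ → ℝ, ∀ ξ ∈ Ioo ξ₀ ξ₁, ρ ξ ∈ Ioo (b ξ) (s ξ) ∧ IsUpcrossing a c (f ξ) (ρ ξ) := by
  choose! ρ hρ using fun ξ (hξ : ξ ∈ Ioo ξ₀ ξ₁) => (h.isValleyPeak ξ).exists_isUpcrossing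
    ((h.left_lt_valley_iff ξ).2 hξ.2) ((h.peak_lt_right_iff ξ).2 hξ.1)
  exact ⟨ρ, hρ⟩

lemma strictAntiOn_upcrossing (h : IsValleyPeakFamily a c ξ₀ ξ₁ f b s)
    (hρ : ∀ ξ ∈ Ioo ξ₀ ξ₁, IsUpcrossing a c (f ξ) (ρ ξ)) : StrictAntiOn ρ (Ioo ξ₀ ξ₁) :=
  fun ξ hξ ζ hζ hlt => (hρ ξ hξ).lt_of_lt (hρ ζ hζ) (h.strictMono _ (hρ ζ hζ).mem hlt)

lemma tendsto_upcrossing (h : IsValleyPeakFamily a c ξ₀ ξ₁ f b s)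
    (hρ : ∀ ξ ∈ Ioo ξ₀ ξ₁, IsUpcrossing a c (f ξ) (ρ ξ)) : Tendsto ρ (𝓝[>] ξ₀) (𝓝 c) := by
  have hmem : ∀ᶠ ξ in 𝓝[>] ξ₀, ξ ∈ Ioo ξ₀ ξ₁ := Ioo_mem_nhdsGT h.lt
  refine tendsto_order.2 ⟨fun x hx => ?_, fun x hx => ?_⟩
  · obtain ⟨θ, hθ, hθc⟩ := exists_between (max_lt hx (h.valley_mem h.lt).2)
    have hθ_mem : θ ∈ Ioo a c :=
      ⟨(h.valley_mem h.lt).1.trans ((le_max_right _ _).trans_lt hθ), hθc⟩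
    have hneg : ∀ᶠ ξ in 𝓝 ξ₀, f ξ θ < 0 :=
      (h.continuous θ hθ_mem).continuousAt.eventually_lt continuousAt_const
        (h.neg_of_le le_rfl hθ_mem)
    filter_upwards [hmem, nhdsWithin_le_nhds hneg] with ξ hξ hξθ
    exact ((le_max_left _ _).trans_lt hθ).trans ((hρ ξ hξ).lt_of_neg hθ_mem hξθ)
  · filter_upwards [hmem] with ξ hξ using (hρ ξ hξ).mem.2.trans hx

lemma tendsto_peak (h : IsValleyPeakFamily a c ξ₀ ξ₁ f b s) : Tendsto s (𝓝[>] ξ₀) (𝓝 c) := by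
  obtain ⟨ρ, hρ⟩ := h.exists_upcrossings
  refine tendsto_of_tendsto_of_tendsto_of_le_of_le' (h.tendsto_upcrossing fun ξ hξ => (hρ ξ hξ).2)
    tendsto_const_nhds ?_ (Eventually.of_forall fun ξ => (h.isValleyPeak ξ).le_right)
  filter_upwards [Ioo_mem_nhdsGT h.lt] with ξ hξ using (hρ ξ hξ).1.2.le

lemma exists_eq_zero (h : IsValleyPeakFamily a c ξ₀ ξ₁ f b s) (hθ : θ ∈ Ioo a c) :
    ∃ ξ ∈ Ioo ξ₀ ξ₁, f ξ θ = 0 :=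
  intermediate_value_Ioo h.lt.le (h.continuous θ hθ).continuousOn
    ⟨h.neg_of_le le_rfl hθ, (h.isValleyPeak ξ₁).pos_of_valley_eq (h.valley_eq_left le_rfl) hθ⟩

lemma existsUnique_upcrossing_eq (h : IsValleyPeakFamily a c ξ₀ ξ₁ f b s)
    (hρ : ∀ ξ ∈ Ioo ξ₀ ξ₁, IsUpcrossing a c (f ξ) (ρ ξ)) (hθ : θ ∈ Ioo a c) :
    ∃! ξ, ξ ∈ Ioo ξ₀ ξ₁ ∧ ρ ξ = θ := by
  obtain ⟨ξ, hξ, hzero⟩ := h.exists_eq_zero hθ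
  have heq : ρ ξ = θ := (hρ ξ hξ).eq_of_eq_zero hθ hzero
  exact ⟨ξ, ⟨hξ, heq⟩, fun ζ hζ =>
    (h.strictAntiOn_upcrossing hρ).injOn hζ.1 hξ (hζ.2.trans heq.symm)⟩

end IsValleyPeakFamily

end ValleyPeak

section Slope

open Polynomial Set

/-- Up to a positive factor, the `θ`-derivative of `Im V` on the last gap. -/
noncomputable def slope (ℓ : ℕ) (p q : ℝ[X]) (ξ θ : ℝ) : ℝ :=
  (-1) ^ ℓ * (ξ / 2 * p.eval (Real.cos θ) - q.eval (Real.cos θ))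

/-- The parameter for which `e^{iθ}` is a critical point of `Im V`. -/
noncomputable def criticalParam (p q : ℝ[X]) (θ : ℝ) : ℝ :=
  2 * (q.eval (Real.cos θ) / p.eval (Real.cos θ))

/-- `m` is the argument of the zero of the first differential on the last gap. -/
structure IsLastZero (ℓ : ℕ) (t : ℕ → ℝ) (p : ℝ[X]) (m : ℝ) : Prop where
  mem : m ∈ Ioo (t (2 * ℓ)) Real.pi
  eq_zero : p.eval (Real.cos m) = 0
  derivative_pos : 0 < (-1) ^ ℓ * (derivative p).eval (Real.cos m)
  pos : ∀ x ∈ Ioc (Real.cos m) (Real.cos (t (2 * ℓ))), 0 < (-1) ^ ℓ * p.eval x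
  neg : ∀ x ∈ Ico (-1) (Real.cos m), (-1) ^ ℓ * p.eval x < 0

lemma hasDerivAt_slope (ℓ : ℕ) (p q : ℝ[X]) (ξ θ : ℝ) :
    HasDerivAt (slope ℓ p q ξ) ((-1) ^ ℓ * (ξ / 2 * (derivative p).eval (Real.cos θ) -
      (derivative q).eval (Real.cos θ)) * -Real.sin θ) θ := by
  have hp := (p.hasDerivAt (Real.cos θ)).comp θ (Real.hasDerivAt_cos θ)
  have hq := (q.hasDerivAt (Real.cos θ)).comp θ (Real.hasDerivAt_cos θ)
  refine (((hp.const_mul (ξ / 2)).sub hq).const_mul ((-1) ^ ℓ)).congr_deriv ?_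
  ring

lemma contDiff_slope {n : ℕ∞} (ℓ : ℕ) (p q : ℝ[X]) (ξ : ℝ) : ContDiff ℝ n (slope ℓ p q ξ) := by
  have heval (r : ℝ[X]) : ContDiff ℝ n fun θ => r.eval (Real.cos θ) :=
    (by simpa using r.contDiff_aeval (𝕜 := ℝ) n : ContDiff ℝ n fun x => r.eval x).comp
      Real.contDiff_cos
  exact contDiff_const.mul ((contDiff_const.mul (heval p)).sub (heval q))

lemma continuous_slope (ℓ : ℕ) (p q : ℝ[X]) (ξ : ℝ) : Continuous (slope ℓ p q ξ) :=
  (contDiff_slope (n := 0) ℓ p q ξ).continuous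

lemma slope_eq_mul {p : ℝ[X]} {θ : ℝ} (hp : p.eval (Real.cos θ) ≠ 0) (ℓ : ℕ) (q : ℝ[X]) (ξ : ℝ) :
    slope ℓ p q ξ θ = (-1) ^ ℓ * p.eval (Real.cos θ) / 2 * (ξ - criticalParam p q θ) := by
  rw [slope, criticalParam]
  field_simp

lemma slope_eq_zero_iff {p : ℝ[X]} {θ : ℝ} (hp : p.eval (Real.cos θ) ≠ 0) (ℓ : ℕ) (q : ℝ[X])
    (ξ : ℝ) : slope ℓ p q ξ θ = 0 ↔ criticalParam p q θ = ξ := by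
  have hne : (-1) ^ ℓ * p.eval (Real.cos θ) / 2 ≠ 0 := by positivity
  rw [slope_eq_mul hp, mul_eq_zero, or_iff_right hne, sub_eq_zero, eq_comm]

lemma IsPencil.deriv_slope_of_eq_zero {ℓ : ℕ} {t : ℕ → ℝ} {p q : ℝ[X]} (H : IsPencil ℓ t p q)
    {ξ θ : ℝ} (hθ : θ ∈ Ioo 0 Real.pi) (hp : p.eval (Real.cos θ) ≠ 0)
    (hzero : slope ℓ p q ξ θ = 0) :
    ∃ y > 0, deriv (slope ℓ p q ξ) θ = (-1) ^ ℓ * p.eval (Real.cos θ) * y := by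
  refine ⟨_, mul_pos (div_pos (H.wronskian_pos (Real.cos θ)) (sq_pos_of_ne_zero hp))
    (Real.sin_pos_of_mem_Ioo hθ), ?_⟩
  rw [(hasDerivAt_slope ℓ p q ξ θ).deriv, ← (slope_eq_zero_iff hp ℓ q ξ).1 hzero, criticalParam,
    wronskian, eval_sub, eval_mul, eval_mul]
  field_simp
  ring

namespace IsLastZero

variable {ℓ : ℕ} {t : ℕ → ℝ} {p q : ℝ[X]} {m ξ θ : ℝ}

lemma cos_mem_Ioc (hm : IsLastZero ℓ t p m) (h : IsNodes ℓ t) (hθ : θ ∈ Ico (t (2 * ℓ)) m) :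
    Real.cos θ ∈ Ioc (Real.cos m) (Real.cos (t (2 * ℓ))) :=
  have ha : 0 ≤ t (2 * ℓ) := h.nonneg (Nat.le_succ _)
  ⟨Real.cos_lt_cos_of_nonneg_of_le_pi (ha.trans hθ.1) hm.mem.2.le hθ.2,
    Real.cos_le_cos_of_nonneg_of_le_pi ha (hθ.2.trans hm.mem.2).le hθ.1⟩

lemma cos_mem_Ico (hm : IsLastZero ℓ t p m) (h : IsNodes ℓ t) (hθ : θ ∈ Ioc m Real.pi) :
    Real.cos θ ∈ Ico (-1) (Real.cos m) :=
  ⟨Real.neg_one_le_cos θ, Real.cos_lt_cos_of_nonneg_of_le_pi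
    ((h.nonneg (Nat.le_succ _)).trans hm.mem.1.le) hθ.2 hθ.1⟩

lemma pos_left (hm : IsLastZero ℓ t p m) (h : IsNodes ℓ t) (hθ : θ ∈ Ico (t (2 * ℓ)) m) :
    0 < (-1) ^ ℓ * p.eval (Real.cos θ) :=
  hm.pos _ (hm.cos_mem_Ioc h hθ)

lemma neg_right (hm : IsLastZero ℓ t p m) (h : IsNodes ℓ t) (hθ : θ ∈ Ioc m Real.pi) :
    (-1) ^ ℓ * p.eval (Real.cos θ) < 0 :=
  hm.neg _ (hm.cos_mem_Ico h hθ)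

lemma strictAntiOn_criticalParam_left (hm : IsLastZero ℓ t p m) (H : IsPencil ℓ t p q) :
    StrictAntiOn (criticalParam p q) (Ico (t (2 * ℓ)) m) := fun _ hx _ hy hxy =>
  mul_lt_mul_of_pos_left (H.strictMonoOn_div (convex_Ioc _ _)
    (fun z hz => right_ne_zero_of_mul (hm.pos z hz).ne') (hm.cos_mem_Ioc H.nodes hy)
    (hm.cos_mem_Ioc H.nodes hx) (Real.cos_lt_cos_of_nonneg_of_le_pi
      ((H.nodes.nonneg (Nat.le_succ _)).trans hx.1) (hy.2.trans hm.mem.2).le hxy)) two_pos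

lemma strictAntiOn_criticalParam_right (hm : IsLastZero ℓ t p m) (H : IsPencil ℓ t p q) :
    StrictAntiOn (criticalParam p q) (Ioc m Real.pi) := fun _ hx _ hy hxy =>
  mul_lt_mul_of_pos_left (H.strictMonoOn_div (convex_Ico _ _)
    (fun z hz => right_ne_zero_of_mul (hm.neg z hz).ne) (hm.cos_mem_Ico H.nodes hy)
    (hm.cos_mem_Ico H.nodes hx) (Real.cos_lt_cos_of_nonneg_of_le_pi
      ((H.nodes.nonneg (Nat.le_succ _)).trans (hm.mem.1.trans hx.1).le) hy.2 hxy)) two_pos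

lemma slope_pos (hm : IsLastZero ℓ t p m) (H : IsPencil ℓ t p q) (ξ : ℝ) :
    0 < slope ℓ p q ξ m := by
  have hW := H.wronskian_pos (Real.cos m)
  rw [wronskian, eval_sub, eval_mul, eval_mul, hm.eq_zero, zero_mul, zero_sub] at hW
  have hsq : (-1 : ℝ) ^ ℓ * (-1) ^ ℓ = 1 := by rw [← mul_pow, neg_one_mul, neg_neg, one_pow]
  rw [slope, hm.eq_zero, mul_zero, zero_sub]
  refine pos_of_mul_pos_right (a := (-1) ^ ℓ * (derivative p).eval (Real.cos m)) (hW.trans_eq ?_)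
    hm.derivative_pos.le
  linear_combination ((derivative p).eval (Real.cos m) * q.eval (Real.cos m)) * hsq

lemma slope_neg_left (hm : IsLastZero ℓ t p m) (h : IsNodes ℓ t) (hθ : θ ∈ Ico (t (2 * ℓ)) m)
    (hξ : ξ < criticalParam p q θ) : slope ℓ p q ξ θ < 0 := by
  have hp := hm.pos_left h hθ
  rw [slope_eq_mul (right_ne_zero_of_mul hp.ne')]
  exact mul_neg_of_pos_of_neg (half_pos hp) (sub_neg.2 hξ)

lemma slope_pos_left (hm : IsLastZero ℓ t p m) (h : IsNodes ℓ t) (hθ : θ ∈ Ico (t (2 * ℓ)) m)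
    (hξ : criticalParam p q θ < ξ) : 0 < slope ℓ p q ξ θ := by
  have hp := hm.pos_left h hθ
  rw [slope_eq_mul (right_ne_zero_of_mul hp.ne')]
  exact mul_pos (half_pos hp) (sub_pos.2 hξ)

lemma slope_neg_right (hm : IsLastZero ℓ t p m) (h : IsNodes ℓ t) (hθ : θ ∈ Ioc m Real.pi)
    (hξ : criticalParam p q θ < ξ) : slope ℓ p q ξ θ < 0 := by
  have hp := hm.neg_right h hθ
  rw [slope_eq_mul (right_ne_zero_of_mul hp.ne)]
  exact mul_neg_of_neg_of_pos (div_neg_of_neg_of_pos hp two_pos) (sub_pos.2 hξ)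

lemma slope_pos_right (hm : IsLastZero ℓ t p m) (h : IsNodes ℓ t) (hθ : θ ∈ Ioc m Real.pi)
    (hξ : ξ < criticalParam p q θ) : 0 < slope ℓ p q ξ θ := by
  have hp := hm.neg_right h hθ
  rw [slope_eq_mul (right_ne_zero_of_mul hp.ne)]
  exact mul_pos_of_neg_of_neg (div_neg_of_neg_of_pos hp two_pos) (sub_neg.2 hξ)

lemma exists_valley (hm : IsLastZero ℓ t p m) (H : IsPencil ℓ t p q) (ξ : ℝ) :
    ∃ b ∈ Ico (t (2 * ℓ)) m, criticalParam p q b ≤ ξ ∧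
      (t (2 * ℓ) < b → criticalParam p q b = ξ) := by
  rcases le_or_gt (criticalParam p q (t (2 * ℓ))) ξ with hle | hlt
  · exact ⟨_, ⟨le_rfl, hm.mem.1⟩, hle, fun hlt => absurd hlt (lt_irrefl _)⟩
  · obtain ⟨b, hb, hzero⟩ := intermediate_value_Ioo hm.mem.1.le
      (continuous_slope ℓ p q ξ).continuousOn
      ⟨hm.slope_neg_left H.nodes ⟨le_rfl, hm.mem.1⟩ hlt, hm.slope_pos H ξ⟩
    have hb' := Ioo_subset_Ico_self hb
    have hcrit := (slope_eq_zero_iff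
      (right_ne_zero_of_mul (hm.pos_left H.nodes hb').ne') ℓ q ξ).1 hzero
    exact ⟨b, hb', hcrit.le, fun _ => hcrit⟩

lemma exists_peak (hm : IsLastZero ℓ t p m) (H : IsPencil ℓ t p q) (ξ : ℝ) :
    ∃ s ∈ Ioc m Real.pi, ξ ≤ criticalParam p q s ∧
      (s < Real.pi → criticalParam p q s = ξ) := by
  rcases le_or_gt ξ (criticalParam p q Real.pi) with hle | hlt
  · exact ⟨_, ⟨hm.mem.2, le_rfl⟩, hle, fun hlt => absurd hlt (lt_irrefl _)⟩
  · obtain ⟨s, hs, hzero⟩ := intermediate_value_Ioo' hm.mem.2.le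
      (continuous_slope ℓ p q ξ).continuousOn
      ⟨hm.slope_neg_right H.nodes ⟨hm.mem.2, le_rfl⟩ hlt, hm.slope_pos H ξ⟩
    have hs' := Ioo_subset_Ioc_self hs
    have hcrit := (slope_eq_zero_iff
      (right_ne_zero_of_mul (hm.neg_right H.nodes hs').ne) ℓ q ξ).1 hzero
    exact ⟨s, hs', hcrit.ge, fun _ => hcrit⟩

end IsLastZero

lemma IsPencil.exists_isLastZero {ℓ : ℕ} {t : ℕ → ℝ} {p q : ℝ[X]} (H : IsPencil ℓ t p q) :
    ∃ m, IsLastZero ℓ t p m := by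
  obtain ⟨x₀, hx₀, D, hD, hfactor⟩ := H.exists_factor
  rw [H.cosGap_last] at hx₀
  have hp : ∀ y, (-1) ^ ℓ * p.eval y = D.eval y * (y - x₀) := fun y => by
    simpa using congrArg (eval y) hfactor
  have hp' : (-1) ^ ℓ * (derivative p).eval x₀ = D.eval x₀ := by
    simpa only [derivative_C, derivative_mul, derivative_X_sub_C, eval_mul, eval_C, eval_add,
      eval_sub, eval_X, eval_zero, eval_one, sub_self, zero_mul, mul_zero, zero_add, mul_one]
      using congrArg (fun f => (derivative f).eval x₀) hfactor
  have ha := H.nodes.mem_Icc_zero_pi (Nat.le_succ (2 * ℓ))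
  have hcos : Real.cos (Real.arccos x₀) = x₀ :=
    Real.cos_arccos hx₀.1.le (hx₀.2.le.trans (Real.cos_le_one _))
  refine ⟨Real.arccos x₀, ⟨?_, ?_⟩, ?_, ?_, ?_, ?_⟩
  · rw [← Real.arccos_cos ha.1 ha.2]
    exact Real.strictAntiOn_arccos ⟨hx₀.1.le, hx₀.2.le.trans (Real.cos_le_one _)⟩
      ⟨Real.neg_one_le_cos _, Real.cos_le_one _⟩ hx₀.2
  · rw [← Real.arccos_neg_one]
    exact Real.strictAntiOn_arccos ⟨le_rfl, by norm_num⟩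
      ⟨hx₀.1.le, hx₀.2.le.trans (Real.cos_le_one _)⟩ hx₀.1
  all_goals rw [hcos]
  · simpa using hp x₀
  · exact hp' ▸ hD x₀ hx₀.2.le
  · exact fun x hx => hp x ▸ mul_pos (hD x hx.2) (sub_pos.2 hx.1)
  · exact fun x hx => hp x ▸ mul_neg_of_pos_of_neg (hD x (hx.2.trans hx₀.2).le) (sub_neg.2 hx.2)

/-- The arguments `b` and `s` of the valley and the peak of `Im V(· ; ξ)` on the last gap. They
lie on the two sides of `m`, and are moved to the end of the gap when there is no critical point
on that side. -/
structure IsCriticalPair (ℓ : ℕ) (t : ℕ → ℝ) (p q : ℝ[X]) (m ξ b s : ℝ) : Prop where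
  valley_mem : b ∈ Ico (t (2 * ℓ)) m
  peak_mem : s ∈ Ioc m Real.pi
  valley_le : criticalParam p q b ≤ ξ
  le_peak : ξ ≤ criticalParam p q s
  valley_eq : t (2 * ℓ) < b → criticalParam p q b = ξ
  peak_eq : s < Real.pi → criticalParam p q s = ξ

lemma IsLastZero.exists_isCriticalPair {ℓ : ℕ} {t : ℕ → ℝ} {p q : ℝ[X]} {m : ℝ}
    (hm : IsLastZero ℓ t p m) (H : IsPencil ℓ t p q) (ξ : ℝ) :
    ∃ b s, IsCriticalPair ℓ t p q m ξ b s := by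
  obtain ⟨b, hb, hle, hbξ⟩ := hm.exists_valley H ξ
  obtain ⟨s, hs, hge, hsξ⟩ := hm.exists_peak H ξ
  exact ⟨b, s, hb, hs, hle, hge, hbξ, hsξ⟩

namespace IsCriticalPair

variable {ℓ : ℕ} {t : ℕ → ℝ} {p q : ℝ[X]} {m ξ b s θ : ℝ}

lemma left_lt_valley_iff (h : IsCriticalPair ℓ t p q m ξ b s) (hm : IsLastZero ℓ t p m)
    (H : IsPencil ℓ t p q) : t (2 * ℓ) < b ↔ ξ < criticalParam p q (t (2 * ℓ)) := by
  refine ⟨fun hb => h.valley_eq hb ▸ hm.strictAntiOn_criticalParam_left H ⟨le_rfl, hm.mem.1⟩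
    h.valley_mem hb, fun hξ => h.valley_mem.1.lt_of_ne ?_⟩
  rintro rfl
  exact h.valley_le.not_gt hξ

lemma peak_lt_right_iff (h : IsCriticalPair ℓ t p q m ξ b s) (hm : IsLastZero ℓ t p m)
    (H : IsPencil ℓ t p q) : s < Real.pi ↔ criticalParam p q Real.pi < ξ := by
  refine ⟨fun hs => (hm.strictAntiOn_criticalParam_right H h.peak_mem ⟨hm.mem.2, le_rfl⟩
    hs).trans_eq (h.peak_eq hs), fun hξ => h.peak_mem.2.lt_of_ne ?_⟩
  rintro rfl
  exact h.le_peak.not_gt hξ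

lemma slope_neg_left (h : IsCriticalPair ℓ t p q m ξ b s) (hm : IsLastZero ℓ t p m)
    (H : IsPencil ℓ t p q) (hθ : θ ∈ Ioo (t (2 * ℓ)) b) : slope ℓ p q ξ θ < 0 := by
  have hθ' : θ ∈ Ico (t (2 * ℓ)) m := ⟨hθ.1.le, hθ.2.trans h.valley_mem.2⟩
  refine hm.slope_neg_left H.nodes hθ' ?_
  rw [← h.valley_eq (hθ.1.trans hθ.2)]
  exact hm.strictAntiOn_criticalParam_left H hθ' h.valley_mem hθ.2

lemma slope_neg_right (h : IsCriticalPair ℓ t p q m ξ b s) (hm : IsLastZero ℓ t p m)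
    (H : IsPencil ℓ t p q) (hθ : θ ∈ Ioo s Real.pi) : slope ℓ p q ξ θ < 0 := by
  have hθ' : θ ∈ Ioc m Real.pi := ⟨h.peak_mem.1.trans hθ.1, hθ.2.le⟩
  refine hm.slope_neg_right H.nodes hθ' ?_
  rw [← h.peak_eq (hθ.1.trans hθ.2)]
  exact hm.strictAntiOn_criticalParam_right H h.peak_mem hθ' hθ.1

lemma slope_pos (h : IsCriticalPair ℓ t p q m ξ b s) (hm : IsLastZero ℓ t p m)
    (H : IsPencil ℓ t p q) (hθ : θ ∈ Ioo b s) : 0 < slope ℓ p q ξ θ := by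
  rcases lt_trichotomy θ m with hlt | rfl | hgt
  · have hθ' : θ ∈ Ico (t (2 * ℓ)) m := ⟨h.valley_mem.1.trans hθ.1.le, hlt⟩
    exact hm.slope_pos_left H.nodes hθ' <|
      (hm.strictAntiOn_criticalParam_left H h.valley_mem hθ' hθ.1).trans_le h.valley_le
  · exact hm.slope_pos H ξ
  · have hθ' : θ ∈ Ioc m Real.pi := ⟨hgt, hθ.2.le.trans h.peak_mem.2⟩
    exact hm.slope_pos_right H.nodes hθ' <|
      h.le_peak.trans_lt (hm.strictAntiOn_criticalParam_right H hθ' h.peak_mem hθ.2)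

lemma eq_or_eq_of_slope_eq_zero (h : IsCriticalPair ℓ t p q m ξ b s) (hm : IsLastZero ℓ t p m)
    (H : IsPencil ℓ t p q) (hθ : θ ∈ Ioo (t (2 * ℓ)) Real.pi) (hzero : slope ℓ p q ξ θ = 0) :
    θ = b ∨ θ = s := by
  by_contra! hne
  rcases lt_or_gt_of_ne hne.1 with hb | hb
  · exact (h.slope_neg_left hm H ⟨hθ.1, hb⟩).ne hzero
  rcases lt_or_gt_of_ne hne.2 with hs | hs
  · exact (h.slope_pos hm H ⟨hb, hs⟩).ne' hzero
  · exact (h.slope_neg_right hm H ⟨hs, hθ.2⟩).ne hzero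

lemma slope_valley (h : IsCriticalPair ℓ t p q m ξ b s) (hm : IsLastZero ℓ t p m)
    (hnodes : IsNodes ℓ t) (hb : t (2 * ℓ) < b) : slope ℓ p q ξ b = 0 :=
  (slope_eq_zero_iff (right_ne_zero_of_mul (hm.pos_left hnodes h.valley_mem).ne') ℓ q ξ).2
    (h.valley_eq hb)

lemma slope_peak (h : IsCriticalPair ℓ t p q m ξ b s) (hm : IsLastZero ℓ t p m)
    (hnodes : IsNodes ℓ t) (hs : s < Real.pi) : slope ℓ p q ξ s = 0 :=
  (slope_eq_zero_iff (right_ne_zero_of_mul (hm.neg_right hnodes h.peak_mem).ne) ℓ q ξ).2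
    (h.peak_eq hs)

lemma deriv_slope_valley_pos (h : IsCriticalPair ℓ t p q m ξ b s) (hm : IsLastZero ℓ t p m)
    (H : IsPencil ℓ t p q) (hb : t (2 * ℓ) < b) : 0 < deriv (slope ℓ p q ξ) b := by
  have hp := hm.pos_left H.nodes h.valley_mem
  obtain ⟨y, hy, hderiv⟩ := H.deriv_slope_of_eq_zero
    ⟨(H.nodes.nonneg (Nat.le_succ _)).trans_lt hb, h.valley_mem.2.trans hm.mem.2⟩
    (right_ne_zero_of_mul hp.ne') (h.slope_valley hm H.nodes hb)
  exact hderiv ▸ mul_pos hp hy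

lemma deriv_slope_peak_neg (h : IsCriticalPair ℓ t p q m ξ b s) (hm : IsLastZero ℓ t p m)
    (H : IsPencil ℓ t p q) (hs : s < Real.pi) : deriv (slope ℓ p q ξ) s < 0 := by
  have hp := hm.neg_right H.nodes h.peak_mem
  obtain ⟨y, hy, hderiv⟩ := H.deriv_slope_of_eq_zero
    ⟨(H.nodes.nonneg (Nat.le_succ _)).trans_lt (hm.mem.1.trans h.peak_mem.1), hs⟩
    (right_ne_zero_of_mul hp.ne) (h.slope_peak hm H.nodes hs)
  exact hderiv ▸ mul_neg_of_neg_of_pos hp hy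

end IsCriticalPair

end Slope

section GapPrimitive

open Polynomial Set Topology MeasureTheory

/-- The primitive of `2^{-ℓ} g · weight` on the last gap that vanishes at its first endpoint; the
imaginary parts of `φ₁`, `φ₂` and `V` have this form. -/
noncomputable def gapPrimitive (ℓ : ℕ) (t : ℕ → ℝ) (g : ℝ → ℝ) (θ : ℝ) : ℝ :=
  (2 ^ ℓ)⁻¹ * ∫ φ in t (2 * ℓ)..θ, g φ * weight ℓ t φ

lemma gapPrimitive_left (ℓ : ℕ) (t : ℕ → ℝ) (g : ℝ → ℝ) :
    gapPrimitive ℓ t g (t (2 * ℓ)) = 0 := by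
  rw [gapPrimitive, intervalIntegral.integral_same, mul_zero]

namespace IsNodes

variable {ℓ : ℕ} {t : ℕ → ℝ} {g : ℝ → ℝ} {x y θ : ℝ}

lemma weight_pos_last (h : IsNodes ℓ t) (hθ : θ ∈ Ioo (t (2 * ℓ)) Real.pi) :
    0 < weight ℓ t θ :=
  h.weight_pos le_rfl (by rwa [h.last])

lemma contDiffAt_weight (h : IsNodes ℓ t) {n : ℕ∞} (hθ : θ ∈ Ioo (t (2 * ℓ)) Real.pi) :
    ContDiffAt ℝ n (weight ℓ t) θ := by
  unfold weight
  refine contDiffAt_prod fun j hj => ?_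
  have hne : Real.cos θ - Real.cos (t j) ≠ 0 :=
    sub_ne_zero.2 (h.cos_ne le_rfl (by have := Finset.mem_Icc.1 hj; omega) (by rwa [h.last]))
  have hsub : ContDiffAt ℝ n (fun θ => Real.cos θ - Real.cos (t j)) θ :=
    Real.contDiff_cos.contDiffAt.sub contDiffAt_const
  exact ((hsub.abs hne).sqrt (abs_ne_zero.2 hne)).inv (Real.sqrt_ne_zero'.2 (abs_pos.2 hne))

lemma intervalIntegrable_last (h : IsNodes ℓ t) (hg : Continuous g)
    (hθ : θ ∈ Icc (t (2 * ℓ)) Real.pi) :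
    IntervalIntegrable (fun φ => g φ * weight ℓ t φ) volume (t (2 * ℓ)) θ :=
  have ha := h.mem_Icc_zero_pi (Nat.le_succ (2 * ℓ))
  h.intervalIntegrable_mul_weight hg ha ⟨ha.1.trans hθ.1, hθ.2⟩

lemma continuousOn_gapPrimitive (h : IsNodes ℓ t) (hg : Continuous g) :
    ContinuousOn (gapPrimitive ℓ t g) (Icc (t (2 * ℓ)) Real.pi) := by
  have hle : t (2 * ℓ) ≤ Real.pi := (h.lt_pi le_rfl).le
  rw [← uIcc_of_le hle]
  exact continuousOn_const.mul (intervalIntegral.continuousOn_primitive_interval'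
    (h.intervalIntegrable_last hg ⟨hle, le_rfl⟩) left_mem_uIcc)

lemma hasDerivAt_gapPrimitive (h : IsNodes ℓ t) (hg : Continuous g)
    (hθ : θ ∈ Ioo (t (2 * ℓ)) Real.pi) :
    HasDerivAt (gapPrimitive ℓ t g) ((2 ^ ℓ)⁻¹ * (g θ * weight ℓ t θ)) θ := by
  have hmeas : StronglyMeasurable fun φ => g φ * weight ℓ t φ :=
    (hg.measurable.mul (measurable_weight ℓ t)).stronglyMeasurable
  exact (intervalIntegral.integral_hasDerivAt_right
    (h.intervalIntegrable_last hg (Ioo_subset_Icc_self hθ)) hmeas.stronglyMeasurableAtFilter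
    (hg.continuousAt.mul (h.contDiffAt_weight (n := 0) hθ).continuousAt)).const_mul _

lemma strictMonoOn_gapPrimitive (h : IsNodes ℓ t) (hg : Continuous g) (hx : t (2 * ℓ) ≤ x)
    (hy : y ≤ Real.pi) (hpos : ∀ θ ∈ Ioo x y, 0 < g θ) :
    StrictMonoOn (gapPrimitive ℓ t g) (Icc x y) := by
  refine strictMonoOn_of_deriv_pos (convex_Icc x y)
    ((h.continuousOn_gapPrimitive hg).mono (Icc_subset_Icc hx hy)) fun θ hθ => ?_
  rw [interior_Icc] at hθ
  have hθ' := Ioo_subset_Ioo hx hy hθ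
  rw [(h.hasDerivAt_gapPrimitive hg hθ').deriv]
  exact mul_pos (by positivity) (mul_pos (hpos θ hθ) (h.weight_pos_last hθ'))

lemma strictAntiOn_gapPrimitive (h : IsNodes ℓ t) (hg : Continuous g) (hx : t (2 * ℓ) ≤ x)
    (hy : y ≤ Real.pi) (hneg : ∀ θ ∈ Ioo x y, g θ < 0) :
    StrictAntiOn (gapPrimitive ℓ t g) (Icc x y) := by
  refine strictAntiOn_of_deriv_neg (convex_Icc x y)
    ((h.continuousOn_gapPrimitive hg).mono (Icc_subset_Icc hx hy)) fun θ hθ => ?_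
  rw [interior_Icc] at hθ
  have hθ' := Ioo_subset_Ioo hx hy hθ
  rw [(h.hasDerivAt_gapPrimitive hg hθ').deriv]
  exact mul_neg_of_pos_of_neg (by positivity)
    (mul_neg_of_neg_of_pos (hneg θ hθ) (h.weight_pos_last hθ'))

lemma contDiffOn_gapPrimitive (h : IsNodes ℓ t) (hg : ContDiff ℝ 1 g) :
    ContDiffOn ℝ 2 (gapPrimitive ℓ t g) (Ioo (t (2 * ℓ)) Real.pi) := by
  rw [show (2 : WithTop ℕ∞) = 1 + 1 from one_add_one_eq_two.symm,
    contDiffOn_succ_iff_deriv_of_isOpen isOpen_Ioo]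
  refine ⟨fun θ hθ => (h.hasDerivAt_gapPrimitive hg.continuous hθ).differentiableAt
    |>.differentiableWithinAt, by simp, ?_⟩
  have hderiv : ContDiffOn ℝ 1 (fun θ => (2 ^ ℓ : ℝ)⁻¹ * (g θ * weight ℓ t θ))
      (Ioo (t (2 * ℓ)) Real.pi) := fun θ hθ =>
    (contDiffAt_const.mul (hg.contDiffAt.mul (h.contDiffAt_weight hθ))).contDiffWithinAt
  exact hderiv.congr fun θ hθ => (h.hasDerivAt_gapPrimitive hg.continuous hθ).deriv

lemma deriv_deriv_gapPrimitive (h : IsNodes ℓ t) (hg : Differentiable ℝ g)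
    (hθ : θ ∈ Ioo (t (2 * ℓ)) Real.pi) (hzero : g θ = 0) :
    deriv (deriv (gapPrimitive ℓ t g)) θ = (2 ^ ℓ)⁻¹ * (deriv g θ * weight ℓ t θ) := by
  have hderiv : deriv (gapPrimitive ℓ t g) =ᶠ[𝓝 θ]
      fun θ => (2 ^ ℓ)⁻¹ * (g θ * weight ℓ t θ) := by
    filter_upwards [isOpen_Ioo.mem_nhds hθ] with φ hφ
      using (h.hasDerivAt_gapPrimitive hg.continuous hφ).deriv
  have hweight := ((h.contDiffAt_weight (n := 1) hθ).differentiableAt one_ne_zero).hasDerivAt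
  have hmul := ((hg θ).hasDerivAt.mul hweight).const_mul (2 ^ ℓ : ℝ)⁻¹
  rw [hzero, zero_mul, add_zero] at hmul
  exact hderiv.deriv_eq.trans hmul.deriv

lemma gapPrimitive_pi (h : IsNodes ℓ t) {r : ℝ[X]} (hr : gapIntegral ℓ t ℓ r = 0) :
    gapPrimitive ℓ t (fun φ => (-1) ^ ℓ * r.eval (Real.cos φ)) Real.pi = 0 := by
  rw [gapIntegral, h.last] at hr
  simp only [gapPrimitive, mul_assoc, intervalIntegral.integral_const_mul, hr, mul_zero]

end IsNodes

/-- `Im V(e^{iθ}; ξ)` on the last gap. -/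
noncomputable def gapV (ℓ : ℕ) (t : ℕ → ℝ) (p q : ℝ[X]) (ξ : ℝ) : ℝ → ℝ :=
  gapPrimitive ℓ t (slope ℓ p q ξ)

namespace IsNodes

variable {ℓ : ℕ} {t : ℕ → ℝ} {p q : ℝ[X]} {ξ θ : ℝ}

lemma gapV_eq (h : IsNodes ℓ t) (p q : ℝ[X]) (ξ : ℝ) (hθ : θ ∈ Icc (t (2 * ℓ)) Real.pi) :
    gapV ℓ t p q ξ θ =
      ξ / 2 * gapPrimitive ℓ t (fun φ => (-1) ^ ℓ * p.eval (Real.cos φ)) θ -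
        gapPrimitive ℓ t (fun φ => (-1) ^ ℓ * q.eval (Real.cos φ)) θ := by
  have hint (r : ℝ[X]) : IntervalIntegrable
      (fun φ => (-1) ^ ℓ * r.eval (Real.cos φ) * weight ℓ t φ) volume (t (2 * ℓ)) θ :=
    h.intervalIntegrable_last (continuous_const.mul (continuous_eval_cos r)) hθ
  simp only [gapV, gapPrimitive]
  rw [mul_left_comm, ← mul_sub, ← intervalIntegral.integral_const_mul (ξ / 2),
    ← intervalIntegral.integral_sub ((hint p).const_mul (ξ / 2)) (hint q)]
  congr 2 with φ
  rw [slope]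
  ring

lemma continuous_gapV (h : IsNodes ℓ t) (p q : ℝ[X]) (hθ : θ ∈ Ioo (t (2 * ℓ)) Real.pi) :
    Continuous fun ξ => gapV ℓ t p q ξ θ := by
  simp only [h.gapV_eq p q _ (Ioo_subset_Icc_self hθ)]
  fun_prop

lemma slope_eq_zero_of_deriv_gapV (h : IsNodes ℓ t) (hθ : θ ∈ Ioo (t (2 * ℓ)) Real.pi)
    (hderiv : deriv (gapV ℓ t p q ξ) θ = 0) : slope ℓ p q ξ θ = 0 := by
  rw [gapV, (h.hasDerivAt_gapPrimitive (continuous_slope ℓ p q ξ) hθ).deriv] at hderiv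
  simpa [(h.weight_pos_last hθ).ne'] using hderiv

lemma deriv_deriv_gapV (h : IsNodes ℓ t) (hθ : θ ∈ Ioo (t (2 * ℓ)) Real.pi)
    (hzero : slope ℓ p q ξ θ = 0) : deriv (deriv (gapV ℓ t p q ξ)) θ =
      (2 ^ ℓ)⁻¹ * (deriv (slope ℓ p q ξ) θ * weight ℓ t θ) :=
  h.deriv_deriv_gapPrimitive ((contDiff_slope (n := 1) ℓ p q ξ).differentiable one_ne_zero) hθ
    hzero

end IsNodes

namespace IsPencil

variable {ℓ : ℕ} {t : ℕ → ℝ} {p q : ℝ[X]} {θ : ℝ}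

lemma gapV_pi (H : IsPencil ℓ t p q) (ξ : ℝ) : gapV ℓ t p q ξ Real.pi = 0 := by
  rw [H.nodes.gapV_eq p q ξ ⟨(H.nodes.lt_pi le_rfl).le, le_rfl⟩,
    H.nodes.gapPrimitive_pi (H.gap_left ℓ le_rfl), H.nodes.gapPrimitive_pi (H.gap_right ℓ le_rfl),
    mul_zero, sub_zero]

lemma gapPrimitive_left_pos (H : IsPencil ℓ t p q) (hθ : θ ∈ Ioo (t (2 * ℓ)) Real.pi) :
    0 < gapPrimitive ℓ t (fun φ => (-1) ^ ℓ * p.eval (Real.cos φ)) θ := by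
  obtain ⟨m, hm⟩ := H.exists_isLastZero
  have hcont : Continuous fun φ => (-1) ^ ℓ * p.eval (Real.cos φ) :=
    continuous_const.mul (continuous_eval_cos p)
  rcases le_or_gt θ m with hle | hgt
  · have hmono := H.nodes.strictMonoOn_gapPrimitive hcont le_rfl hm.mem.2.le
      fun φ hφ => hm.pos_left H.nodes ⟨hφ.1.le, hφ.2⟩
    exact (gapPrimitive_left _ _ _).symm.trans_lt
      (hmono ⟨le_rfl, hm.mem.1.le⟩ ⟨hθ.1.le, hle⟩ hθ.1)
  · have hanti := H.nodes.strictAntiOn_gapPrimitive hcont hm.mem.1.le le_rfl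
      fun φ hφ => hm.neg_right H.nodes ⟨hφ.1, hφ.2.le⟩
    exact (H.nodes.gapPrimitive_pi (H.gap_left ℓ le_rfl)).symm.trans_lt
      (hanti ⟨hgt.le, hθ.2.le⟩ ⟨hm.mem.2.le, le_rfl⟩ hθ.2)

lemma strictMono_gapV (H : IsPencil ℓ t p q) (hθ : θ ∈ Ioo (t (2 * ℓ)) Real.pi) :
    StrictMono fun ξ => gapV ℓ t p q ξ θ := fun ξ ξ' hlt => by
  simp only [H.nodes.gapV_eq p q _ (Ioo_subset_Icc_self hθ)]
  gcongr
  exact H.gapPrimitive_left_pos hθ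

end IsPencil

namespace IsCriticalPair

variable {ℓ : ℕ} {t : ℕ → ℝ} {p q : ℝ[X]} {m ξ b s : ℝ}

lemma deriv_deriv_gapV_valley_pos (h : IsCriticalPair ℓ t p q m ξ b s) (hm : IsLastZero ℓ t p m)
    (H : IsPencil ℓ t p q) (hb : t (2 * ℓ) < b) : 0 < deriv (deriv (gapV ℓ t p q ξ)) b := by
  have hmem : b ∈ Ioo (t (2 * ℓ)) Real.pi := ⟨hb, h.valley_mem.2.trans hm.mem.2⟩
  rw [H.nodes.deriv_deriv_gapV hmem (h.slope_valley hm H.nodes hb)]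
  exact mul_pos (by positivity)
    (mul_pos (h.deriv_slope_valley_pos hm H hb) (H.nodes.weight_pos_last hmem))

lemma deriv_deriv_gapV_peak_neg (h : IsCriticalPair ℓ t p q m ξ b s) (hm : IsLastZero ℓ t p m)
    (H : IsPencil ℓ t p q) (hs : s < Real.pi) : deriv (deriv (gapV ℓ t p q ξ)) s < 0 := by
  have hmem : s ∈ Ioo (t (2 * ℓ)) Real.pi := ⟨hm.mem.1.trans h.peak_mem.1, hs⟩
  rw [H.nodes.deriv_deriv_gapV hmem (h.slope_peak hm H.nodes hs)]
  exact mul_neg_of_pos_of_neg (by positivity)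
    (mul_neg_of_neg_of_pos (h.deriv_slope_peak_neg hm H hs) (H.nodes.weight_pos_last hmem))

lemma isValleyPeak (h : IsCriticalPair ℓ t p q m ξ b s) (hm : IsLastZero ℓ t p m)
    (H : IsPencil ℓ t p q) : IsValleyPeak (t (2 * ℓ)) Real.pi (gapV ℓ t p q ξ) b s :=
  have hcont := continuous_slope ℓ p q ξ
  have hb := h.valley_mem
  have hs := h.peak_mem
  { left_le := hb.1
    lt := hb.2.trans hs.1
    le_right := hs.2
    left_eq_zero := gapPrimitive_left _ _ _
    right_eq_zero := H.gapV_pi ξ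
    continuousOn := H.nodes.continuousOn_gapPrimitive hcont
    strictAntiOn_left := H.nodes.strictAntiOn_gapPrimitive hcont le_rfl
      (hb.2.trans hm.mem.2).le fun _ => h.slope_neg_left hm H
    strictMonoOn := H.nodes.strictMonoOn_gapPrimitive hcont hb.1 hs.2 fun _ => h.slope_pos hm H
    strictAntiOn_right := H.nodes.strictAntiOn_gapPrimitive hcont
      (hm.mem.1.trans hs.1).le le_rfl fun _ => h.slope_neg_right hm H
    contDiffOn := H.nodes.contDiffOn_gapPrimitive (contDiff_slope (n := 1) ℓ p q ξ)
    eq_or_eq_of_deriv_eq_zero := fun _ hθ hderiv => h.eq_or_eq_of_slope_eq_zero hm H hθ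
      (H.nodes.slope_eq_zero_of_deriv_gapV hθ hderiv)
    deriv_deriv_valley_pos := h.deriv_deriv_gapV_valley_pos hm H
    deriv_deriv_peak_neg := h.deriv_deriv_gapV_peak_neg hm H }

end IsCriticalPair

lemma IsPencil.exists_isValleyPeakFamily {ℓ : ℕ} {t : ℕ → ℝ} {p q : ℝ[X]}
    (H : IsPencil ℓ t p q) : ∃ b s, IsValleyPeakFamily (t (2 * ℓ)) Real.pi
      (criticalParam p q Real.pi) (criticalParam p q (t (2 * ℓ))) (gapV ℓ t p q) b s := by
  obtain ⟨m, hm⟩ := H.exists_isLastZero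
  choose b s hbs using hm.exists_isCriticalPair H
  have hvalley (ξ : ℝ) := (hbs ξ).left_lt_valley_iff hm H
  have hpeak (ξ : ℝ) := (hbs ξ).peak_lt_right_iff hm H
  refine ⟨b, s, ?_, fun ξ => (hbs ξ).isValleyPeak hm H, hvalley, hpeak, fun x hx y hy hxy => ?_,
    fun x hx y hy hxy => ?_, fun θ hθ => H.strictMono_gapV hθ,
    fun θ hθ => H.nodes.continuous_gapV p q hθ⟩
  · rw [criticalParam, criticalParam, Real.cos_pi]
    exact mul_lt_mul_of_pos_left H.div_neg_one_lt_div two_pos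
  · rwa [← (hm.strictAntiOn_criticalParam_left H).lt_iff_gt (hbs x).valley_mem (hbs y).valley_mem,
      (hbs x).valley_eq ((hvalley x).2 hx), (hbs y).valley_eq ((hvalley y).2 hy)]
  · rwa [← (hm.strictAntiOn_criticalParam_right H).lt_iff_gt (hbs x).peak_mem (hbs y).peak_mem,
      (hbs x).peak_eq ((hpeak x).2 hx), (hbs y).peak_eq ((hpeak y).2 hy)]

end GapPrimitive

section Density

open Finset Complex MeasureTheory

/-- The angles of the branch points `η₁, …, η_{2ℓ}`, preceded by the angle `0` of the centre `1` of
the first gap and followed by the angle `π` of the centre `-1` of the last gap. -/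
noncomputable def node (η : ℕ → ℂ) (ℓ j : ℕ) : ℝ :=
  if j = 0 then 0 else if j ≤ 2 * ℓ then (η j).arg else Real.pi

lemma node_zero (η : ℕ → ℂ) (ℓ : ℕ) : node η ℓ 0 = 0 := if_pos rfl

lemma node_eq_arg (η : ℕ → ℂ) {ℓ j : ℕ} (h₁ : 1 ≤ j) (h₂ : j ≤ 2 * ℓ) :
    node η ℓ j = (η j).arg := by
  rw [node, if_neg (by omega), if_pos h₂]

lemma node_eq_pi (η : ℕ → ℂ) {ℓ j : ℕ} (h : 2 * ℓ < j) : node η ℓ j = Real.pi := by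
  rw [node, if_neg (by omega), if_neg h.not_ge]

lemma node_eq_gapEnd (η : ℕ → ℂ) {ℓ k : ℕ} (hk : k ≤ ℓ) :
    node η ℓ (2 * k + 1) = gapEnd η ℓ k := by
  rw [gapEnd]
  split_ifs with hlt
  exacts [node_eq_arg η (by omega) (by omega), node_eq_pi η (by omega)]

lemma eq_exp_arg {z : ℂ} (hz : ‖z‖ = 1) : z = exp (z.arg * I) := by
  simpa [hz] using (norm_mul_exp_arg_mul_I z).symm

namespace IsSpectrum

variable {N : ℕ} {η : ℕ → ℂ} {ℓ : ℕ}

lemma isNodes (hη : IsSpectrum N η) (hℓ : ℓ ∈ Set.Icc 1 N) : IsNodes ℓ (node η ℓ) := by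
  obtain ⟨hℓ₁, hℓN⟩ := hℓ
  refine ⟨node_zero η ℓ, node_eq_pi η (by omega), fun j hj => ?_⟩
  rcases Nat.eq_zero_or_pos j with rfl | hj₀
  · rw [node_zero, node_eq_arg η le_rfl (by omega)]
    exact hη.arg_pos _ ⟨le_rfl, by omega⟩
  · rw [node_eq_arg η hj₀ hj]
    rcases hj.eq_or_lt with rfl | hlt
    · rw [node_eq_pi η (by omega)]
      exact hη.arg_lt _ ⟨by omega, by omega⟩
    · rw [node_eq_arg η (by omega) hlt]
      exact hη.arg_strictMono ⟨hj₀, by omega⟩ ⟨by omega, by omega⟩ (Nat.lt_succ_self j)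

lemma eq_exp_node (hη : IsSpectrum N η) (hℓ : ℓ ≤ N) :
    ∀ j ∈ Icc 1 (2 * ℓ), η j = exp (node η ℓ j * I) := fun j hj => by
  rw [Finset.mem_Icc] at hj
  rw [node_eq_arg η hj.1 hj.2]
  exact eq_exp_arg (hη.norm_eq j ⟨hj.1, by omega⟩)

end IsSpectrum

/-- The densities of the differentials `P̂_ℓ dz / R̂_ℓ` (the case `e = 1`) and `Q̂_ℓ dz / R̂_ℓ` (the
case `e = 2`). -/
noncomputable def density (η : ℕ → ℂ) (ℓ e : ℕ) (B : Fin (ℓ + e + 1) → ℝ) (z : ℂ) : ℂ :=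
  palindrome (ℓ + e) B z / z ^ (e + 1) / Rhat η ℓ z

namespace IsNodes

variable {ℓ : ℕ} {t : ℕ → ℝ} {η : ℕ → ℂ} {e i : ℕ} {θ : ℝ}

lemma density_exp (h : IsNodes ℓ t) (hη : ∀ j ∈ Icc 1 (2 * ℓ), η j = exp (t j * I))
    (B : Fin (ℓ + e + 1) → ℝ) (hi : i ≤ 2 * ℓ) (hθ : θ ∈ Set.Ioo (t i) (t (i + 1))) :
    density η ℓ e B (exp (θ * I)) * (I * exp (θ * I)) = I * (-I) ^ i *
      (((2 ^ ℓ)⁻¹ * ((chebPoly (ℓ + e) B).eval (Real.cos θ) * weight ℓ t θ) : ℝ) : ℂ) := by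
  have hweight : (weight ℓ t θ : ℂ) ≠ 0 := ofReal_ne_zero.2 (h.weight_pos hi hθ).ne'
  have hexp := Complex.exp_ne_zero (θ * I)
  have hI : (-I) ^ i * I ^ i = 1 := by rw [← mul_pow, neg_mul, I_mul_I, neg_neg, one_pow]
  have hI₀ : I ^ i ≠ 0 := pow_ne_zero _ I_ne_zero
  rw [density, palindrome_exp, h.Rhat_exp hη hi hθ, eq_div_of_mul_eq hI₀ hI, pow_add _ ℓ e,
    pow_succ _ e]
  push_cast
  field_simp

lemma density_exp_neg (h : IsNodes ℓ t) (hη : ∀ j ∈ Icc 1 (2 * ℓ), η j = exp (t j * I))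
    (B : Fin (ℓ + e + 1) → ℝ) (hi : i ≤ 2 * ℓ) (hθ : θ ∈ Set.Ioo (t i) (t (i + 1))) :
    density η ℓ e B (exp ((-θ : ℝ) * I)) * (I * exp ((-θ : ℝ) * I)) = I * I ^ i *
      (((2 ^ ℓ)⁻¹ * ((chebPoly (ℓ + e) B).eval (Real.cos θ) * weight ℓ t θ) : ℝ) : ℂ) := by
  have hconj : density η ℓ e B (exp ((-θ : ℝ) * I)) =
      starRingEnd ℂ (density η ℓ e B (exp (θ * I))) := by
    rw [density, density, palindrome_exp, palindrome_exp, Real.cos_neg, h.Rhat_exp_neg hη hi hθ]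
    simp only [map_div₀, map_mul, map_pow, conj_exp_mul_I, conj_ofReal]
  have hdensity := congrArg (starRingEnd ℂ) (h.density_exp hη B hi hθ)
  simp only [map_mul, map_pow, map_neg, conj_I, conj_ofReal, conj_exp_mul_I, ← hconj,
    neg_neg] at hdensity
  linear_combination -hdensity

lemma intervalIntegrable_density (h : IsNodes ℓ t)
    (hη : ∀ j ∈ Icc 1 (2 * ℓ), η j = exp (t j * I)) (B : Fin (ℓ + e + 1) → ℝ) (hi : i ≤ 2 * ℓ)
    (hθ : θ ∈ Set.Icc (t i) (t (i + 1))) :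
    IntervalIntegrable (fun φ : ℝ => density η ℓ e B (exp (φ * I)) * (I * exp (φ * I))) volume
      (t i) θ := by
  have hreal := (h.intervalIntegrable_mul_weight (continuous_eval_cos (chebPoly (ℓ + e) B))
    (h.mem_Icc_zero_pi (j := i) (by omega)) (b := θ)
    ⟨(h.nonneg (by omega)).trans hθ.1, hθ.2.trans (h.le_pi (by omega))⟩).const_mul (2 ^ ℓ)⁻¹
  have hcomplex : IntervalIntegrable (fun φ => (((2 ^ ℓ)⁻¹ *
      ((chebPoly (ℓ + e) B).eval (Real.cos φ) * weight ℓ t φ) : ℝ) : ℂ)) volume (t i) θ :=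
    ⟨hreal.1.ofReal, hreal.2.ofReal⟩
  refine (hcomplex.const_mul (I * (-I) ^ i)).congr_uIoo fun φ hφ => ?_
  rw [Set.uIoo_of_le hθ.1] at hφ
  exact (h.density_exp hη B hi ⟨hφ.1, hφ.2.trans_le hθ.2⟩).symm

lemma arcIntegral_density (h : IsNodes ℓ t) (hη : ∀ j ∈ Icc 1 (2 * ℓ), η j = exp (t j * I))
    (B : Fin (ℓ + e + 1) → ℝ) (hi : i ≤ 2 * ℓ) (hθ : θ ∈ Set.Icc (t i) (t (i + 1))) :
    arcIntegral (density η ℓ e B) (t i) θ = I * (-I) ^ i * (((2 ^ ℓ)⁻¹ *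
      ∫ φ in t i..θ, (chebPoly (ℓ + e) B).eval (Real.cos φ) * weight ℓ t φ : ℝ) : ℂ) := by
  rw [arcIntegral, intervalIntegral.integral_congr_Ioo_of_le hθ.1
    (fun φ hφ => h.density_exp hη B hi ⟨hφ.1, hφ.2.trans_le hθ.2⟩),
    intervalIntegral.integral_const_mul, intervalIntegral.integral_ofReal,
    intervalIntegral.integral_const_mul]

lemma arcIntegral_density_neg (h : IsNodes ℓ t) (hη : ∀ j ∈ Icc 1 (2 * ℓ), η j = exp (t j * I))
    (B : Fin (ℓ + e + 1) → ℝ) (hi : i ≤ 2 * ℓ) :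
    arcIntegral (density η ℓ e B) (-t (i + 1)) (-t i) = I * I ^ i * (((2 ^ ℓ)⁻¹ *
      ∫ φ in t i..t (i + 1), (chebPoly (ℓ + e) B).eval (Real.cos φ) * weight ℓ t φ : ℝ) : ℂ) := by
  rw [arcIntegral, ← intervalIntegral.integral_comp_neg,
    intervalIntegral.integral_congr_Ioo_of_le (h.lt i hi).le
    (fun φ hφ => h.density_exp_neg hη B hi hφ),
    intervalIntegral.integral_const_mul, intervalIntegral.integral_ofReal,
    intervalIntegral.integral_const_mul]

/-- A band contributes a real number, and the integral over a gap vanishes. -/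
lemma im_arcIntegral_density_eq_zero (h : IsNodes ℓ t)
    (hη : ∀ j ∈ Icc 1 (2 * ℓ), η j = exp (t j * I)) {B : Fin (ℓ + e + 1) → ℝ}
    (hB : ∀ k ∈ Set.Icc 1 ℓ, gapIntegral ℓ t k (chebPoly (ℓ + e) B) = 0)
    (hi : i ∈ Set.Icc 1 (2 * ℓ)) :
    (arcIntegral (density η ℓ e B) (t i) (t (i + 1))).im = 0 := by
  obtain ⟨hi₁, hi₂⟩ := hi
  rw [h.arcIntegral_density hη B hi₂ ⟨(h.lt i hi₂).le, le_rfl⟩]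
  obtain ⟨j, rfl | rfl⟩ := Nat.even_or_odd' i
  · have hgap := hB j ⟨by omega, by omega⟩
    rw [gapIntegral] at hgap
    simp [hgap]
  · have hreal : I * (-I) ^ (2 * j + 1) = (((-1) ^ j : ℝ) : ℂ) := by
      rw [pow_succ, pow_mul, neg_sq, I_sq, mul_left_comm, mul_neg, I_mul_I, neg_neg, mul_one]
      push_cast
      rfl
    rw [hreal, ← ofReal_mul, ofReal_im]

lemma arcIntegral_density_last (h : IsNodes ℓ t)
    (hη : ∀ j ∈ Icc 1 (2 * ℓ), η j = exp (t j * I)) (B : Fin (ℓ + e + 1) → ℝ)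
    (hθ : θ ∈ Set.Icc (t (2 * ℓ)) Real.pi) :
    arcIntegral (density η ℓ e B) (t (2 * ℓ)) θ = I * ((gapPrimitive ℓ t
      (fun φ => (-1) ^ ℓ * (chebPoly (ℓ + e) B).eval (Real.cos φ)) θ : ℝ) : ℂ) := by
  rw [h.arcIntegral_density hη B le_rfl (by rwa [h.last]), gapPrimitive, pow_mul, neg_sq, I_sq]
  simp only [mul_assoc, intervalIntegral.integral_const_mul]
  push_cast
  ring

lemma im_arcIntegral_density (h : IsNodes ℓ t) (hℓ : 1 ≤ ℓ)
    (hη : ∀ j ∈ Icc 1 (2 * ℓ), η j = exp (t j * I)) {B : Fin (ℓ + e + 1) → ℝ}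
    (hB : ∀ k ∈ Set.Icc 1 ℓ, gapIntegral ℓ t k (chebPoly (ℓ + e) B) = 0)
    (hθ : θ ∈ Set.Icc (t (2 * ℓ)) Real.pi) :
    (arcIntegral (density η ℓ e B) (t 1) θ).im =
      gapPrimitive ℓ t (fun φ => (-1) ^ ℓ * (chebPoly (ℓ + e) B).eval (Real.cos φ)) θ := by
  have hle : 1 ≤ 2 * ℓ := by omega
  have hint : ∀ i ∈ Set.Ico 1 (2 * ℓ), IntervalIntegrable
      (fun φ : ℝ => density η ℓ e B (exp (φ * I)) * (I * exp (φ * I))) volume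
      (t i) (t (i + 1)) := fun i hi =>
    h.intervalIntegrable_density hη B hi.2.le ⟨(h.lt i hi.2.le).le, le_rfl⟩
  have hbefore : (arcIntegral (density η ℓ e B) (t 1) (t (2 * ℓ))).im = 0 := by
    rw [arcIntegral, ← intervalIntegral.sum_integral_adjacent_intervals_Ico hle hint, im_sum]
    refine Finset.sum_eq_zero fun i hi => h.im_arcIntegral_density_eq_zero hη hB ?_
    rw [Finset.mem_Ico] at hi
    exact ⟨hi.1, hi.2.le⟩
  have hsplit : arcIntegral (density η ℓ e B) (t 1) θ =
      arcIntegral (density η ℓ e B) (t 1) (t (2 * ℓ)) +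
        arcIntegral (density η ℓ e B) (t (2 * ℓ)) θ :=
    (intervalIntegral.integral_add_adjacent_intervals
      (IntervalIntegrable.trans_iterate_Ico hle hint)
      (h.intervalIntegrable_density hη B le_rfl (by rwa [h.last]))).symm
  rw [hsplit, add_im, hbefore, zero_add, h.arcIntegral_density_last hη B hθ, I_mul_im, ofReal_re]

end IsNodes

lemma IsSpectrum.gapIntegralsVanish_density_iff {N : ℕ} {η : ℕ → ℂ} (hη : IsSpectrum N η) {ℓ : ℕ}
    (hℓ : ℓ ∈ Set.Icc 1 N) {e : ℕ} (B : Fin (ℓ + e + 1) → ℝ) :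
    GapIntegralsVanish η ℓ (density η ℓ e B) ↔
      ∀ k ∈ Set.Icc 1 ℓ, gapIntegral ℓ (node η ℓ) k (chebPoly (ℓ + e) B) = 0 := by
  have h := hη.isNodes hℓ
  have hη' := hη.eq_exp_node hℓ.2
  refine forall₂_congr fun k ⟨hk₁, hk⟩ => ?_
  have hi : 2 * k ≤ 2 * ℓ := by omega
  rw [← node_eq_gapEnd η hk, ← node_eq_arg η (by omega) hi,
    h.arcIntegral_density hη' B hi ⟨(h.lt _ hi).le, le_rfl⟩, h.arcIntegral_density_neg hη' B hi]
  simp [gapIntegral]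

lemma log_exp_mul_I {θ : ℝ} (hθ : θ ∈ Set.Ioc (-Real.pi) Real.pi) :
    log (exp (θ * I)) = θ * I :=
  log_exp (by simpa using hθ.1) (by simpa using hθ.2)

lemma spiralIntegral_exp (F : ℂ → ℂ) {a θ : ℝ} (ha : a ∈ Set.Ioc (-Real.pi) Real.pi)
    (hθ : θ ∈ Set.Ioc (-Real.pi) Real.pi) :
    spiralIntegral F (exp (a * I)) (exp (θ * I)) = arcIntegral F a θ := by
  have hspiral (u : ℝ) : spiral (exp (a * I)) (exp (θ * I)) u =
      exp (((θ - a) * u + a : ℝ) * I) := by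
    rw [spiral, log_exp_mul_I ha, log_exp_mul_I hθ]
    push_cast
    ring_nf
  have hsubst := intervalIntegral.smul_integral_comp_mul_add (a := 0) (b := 1)
    (fun φ : ℝ => F (exp (φ * I)) * (I * exp (φ * I))) (θ - a) a
  rw [mul_zero, zero_add, mul_one, sub_add_cancel] at hsubst
  rw [arcIntegral, ← hsubst, ← intervalIntegral.integral_smul, spiralIntegral,
    log_exp_mul_I ha, log_exp_mul_I hθ]
  refine intervalIntegral.integral_congr fun u _ => ?_
  simp only [hspiral, real_smul]
  push_cast
  ring

end Density

section Coefficients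

open Polynomial

variable {ℓ : ℕ} {t : ℕ → ℝ}

/-- The data that determine the coefficients `B`: their first `e + 1` entries, followed by the
integrals over the gaps `1, …, ℓ`. -/
noncomputable def coeffData (ℓ : ℕ) (t : ℕ → ℝ) (e : ℕ) (B : Fin (ℓ + e + 1) → ℝ) :
    Fin (ℓ + e + 1) → ℝ :=
  fun i => if (i : ℕ) ≤ e then B i else gapIntegral ℓ t (i - e) (chebPoly (ℓ + e) B)

lemma coeffData_eq_iff {e : ℕ} {B v : Fin (ℓ + e + 1) → ℝ} :
    coeffData ℓ t e B = (fun i : Fin (ℓ + e + 1) => if (i : ℕ) ≤ e then v i else 0) ↔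
      (∀ i : Fin (ℓ + e + 1), (i : ℕ) ≤ e → B i = v i) ∧
        ∀ k ∈ Set.Icc 1 ℓ, gapIntegral ℓ t k (chebPoly (ℓ + e) B) = 0 := by
  refine ⟨fun h => ⟨fun i hi => ?_, fun k ⟨hk₁, hk⟩ => ?_⟩, fun ⟨hv, hgap⟩ => ?_⟩
  · simpa [coeffData, hi] using congrFun h i
  · simpa [coeffData, show ¬ k + e ≤ e by omega] using congrFun h ⟨k + e, by omega⟩
  · funext i
    rw [coeffData]
    split_ifs with hi
    exacts [hv i hi, hgap (i - e) ⟨by omega, by omega⟩]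

namespace IsNodes

lemma isLinearMap_coeffData (h : IsNodes ℓ t) (e : ℕ) : IsLinearMap ℝ (coeffData ℓ t e) := by
  refine ⟨fun B D => funext fun i => ?_, fun c B => funext fun i => ?_⟩ <;>
    simp only [coeffData, Pi.add_apply, Pi.smul_apply] <;> split_ifs
  · rfl
  · simpa using h.gapIntegral_mul_add_mul (k := i - e) (by omega) 1 1 (chebPoly (ℓ + e) B)
      (chebPoly (ℓ + e) D)
  · rfl
  · simpa [smul_eq_C_mul] using h.gapIntegral_mul_add_mul (k := i - e) (by omega) c 0
      (chebPoly (ℓ + e) B) 0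

/-- A nonzero polynomial of degree less than `ℓ` cannot have a root in each of `ℓ` gaps. -/
lemma injective_coeffData (h : IsNodes ℓ t) (hℓ : 1 ≤ ℓ) (e : ℕ) :
    Function.Injective (coeffData ℓ t e) := by
  refine (injective_iff_map_eq_zero (h.isLinearMap_coeffData e).mk').2 fun B hB => ?_
  obtain ⟨hcoeff, hgap⟩ := (coeffData_eq_iff (B := B) (v := 0)).1
    (hB.trans (funext fun i => (ite_self 0).symm))
  have hdeg : (chebPoly (ℓ + e) B).natDegree < (Finset.Icc 1 ℓ).card := by
    have hle := natDegree_chebPoly_le (B := B) (j := ⟨e + 1, by omega⟩) fun i hi =>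
      hcoeff i (Nat.lt_succ_iff.1 hi)
    rw [Nat.card_Icc]
    simp only at hle
    omega
  have hzero : chebPoly (ℓ + e) B = 0 := h.eq_zero_of_gapIntegral
    (fun k hk => (Finset.mem_Icc.1 hk).2) hdeg fun k hk => hgap k (Finset.mem_Icc.1 hk)
  exact chebPoly_injective _ (hzero.trans (map_zero _).symm)

lemma existsUnique_coeffs (h : IsNodes ℓ t) (hℓ : 1 ≤ ℓ) (e : ℕ) (v : Fin (e + 1) → ℝ) :
    ∃! B : Fin (ℓ + e + 1) → ℝ, (∀ i : Fin (e + 1), B (i.castLE (by omega)) = v i) ∧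
      ∀ k ∈ Set.Icc 1 ℓ, gapIntegral ℓ t k (chebPoly (ℓ + e) B) = 0 := by
  have hinj := h.injective_coeffData hℓ e
  have hsurj : Function.Surjective (coeffData ℓ t e) :=
    LinearMap.injective_iff_surjective (f := (h.isLinearMap_coeffData e).mk').1 hinj
  refine (existsUnique_congr fun B => coeffData_eq_iff.trans (and_congr_left' ?_)).1
    (Function.Bijective.existsUnique ⟨hinj, hsurj⟩
      fun i : Fin (ℓ + e + 1) => if (i : ℕ) ≤ e then v (Fin.ofNat (e + 1) i) else 0)
  refine ⟨fun hv i => ?_, fun hv i hi => ?_⟩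
  · simpa using hv (i.castLE (by omega)) (Nat.lt_succ_iff.1 i.2)
  · have hcast : Fin.ofNat (e + 1) i = ⟨i, Nat.lt_succ_of_le hi⟩ :=
      Fin.ext (Nat.mod_eq_of_lt (Nat.lt_succ_of_le hi))
    rw [hcast]
    exact hv ⟨i, Nat.lt_succ_of_le hi⟩

end IsNodes

end Coefficients

section Identification

open Finset Complex

namespace IsSpectrum

variable {N : ℕ} {η : ℕ → ℂ} {ℓ : ℕ}

lemma sum_re (hη : IsSpectrum N η) (hℓ : ℓ ≤ N) :
    ∑ j ∈ Icc 1 (2 * ℓ), (η j).re = ∑ j ∈ Icc 1 (2 * ℓ), Real.cos (node η ℓ j) :=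
  Finset.sum_congr rfl fun j hj => by
    rw [← exp_ofReal_mul_I_re, ← hη.eq_exp_node hℓ j hj]

lemma sum_re_sq (hη : IsSpectrum N η) (hℓ : ℓ ≤ N) :
    ∑ j ∈ Icc 1 (2 * ℓ), (η j ^ 2).re =
      2 * ∑ j ∈ Icc 1 (2 * ℓ), Real.cos (node η ℓ j) ^ 2 - 2 * ℓ := by
  have hre : ∀ j ∈ Icc 1 (2 * ℓ), (η j ^ 2).re = 2 * Real.cos (node η ℓ j) ^ 2 - 1 :=
    fun j hj => by
      have hsq : exp (node η ℓ j * I) ^ 2 = exp ((2 * node η ℓ j : ℝ) * I) := by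
        rw [← Complex.exp_nat_mul]
        push_cast
        ring_nf
      rw [← Real.cos_two_mul, ← exp_ofReal_mul_I_re, ← hsq, ← hη.eq_exp_node hℓ j hj]
  rw [Finset.sum_congr rfl hre, Finset.sum_sub_distrib, ← Finset.mul_sum]
  simp

lemma second_coeff_eq (hη : IsSpectrum N η) (hℓ : ℓ ≤ N) :
    1 / 8 * ((∑ j ∈ Icc 1 (2 * ℓ), 2 * (η j).re) ^ 2 -
      2 * ∑ j ∈ Icc 1 (2 * ℓ), 2 * (η j ^ 2).re) =
    (∑ j ∈ Icc 1 (2 * ℓ), Real.cos (node η ℓ j)) ^ 2 / 2 -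
      ∑ j ∈ Icc 1 (2 * ℓ), Real.cos (node η ℓ j) ^ 2 + ℓ := by
  rw [← Finset.mul_sum, ← Finset.mul_sum, hη.sum_re hℓ, hη.sum_re_sq hℓ]
  ring

lemma isFirstCoeffs_iff (hη : IsSpectrum N η) (hℓ : ℓ ∈ Set.Icc 1 N) {B : Fin (ℓ + 2) → ℝ} :
    IsFirstCoeffs η ℓ B ↔ (B 0 = 1 ∧ B 1 = -∑ j ∈ Icc 1 (2 * ℓ), Real.cos (node η ℓ j)) ∧
      ∀ k ∈ Set.Icc 1 ℓ, gapIntegral ℓ (node η ℓ) k (chebPoly (ℓ + 1) B) = 0 := by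
  rw [← hη.gapIntegralsVanish_density_iff hℓ, ← hη.sum_re hℓ.2]
  exact ⟨fun h => ⟨⟨h.zero, h.one⟩, h.gaps⟩, fun h => ⟨h.1.1, h.1.2, h.2⟩⟩

lemma isSecondCoeffs_iff (hη : IsSpectrum N η) (hℓ : ℓ ∈ Set.Icc 1 N) {C : Fin (ℓ + 3) → ℝ} :
    IsSecondCoeffs η ℓ C ↔ (C 0 = 1 ∧ C 1 = -∑ j ∈ Icc 1 (2 * ℓ), Real.cos (node η ℓ j) ∧
      C 2 = (∑ j ∈ Icc 1 (2 * ℓ), Real.cos (node η ℓ j)) ^ 2 / 2 -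
        ∑ j ∈ Icc 1 (2 * ℓ), Real.cos (node η ℓ j) ^ 2 + ℓ) ∧
      ∀ k ∈ Set.Icc 1 ℓ, gapIntegral ℓ (node η ℓ) k (chebPoly (ℓ + 2) C) = 0 := by
  rw [← hη.gapIntegralsVanish_density_iff hℓ, ← hη.second_coeff_eq hℓ.2, ← hη.sum_re hℓ.2]
  exact ⟨fun h => ⟨⟨h.zero, h.one, h.two⟩, h.gaps⟩, fun h => ⟨h.1.1, h.1.2.1, h.1.2.2, h.2⟩⟩

lemma existsUnique_isFirstCoeffs (hη : IsSpectrum N η) (hℓ : ℓ ∈ Set.Icc 1 N) :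
    ∃! B : Fin (ℓ + 2) → ℝ, IsFirstCoeffs η ℓ B := by
  refine (existsUnique_congr fun B => ?_).1 ((hη.isNodes hℓ).existsUnique_coeffs hℓ.1 1
    ![1, -∑ j ∈ Icc 1 (2 * ℓ), Real.cos (node η ℓ j)])
  rw [hη.isFirstCoeffs_iff hℓ, Fin.forall_fin_two]
  rfl

lemma existsUnique_isSecondCoeffs (hη : IsSpectrum N η) (hℓ : ℓ ∈ Set.Icc 1 N) :
    ∃! C : Fin (ℓ + 3) → ℝ, IsSecondCoeffs η ℓ C := by
  have hcast : Fin.castLE (by omega) (2 : Fin 3) = (2 : Fin (ℓ + 3)) :=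
    Fin.ext (Nat.mod_eq_of_lt (by omega)).symm
  refine (existsUnique_congr fun C => ?_).1 ((hη.isNodes hℓ).existsUnique_coeffs hℓ.1 2
    ![1, -∑ j ∈ Icc 1 (2 * ℓ), Real.cos (node η ℓ j),
      (∑ j ∈ Icc 1 (2 * ℓ), Real.cos (node η ℓ j)) ^ 2 / 2 -
        ∑ j ∈ Icc 1 (2 * ℓ), Real.cos (node η ℓ j) ^ 2 + ℓ])
  rw [hη.isSecondCoeffs_iff hℓ, Fin.forall_fin_succ, Fin.forall_fin_two, ← hcast]
  rfl

lemma isPencil (hη : IsSpectrum N η) (hℓ : ℓ ∈ Set.Icc 1 N) {B : Fin (ℓ + 2) → ℝ}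
    {C : Fin (ℓ + 3) → ℝ} (hB : IsFirstCoeffs η ℓ B) (hC : IsSecondCoeffs η ℓ C) :
    IsPencil ℓ (node η ℓ) (chebPoly (ℓ + 1) B) (chebPoly (ℓ + 2) C) := by
  have h := hη.isNodes hℓ
  obtain ⟨⟨hB₀, hB₁⟩, hB_gap⟩ := (hη.isFirstCoeffs_iff hℓ).1 hB
  obtain ⟨⟨hC₀, hC₁, hC₂⟩, hC_gap⟩ := (hη.isSecondCoeffs_iff hℓ).1 hC
  refine ⟨h, natDegree_chebPoly_of_zero_eq_one hB₀, natDegree_chebPoly_of_zero_eq_one hC₀,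
    leadingCoeff_chebPoly_pos hB₀, leadingCoeff_chebPoly_pos hC₀, fun k hk => ?_, fun k hk => ?_⟩
  all_goals rcases Nat.eq_zero_or_pos k with rfl | hk₀
  exacts [h.gapIntegral_zero_eq_zero_of_first hB₀ hB₁ hB_gap, hB_gap k ⟨hk₀, hk⟩,
    h.gapIntegral_zero_eq_zero_of_second hC₀ hC₁ hC₂ hC_gap, hC_gap k ⟨hk₀, hk⟩]

lemma im_spiralIntegral_density (hη : IsSpectrum N η) (hℓ : ℓ ∈ Set.Icc 1 N) {e : ℕ}
    {B : Fin (ℓ + e + 1) → ℝ}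
    (hB : ∀ k ∈ Set.Icc 1 ℓ, gapIntegral ℓ (node η ℓ) k (chebPoly (ℓ + e) B) = 0) {θ : ℝ}
    (hθ : θ ∈ Set.Icc (node η ℓ (2 * ℓ)) Real.pi) :
    (spiralIntegral (density η ℓ e B) (η 1) (exp (θ * I))).im = gapPrimitive ℓ (node η ℓ)
      (fun φ => (-1) ^ ℓ * (chebPoly (ℓ + e) B).eval (Real.cos φ)) θ := by
  have h := hη.isNodes hℓ
  have hℓ₁ := hℓ.1
  have hη' := hη.eq_exp_node hℓ.2
  have hmem {x : ℝ} (hx : x ∈ Set.Icc 0 Real.pi) : x ∈ Set.Ioc (-Real.pi) Real.pi :=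
    ⟨(neg_neg_of_pos Real.pi_pos).trans_le hx.1, hx.2⟩
  rw [hη' 1 (Finset.mem_Icc.2 ⟨le_rfl, by omega⟩),
    spiralIntegral_exp _ (hmem (h.mem_Icc_zero_pi (by omega)))
      (hmem ⟨(h.nonneg (by omega)).trans hθ.1, hθ.2⟩),
    h.im_arcIntegral_density hℓ₁ hη' hB hθ]

lemma imV_eq_gapV (hη : IsSpectrum N η) (hℓ : ℓ ∈ Set.Icc 1 N) {B : Fin (ℓ + 2) → ℝ}
    {C : Fin (ℓ + 3) → ℝ} (hB : IsFirstCoeffs η ℓ B) (hC : IsSecondCoeffs η ℓ C) (ξ : ℝ) {θ : ℝ}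
    (hθ : θ ∈ Set.Icc (node η ℓ (2 * ℓ)) Real.pi) :
    imV η ℓ B C ξ θ = gapV ℓ (node η ℓ) (chebPoly (ℓ + 1) B) (chebPoly (ℓ + 2) C) ξ θ := by
  have hphi₁ : (phi1 η ℓ B (exp (θ * I))).im = _ :=
    hη.im_spiralIntegral_density hℓ ((hη.isFirstCoeffs_iff hℓ).1 hB).2 hθ
  have hphi₂ : (phi2 η ℓ C (exp (θ * I))).im = _ :=
    hη.im_spiralIntegral_density hℓ ((hη.isSecondCoeffs_iff hℓ).1 hC).2 hθ
  have hhalf : (ξ : ℂ) / 2 = ((ξ / 2 : ℝ) : ℂ) := by push_cast; rfl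
  rw [imV, V, sub_im, hhalf, im_ofReal_mul, hphi₁, hphi₂, (hη.isNodes hℓ).gapV_eq _ _ _ hθ]

lemma xiEven_eq (hη : IsSpectrum N η) (hℓ : ℓ ∈ Set.Icc 1 N) (B : Fin (ℓ + 2) → ℝ)
    (C : Fin (ℓ + 3) → ℝ) : xiEven η ℓ B C =
      criticalParam (chebPoly (ℓ + 1) B) (chebPoly (ℓ + 2) C) (node η ℓ (2 * ℓ)) := by
  have hℓ₁ := hℓ.1
  have hexp := Complex.exp_ne_zero (node η ℓ (2 * ℓ) * I)
  rw [xiEven, hη.eq_exp_node hℓ.2 _ (Finset.mem_Icc.2 ⟨by omega, le_rfl⟩), Qhat, Phat,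
    palindrome_exp, palindrome_exp, criticalParam, ← ofReal_re (2 * _), pow_succ _ (ℓ + 1),
    pow_succ _ 2]
  congr 1
  push_cast
  rw [mul_right_comm _ _ (Complex.ofReal _), mul_div_mul_right _ _ hexp, mul_div_assoc,
    div_div_div_cancel_right₀ (pow_ne_zero 2 hexp),
    mul_div_mul_left _ _ (pow_ne_zero (ℓ + 1) hexp)]

lemma xiOdd_eq (hη : IsSpectrum N η) (hℓ : ℓ ∈ Set.Icc 1 N) (B : Fin (ℓ + 2) → ℝ)
    (C : Fin (ℓ + 3) → ℝ)
    (hθ : (η (2 * ℓ + 1)).arg ∈ Set.Ioo (η (2 * ℓ)).arg Real.pi) : xiOdd η ℓ B C =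
      2 * (gapPrimitive ℓ (node η ℓ)
          (fun φ => (-1) ^ ℓ * (chebPoly (ℓ + 2) C).eval (Real.cos φ)) (η (2 * ℓ + 1)).arg /
        gapPrimitive ℓ (node η ℓ)
          (fun φ => (-1) ^ ℓ * (chebPoly (ℓ + 1) B).eval (Real.cos φ)) (η (2 * ℓ + 1)).arg) := by
  have hnode : node η ℓ (2 * ℓ) = (η (2 * ℓ)).arg :=
    node_eq_arg η (by have := hℓ.1; omega) le_rfl
  have harc (e : ℕ) (D : Fin (ℓ + e + 1) → ℝ) :=
    (hη.isNodes hℓ).arcIntegral_density_last (hη.eq_exp_node hℓ.2) D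
      (hnode ▸ Set.Ioo_subset_Icc_self hθ)
  have hQ : (fun z => Qhat ℓ C z / Rhat η ℓ z) = density η ℓ 2 C := rfl
  have hP : (fun z => Phat ℓ B z / Rhat η ℓ z) = density η ℓ 1 B := rfl
  rw [xiOdd, hQ, hP, ← hnode, harc, harc, mul_left_comm, mul_div_mul_left _ _ I_ne_zero,
    mul_div_assoc, ← ofReal_div, ← ofReal_ofNat, ← ofReal_mul, ofReal_re]

lemma exists_isValleyPeakFamily (hη : IsSpectrum N η) (hℓ : ℓ ∈ Set.Icc 1 N)
    {B : Fin (ℓ + 2) → ℝ} {C : Fin (ℓ + 3) → ℝ} (hB : IsFirstCoeffs η ℓ B)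
    (hC : IsSecondCoeffs η ℓ C) : ∃ (ξ₀ : ℝ) (b s : ℝ → ℝ),
      IsValleyPeakFamily (η (2 * ℓ)).arg Real.pi ξ₀ (xiEven η ℓ B C) (imV η ℓ B C) b s := by
  obtain ⟨b, s, hfamily⟩ := (hη.isPencil hℓ hB hC).exists_isValleyPeakFamily
  have hnode : node η ℓ (2 * ℓ) = (η (2 * ℓ)).arg :=
    node_eq_arg η (by have := hℓ.1; omega) le_rfl
  rw [hη.xiEven_eq hℓ, ← hnode]
  exact ⟨_, b, s, hfamily.congr fun ξ θ hθ => (hη.imV_eq_gapV hℓ hB hC ξ hθ).symm⟩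

lemma arg_succ_mem_Ioo (hη : IsSpectrum N η) (hℓ : ℓ ∈ Set.Icc 1 N) (hlt : ℓ < N) :
    (η (2 * ℓ + 1)).arg ∈ Set.Ioo (η (2 * ℓ)).arg Real.pi := by
  obtain ⟨hℓ₁, -⟩ := hℓ
  have hmem : 2 * ℓ + 1 ∈ Set.Icc 1 (2 * N) := ⟨by omega, by omega⟩
  exact ⟨hη.arg_strictMono ⟨by omega, by omega⟩ hmem (Nat.lt_succ_self _), hη.arg_lt _ hmem⟩

lemma eq_xiOdd_of_imV_eq_zero (hη : IsSpectrum N η) (hℓ : ℓ ∈ Set.Icc 1 N)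
    {B : Fin (ℓ + 2) → ℝ} {C : Fin (ℓ + 3) → ℝ} (hB : IsFirstCoeffs η ℓ B)
    (hC : IsSecondCoeffs η ℓ C) (hlt : ℓ < N) {ξ : ℝ}
    (hzero : imV η ℓ B C ξ (η (2 * ℓ + 1)).arg = 0) : ξ = xiOdd η ℓ B C := by
  have H := hη.isPencil hℓ hB hC
  have hθ := hη.arg_succ_mem_Ioo hℓ hlt
  have hθ' : (η (2 * ℓ + 1)).arg ∈ Set.Ioo (node η ℓ (2 * ℓ)) Real.pi := by
    rwa [node_eq_arg η (by have := hℓ.1; omega) le_rfl]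
  rw [hη.imV_eq_gapV hℓ hB hC ξ (Set.Ioo_subset_Icc_self hθ'),
    H.nodes.gapV_eq _ _ _ (Set.Ioo_subset_Icc_self hθ'), sub_eq_zero] at hzero
  rw [hη.xiOdd_eq hℓ B C hθ, ← hzero, mul_div_cancel_right₀ _ (H.gapPrimitive_left_pos hθ').ne',
    mul_div_cancel₀ _ two_ne_zero]

end IsSpectrum

end Identification

section LastGap

open Complex Filter Topology

variable {η : ℕ → ℂ} {ℓ : ℕ} {B : Fin (ℓ + 2) → ℝ} {C : Fin (ℓ + 3) → ℝ} {ξ₀ ξ₁ ξ θ : ℝ}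
  {b s : ℝ → ℝ}

lemma arg_exp_of_mem (hθ : θ ∈ Set.Ioo (η (2 * ℓ)).arg Real.pi) : (exp (θ * I)).arg = θ := by
  rw [arg_exp_mul_I, toIocMod_eq_self]
  exact ⟨(neg_pi_lt_arg _).trans hθ.1, by linarith [hθ.2]⟩

lemma exp_mem_lastGap (hθ : θ ∈ Set.Ioo (η (2 * ℓ)).arg Real.pi) : exp (θ * I) ∈ lastGap η ℓ := by
  exact ⟨norm_exp_ofReal_mul_I θ, by rwa [arg_exp_of_mem hθ]⟩

lemma forall_mem_lastGap {P : ℂ → Prop} :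
    (∀ z ∈ lastGap η ℓ, P z) ↔ ∀ θ ∈ Set.Ioo (η (2 * ℓ)).arg Real.pi, P (exp (θ * I)) :=
  ⟨fun h _ hθ => h _ (exp_mem_lastGap hθ),
    fun h z ⟨hz, hz_arg⟩ => eq_exp_arg hz ▸ h z.arg hz_arg⟩

lemma exp_mul_I_eq_iff {z : ℂ} (hz : ‖z‖ = 1) (hθ : θ ∈ Set.Ioo (η (2 * ℓ)).arg Real.pi) :
    exp (θ * I) = z ↔ θ = z.arg :=
  ⟨fun h => by rw [← h, arg_exp_of_mem hθ], fun h => by rw [h, ← eq_exp_arg hz]⟩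

lemma tendsto_exp_mul_I_neg_one {α : Type*} {l : Filter α} {f : α → ℝ}
    (hf : Tendsto f l (𝓝 Real.pi)) : Tendsto (fun x => exp (f x * I)) l (𝓝 (-1)) := by
  have hexp : Continuous fun θ : ℝ => exp (θ * I) := by fun_prop
  exact exp_pi_mul_I ▸ (hexp.tendsto Real.pi).comp hf

namespace IsValleyPeakFamily

lemma minimum_lastGap
    (h : IsValleyPeakFamily (η (2 * ℓ)).arg Real.pi ξ₀ ξ₁ (imV η ℓ B C) b s) (hξ : ξ < ξ₁) :
    exp (b ξ * I) ∈ lastGap η ℓ ∧ (V η ℓ B C ξ (exp (b ξ * I))).im < 0 ∧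
      (∀ z ∈ lastGap η ℓ, z ≠ exp (b ξ * I) →
        (V η ℓ B C ξ (exp (b ξ * I))).im < (V η ℓ B C ξ z).im) ∧
      deriv (imV η ℓ B C ξ) (exp (b ξ * I)).arg = 0 ∧
      0 < deriv (deriv (imV η ℓ B C ξ)) (exp (b ξ * I)).arg := by
  have hshape := h.isValleyPeak ξ
  have hb := (h.left_lt_valley_iff ξ).2 hξ
  rw [forall_mem_lastGap, arg_exp_of_mem (h.valley_mem hξ)]
  exact ⟨exp_mem_lastGap (h.valley_mem hξ), hshape.valley_neg hb,
    fun θ hθ hne => hshape.valley_lt hb hθ (ne_of_apply_ne (fun x : ℝ => exp (x * I)) hne),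
    hshape.deriv_valley hb, hshape.deriv_deriv_valley_pos hb⟩

lemma maximum_lastGap
    (h : IsValleyPeakFamily (η (2 * ℓ)).arg Real.pi ξ₀ ξ₁ (imV η ℓ B C) b s) (hξ : ξ₀ < ξ) :
    0 < (V η ℓ B C ξ (exp (s ξ * I))).im ∧
      (∀ z ∈ lastGap η ℓ, z ≠ exp (s ξ * I) →
        (V η ℓ B C ξ z).im < (V η ℓ B C ξ (exp (s ξ * I))).im) ∧
      deriv (imV η ℓ B C ξ) (exp (s ξ * I)).arg = 0 ∧
      deriv (deriv (imV η ℓ B C ξ)) (exp (s ξ * I)).arg < 0 ∧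
      ∀ z ∈ lastGap η ℓ, deriv (imV η ℓ B C ξ) z.arg = 0 →
        z = exp (b ξ * I) ∨ z = exp (s ξ * I) := by
  have hshape := h.isValleyPeak ξ
  have hs := (h.peak_lt_right_iff ξ).2 hξ
  rw [forall_mem_lastGap, forall_mem_lastGap, arg_exp_of_mem (h.peak_mem hξ)]
  refine ⟨hshape.peak_pos hs,
    fun θ hθ hne => hshape.lt_peak hs hθ (ne_of_apply_ne (fun x : ℝ => exp (x * I)) hne),
    hshape.deriv_peak hs, hshape.deriv_deriv_peak_neg hs, fun θ hθ hderiv => ?_⟩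
  rw [arg_exp_of_mem hθ] at hderiv
  exact (hshape.eq_or_eq_of_deriv_eq_zero θ hθ hderiv).imp (congrArg fun x : ℝ => exp (x * I))
    (congrArg fun x : ℝ => exp (x * I))

lemma neg_lastGap_of_le
    (h : IsValleyPeakFamily (η (2 * ℓ)).arg Real.pi ξ₀ ξ₁ (imV η ℓ B C) b s) (hξ : ξ ≤ ξ₀) :
    ∀ z ∈ lastGap η ℓ, (V η ℓ B C ξ z).im < 0 ∧
      (deriv (imV η ℓ B C ξ) z.arg = 0 → z = exp (b ξ * I)) :=
  forall_mem_lastGap.2 fun θ hθ => ⟨h.neg_of_le hξ hθ, fun hderiv => by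
    rw [h.eq_valley_of_deriv_eq_zero hξ hθ (arg_exp_of_mem hθ ▸ hderiv)]⟩

end IsValleyPeakFamily

lemma IsUpcrossing.signChange_lastGap {r : ℝ}
    (h : IsUpcrossing (η (2 * ℓ)).arg Real.pi (imV η ℓ B C ξ) r) :
    exp (r * I) ∈ lastGap η ℓ ∧ (V η ℓ B C ξ (exp (r * I))).im = 0 ∧
      (∀ z ∈ lastGap η ℓ, z.arg < (exp (r * I)).arg → (V η ℓ B C ξ z).im < 0) ∧
      ∀ z ∈ lastGap η ℓ, (exp (r * I)).arg < z.arg → 0 < (V η ℓ B C ξ z).im := by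
  rw [forall_mem_lastGap, forall_mem_lastGap, arg_exp_of_mem h.mem]
  refine ⟨exp_mem_lastGap h.mem, h.eq_zero, fun θ hθ hlt => ?_, fun θ hθ hlt => ?_⟩ <;>
    rw [arg_exp_of_mem hθ] at hlt
  exacts [h.neg θ ⟨hθ.1, hlt⟩, h.pos θ ⟨hlt, hθ.2⟩]

end LastGap

end DarkGas

theorem mainTheorem6 (N : ℕ) (η : ℕ → ℂ) (hη : IsSpectrum N η) (ℓ : ℕ) (hℓ : ℓ ∈ Set.Icc 1 N) :
    (∃! B : Fin (ℓ + 2) → ℝ, IsFirstCoeffs η ℓ B) ∧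
    (∃! C : Fin (ℓ + 3) → ℝ, IsSecondCoeffs η ℓ C) ∧
    ∀ (B : Fin (ℓ + 2) → ℝ) (C : Fin (ℓ + 3) → ℝ), IsFirstCoeffs η ℓ B → IsSecondCoeffs η ℓ C →
      ∃ ξ₀ < xiEven η ℓ B C, ∃ ρ s β : ℝ → ℂ,
        -- regularity along the gap, and the minimum, for all `ξ < ξ_{2ℓ}`
        (∀ ξ < xiEven η ℓ B C,
          ContDiffOn ℝ 2 (imV η ℓ B C ξ) (Set.Ioo (η (2 * ℓ)).arg Real.pi) ∧
          β ξ ∈ lastGap η ℓ ∧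
          (V η ℓ B C ξ (β ξ)).im < 0 ∧
          (∀ z ∈ lastGap η ℓ, z ≠ β ξ → (V η ℓ B C ξ (β ξ)).im < (V η ℓ B C ξ z).im) ∧
          deriv (imV η ℓ B C ξ) (β ξ).arg = 0 ∧
          0 < deriv (deriv (imV η ℓ B C ξ)) (β ξ).arg) ∧
        -- the sign change and the maximum, for `ξ₀ < ξ < ξ_{2ℓ}`
        (∀ ξ ∈ Set.Ioo ξ₀ (xiEven η ℓ B C),
          ρ ξ ∈ lastGap η ℓ ∧ s ξ ∈ lastGap η ℓ ∧
          (β ξ).arg < (ρ ξ).arg ∧ (ρ ξ).arg < (s ξ).arg ∧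
          (V η ℓ B C ξ (ρ ξ)).im = 0 ∧
          (∀ z ∈ lastGap η ℓ, z.arg < (ρ ξ).arg → (V η ℓ B C ξ z).im < 0) ∧
          (∀ z ∈ lastGap η ℓ, (ρ ξ).arg < z.arg → 0 < (V η ℓ B C ξ z).im) ∧
          0 < (V η ℓ B C ξ (s ξ)).im ∧
          (∀ z ∈ lastGap η ℓ, z ≠ s ξ → (V η ℓ B C ξ z).im < (V η ℓ B C ξ (s ξ)).im) ∧
          deriv (imV η ℓ B C ξ) (s ξ).arg = 0 ∧
          deriv (deriv (imV η ℓ B C ξ)) (s ξ).arg < 0 ∧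
          ∀ z ∈ lastGap η ℓ, deriv (imV η ℓ B C ξ) z.arg = 0 → z = β ξ ∨ z = s ξ) ∧
        -- after the collision at `-1` the sign change and the maximum have disappeared
        (∀ ξ ≤ ξ₀, ∀ z ∈ lastGap η ℓ, (V η ℓ B C ξ z).im < 0 ∧
          (deriv (imV η ℓ B C ξ) z.arg = 0 → z = β ξ)) ∧
        -- monotonicity and limits
        StrictAntiOn (fun ξ => (β ξ).arg) (Set.Iio (xiEven η ℓ B C)) ∧
        StrictAntiOn (fun ξ => (s ξ).arg) (Set.Ioo ξ₀ (xiEven η ℓ B C)) ∧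
        StrictAntiOn (fun ξ => (ρ ξ).arg) (Set.Ioo ξ₀ (xiEven η ℓ B C)) ∧
        Filter.Tendsto s (nhdsWithin ξ₀ (Set.Ioi ξ₀)) (nhds (-1)) ∧
        Filter.Tendsto ρ (nhdsWithin ξ₀ (Set.Ioi ξ₀)) (nhds (-1)) ∧
        -- the next odd transition value is well defined
        (ℓ < N →
          (∃! ξ : ℝ, ξ ∈ Set.Ioo ξ₀ (xiEven η ℓ B C) ∧ ρ ξ = η (2 * ℓ + 1)) ∧
          ∀ ξ ∈ Set.Ioo ξ₀ (xiEven η ℓ B C), ρ ξ = η (2 * ℓ + 1) → ξ = xiOdd η ℓ B C) := by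
  refine ⟨hη.existsUnique_isFirstCoeffs hℓ, hη.existsUnique_isSecondCoeffs hℓ,
    fun B C hB hC => ?_⟩
  obtain ⟨ξ₀, b, s, hfamily⟩ := hη.exists_isValleyPeakFamily hℓ hB hC
  obtain ⟨ρ, hρ⟩ := hfamily.exists_upcrossings
  have hcross := fun ξ hξ => (hρ ξ hξ).2
  have arg_valley := fun ξ hξ => arg_exp_of_mem (hfamily.valley_mem (ξ := ξ) hξ)
  have arg_peak := fun ξ hξ => arg_exp_of_mem (hfamily.peak_mem (ξ := ξ) hξ)
  have arg_cross := fun ξ hξ => arg_exp_of_mem (hcross ξ hξ).mem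
  refine ⟨ξ₀, hfamily.lt, fun ξ => Complex.exp (ρ ξ * Complex.I),
    fun ξ => Complex.exp (s ξ * Complex.I), fun ξ => Complex.exp (b ξ * Complex.I),
    fun ξ hξ => ⟨(hfamily.isValleyPeak ξ).contDiffOn, hfamily.minimum_lastGap hξ⟩,
    fun ξ hξ => ?_, fun ξ hξ => hfamily.neg_lastGap_of_le hξ,
    hfamily.strictAntiOn_valley.congr fun ξ hξ => (arg_valley ξ hξ).symm,
    (hfamily.strictAntiOn_peak.mono Set.Ioo_subset_Ioi_self).congr
      fun ξ hξ => (arg_peak ξ hξ.1).symm,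
    (hfamily.strictAntiOn_upcrossing hcross).congr fun ξ hξ => (arg_cross ξ hξ).symm,
    tendsto_exp_mul_I_neg_one hfamily.tendsto_peak,
    tendsto_exp_mul_I_neg_one (hfamily.tendsto_upcrossing hcross), fun hlt => ?_⟩
  · obtain ⟨hmem, hzero, hneg, hpos⟩ := (hcross ξ hξ).signChange_lastGap
    refine ⟨hmem, exp_mem_lastGap (hfamily.peak_mem hξ.1), ?_, ?_, hzero, hneg, hpos,
      hfamily.maximum_lastGap hξ.1⟩
    exacts [by simpa only [arg_valley ξ hξ.2, arg_cross ξ hξ] using (hρ ξ hξ).1.1,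
      by simpa only [arg_cross ξ hξ, arg_peak ξ hξ.1] using (hρ ξ hξ).1.2]
  · have hnorm : ‖η (2 * ℓ + 1)‖ = 1 := hη.norm_eq _ ⟨by omega, by omega⟩
    have hiff := fun ξ hξ => exp_mul_I_eq_iff hnorm (hcross ξ hξ).mem
    refine ⟨(existsUnique_congr fun ξ => and_congr_right (hiff ξ)).2
      (hfamily.existsUnique_upcrossing_eq hcross (hη.arg_succ_mem_Ioo hℓ hlt)), fun ξ hξ h => ?_⟩
    exact hη.eq_xiOdd_of_imV_eq_zero hℓ hB hC hlt ((hiff ξ hξ).1 h ▸ (hcross ξ hξ).eq_zero)
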